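/- Let $\mathbb K$ be a real composition algebra (nonzero, unital, not necessarily associative, with a nondegenerate quadratic form satisfying $|xy|^2=|x|^2|y|^2$) whose form is positive definite; by Hurwitz's theorem these are $\mathbb R,\mathbb C,\mathbb H,\mathbb O$. Write $L_x,R_x$ for left and right multiplications, $\operatorname{Der}$ for derivation algebras, $\langle x,y\rangle=\tfrac12(|x+y|^2-|x|^2-|y|^2)$, $D_{x,y}=[L_x,L_y]+[L_x,R_y]+[R_x,R_y]$, and $X^\dagger$ for the conjugate transpose. Let $H_3(\mathbb K)$ be the algebra of hermitian $3\times3$ matrices with product $A\cdot B=AB+BA$, $H_3'(\mathbb K)$ its traceless part and $A_3'(\mathbb K)$ the space of traceless antihermitian $3\times 3$ matrices. For a composition algebra $\mathbb K_2$ with imaginary part $\mathbb K_2'=1^\perp$, let $$L_3(\mathbb K,\mathbb K_2)=\operatorname{Der}H_3(\mathbb K)\,\dot+\,H_3'(\mathbb K)\otimes\mathbb K_2'\,\dot+\,\operatorname{Der}\mathbb K_2$$ with Tits's brackets: the commutators on $\operatorname{Der}H_3(\mathbb K)$ and $\operatorname{Der}\mathbb K_2$, and, for $T\in\operatorname{Der}H_3(\mathbb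 K)$, $E\in\operatorname{Der}\mathbb K_2$, $[T,E]=0$, $[T,A\otimes x]=T(A)\otimes x$, $[E,A\otimes x]=A\otimes E(x)$, $$[A\otimes x,B\otimes y]=\tfrac16\langle A,B\rangle D_{x,y}+(A*B)\otimes\tfrac12[x,y]-\langle x,y\rangle[L_A,L_B],$$ where $\langle A,B\rangle=\operatorname{Re}\operatorname{tr}(A\cdot B)$ and $A*B=A\cdot B-\tfrac13\operatorname{tr}(A\cdot B)I$. Let $\mathfrak{sa}(3,\mathbb K)$, $\mathfrak{sl}(3,\mathbb K)$, $\mathfrak{sp}(6,\mathbb K)$ be the spaces of formal sums $X+DI$ with $D\in\operatorname{Der}\mathbb K$ and $X$ a traceless matrix over $\mathbb K$ which is, respectively, $3\times3$ with $X^\dagger=-X$; $3\times3$ arbitrary; $6\times6$ with $X^\dagger J+JX=0$, $J=\begin{pmatrix}0&I\\-I&0\end{pmatrix}$. Their bracket, for matrices of size $N$, is: $[DI,EI]=[D,E]I$, $[DI,X]=D(X)$ (entrywise), and $$[X,Y]=XY-YX-\tfrac1N\operatorname{tr}(XY-YX)\,I+\tfrac1N\Big(\sum_{i,j}D_{x_{ij},y_{ji}}\Big)I.$$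 Let $\tilde{\mathbb C}=\mathbb R+\mathbb R\tilde i$ with $\tilde i^2=1$, and let $\tilde{\mathbb H}$ be the split quaternions, $\tilde i^2=\tilde j^2=1$, $\tilde k=\tilde i\tilde j=-\tilde j\tilde i$. Then all the spaces $L_3(\mathbb K,\mathbb R)$, $L_3(\mathbb K,\tilde{\mathbb C})$, $L_3(\mathbb K,\tilde{\mathbb H})$, $\mathfrak{sa}(3,\mathbb K)$, $\mathfrak{sl}(3,\mathbb K)$, $\mathfrak{sp}(6,\mathbb K)$ are closed under these brackets and are Lie algebras, and there are Lie algebra isomorphisms $$\psi:L_3(\mathbb K,\mathbb R)\cong\mathfrak{sa}(3,\mathbb K),\qquad \varphi:L_3(\mathbb K,\tilde{\mathbb C})\cong\mathfrak{sl}(3,\mathbb K),\qquad \chi:L_3(\mathbb K,\tilde{\mathbb H})\cong\mathfrak{sp}(6,\mathbb K)$$ given as follows. For $A\in A_3'(\mathbb K)$ and $D\in\operatorname{Der}\mathbb K$ the map $T_{A,D}:X\mapsto AX-XA+D(X)$ is a derivation of $H_3(\mathbb K)$, and for $H,H_1,H_2,H_3\in H_3'(\mathbb K)$, $r_1,r_2,r_3\in\mathbb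 R$, with $C_a(x)=ax-xa$ and $S_m=H_m+r_mI$, $$\psi(T_{A,D})=A+DI,\qquad \varphi(T_{A,D}+H\otimes\tilde i)=A+H+DI,$$ $$\chi\big(T_{A,D}+H_1\otimes\tilde i+H_2\otimes\tilde j+H_3\otimes\tilde k+r_1C_{\tilde i}+r_2C_{\tilde j}+r_3C_{\tilde k}\big)=\begin{pmatrix}A+S_1&S_2+S_3\\S_2-S_3&A-S_1\end{pmatrix}+DI.$$ -/

import Mathlib

open scoped TensorProduct Quaternion

set_option linter.unusedSectionVars false
set_option linter.flexible false

/-! ## Composition algebras -/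

/-- A real composition algebra: a nonzero, not necessarily associative, unital real algebra with a
nondegenerate quadratic form `x ↦ |x|²` that satisfies `|x y|² = |x|² |y|²`. -/
class CompositionAlgebra (K : Type*) [NonAssocRing K] [Module ℝ K] where
  normSq : QuadraticForm ℝ K
  normSq_mul : ∀ x y : K, normSq (x * y) = normSq x * normSq y
  nondegenerate : ∀ x : K, (∀ y : K, QuadraticMap.polar normSq x y = 0) → x = 0
  one_ne_zero : (1 : K) ≠ 0

namespace CompositionAlgebra

section General

variable (K : Type*) [NonAssocRing K] [Module ℝ K] [IsScalarTower ℝ K K] [SMulCommClass ℝ K K]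
  [CompositionAlgebra K]

/-- `⟨x, y⟩ = ½ (|x + y|² - |x|² - |y|²)`. -/
noncomputable def form : K →ₗ[ℝ] K →ₗ[ℝ] ℝ :=
  (1 / 2 : ℝ) • QuadraticMap.polarBilin (normSq (K := K))

/-- The real part, `Re x = ⟨x, 1⟩`. -/
noncomputable def re : K →ₗ[ℝ] ℝ := (form K).flip 1

/-- The conjugation, `x̄ = 2 Re x - x`. -/
noncomputable def conj : K →ₗ[ℝ] K := (2 : ℝ) • (re K).smulRight (1 : K) - LinearMap.id

/-- The space `K'` of imaginary elements: the orthogonal complement of `ℝ 1`. -/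
noncomputable def imag : Submodule ℝ K := LinearMap.ker (re K)

variable {K}

theorem form_apply (x y : K) :
    form K x y = (1 / 2) * (normSq (x + y) - normSq x - normSq y) := by
  simp [form, QuadraticMap.polar]

theorem form_comm (x y : K) : form K x y = form K y x := by
  rw [form_apply, form_apply, add_comm x y]; ring

theorem conj_apply (x : K) : conj K x = (2 * form K x 1) • (1 : K) - x := by
  simp [conj, re, smul_smul]

theorem ext_form {x y : K} (h : ∀ z, form K x z = form K y z) : x = y := by
  rw [← sub_eq_zero]
  apply nondegenerate
  intro z
  have h1 : form K (x - y) z = 0 := by rw [map_sub, LinearMap.sub_apply, h z, sub_self]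
  rw [form_apply] at h1
  simp only [QuadraticMap.polar]
  linarith

theorem normSq_one : normSq (1 : K) = 1 := by
  have h : ∀ x : K, normSq x * (normSq (1 : K) - 1) = 0 := fun x => by
    have := normSq_mul x 1
    rw [mul_one] at this
    linarith
  by_contra hne
  have h0 : ∀ x : K, normSq x = 0 := fun x =>
    (mul_eq_zero.mp (h x)).resolve_right (sub_ne_zero.mpr hne)
  exact one_ne_zero (K := K) (nondegenerate 1 fun y => by simp [QuadraticMap.polar, h0])

theorem form_mul_left (x y z : K) : form K (x * y) (x * z) = normSq x * form K y z := by
  rw [form_apply, form_apply, ← mul_add, normSq_mul, normSq_mul, normSq_mul]; ring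

theorem form_mul_right (x y z : K) : form K (y * x) (z * x) = normSq x * form K y z := by
  rw [form_apply, form_apply, ← add_mul, normSq_mul, normSq_mul, normSq_mul]; ring

theorem normSq_add (x y : K) : normSq (x + y) = normSq x + normSq y + 2 * form K x y := by
  rw [form_apply]; ring

theorem form_conj_right (x y z : K) : form K (x * y) z = form K x (z * conj K y) := by
  have h := form_mul_right (y + 1) x z
  have h1 := form_mul_right y x z
  rw [normSq_add, normSq_one] at h
  simp only [mul_add, map_add, LinearMap.add_apply, mul_one, h1] at h
  rw [conj_apply, mul_sub, mul_smul_comm, mul_one, map_sub, map_smul, smul_eq_mul]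
  linarith

theorem form_conj_left (x y z : K) : form K (x * y) z = form K y (conj K x * z) := by
  have h := form_mul_left (x + 1) y z
  have h1 := form_mul_left x y z
  rw [normSq_add, normSq_one] at h
  simp only [add_mul, map_add, LinearMap.add_apply, one_mul, h1] at h
  rw [conj_apply, sub_mul, smul_mul_assoc, one_mul, map_sub, map_smul, smul_eq_mul]
  linarith

theorem form_one_one : form K (1 : K) 1 = 1 := by
  have h : normSq ((1 : K) + 1) = 4 := by
    rw [← two_smul ℝ (1 : K), QuadraticMap.map_smul, normSq_one]; norm_num
  rw [form_apply, h, normSq_one]; norm_num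

theorem form_conj (x y : K) : form K (conj K x) y = form K x (conj K y) := by
  simp only [conj_apply, map_sub, map_smul, LinearMap.sub_apply, LinearMap.smul_apply, smul_eq_mul]
  rw [form_comm 1 y]; ring

theorem conj_mul (x y : K) : conj K (x * y) = conj K y * conj K x := by
  refine ext_form fun z => ?_
  rw [form_conj, form_conj_left x, form_conj_left (conj K y), form_comm (conj K x)]
  have hc : conj K (conj K y) = y := by
    simp only [conj_apply, map_sub, map_smul, form_one_one]
    module
  rw [hc, form_conj_right y z]

end General

end CompositionAlgebra

/-! ## The algebras `ℝ`, `ℂ`, `ℍ`, `𝕆` -/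

/-- A quadratic form on a real module given by a function that is the diagonal of a bilinear
map. -/
def quadOfBilin {V : Type*} [AddCommGroup V] [Module ℝ V] (B : V → V → ℝ)
    (h1 : ∀ x y z, B (x + y) z = B x z + B y z) (h2 : ∀ (c : ℝ) x z, B (c • x) z = c * B x z)
    (h3 : ∀ x y z, B x (y + z) = B x y + B x z) (h4 : ∀ (c : ℝ) x z, B x (c • z) = c * B x z) :
    QuadraticForm ℝ V :=
  LinearMap.BilinMap.toQuadraticMap (LinearMap.mk₂ ℝ B h1 h2 h3 h4)

theorem of_polar_quadOfBilin {V : Type*} [AddCommGroup V] [Module ℝ V] {B : V → V → ℝ}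
    {h1 : ∀ x y z, B (x + y) z = B x z + B y z} {h2 : ∀ (c : ℝ) x z, B (c • x) z = c * B x z}
    {h3 : ∀ x y z, B x (y + z) = B x y + B x z} {h4 : ∀ (c : ℝ) x z, B x (c • z) = c * B x z}
    {x y : V} (h : QuadraticMap.polar (quadOfBilin B h1 h2 h3 h4) x y = 0) :
    B x y + B y x = 0 := by
  simp only [quadOfBilin, QuadraticMap.polar, LinearMap.BilinMap.toQuadraticMap_apply,
    LinearMap.mk₂_apply, h1, h3] at h
  linarith

namespace CompositionAlgebra

noncomputable instance instReal : CompositionAlgebra ℝ where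
  normSq := quadOfBilin (fun x y => x * y)
    (by intros; ring) (by intros; simp; ring) (by intros; ring) (by intros; simp; ring)
  normSq_mul x y := by simp [quadOfBilin]; ring
  nondegenerate x h := by
    have h1 := of_polar_quadOfBilin (h 1)
    linarith
  one_ne_zero := by norm_num

noncomputable instance instComplex : CompositionAlgebra ℂ where
  normSq := quadOfBilin (fun x y => x.re * y.re + x.im * y.im)
    (by intros; simp; ring) (by intros; simp; ring) (by intros; simp; ring) (by intros; simp; ring)
  normSq_mul x y := by simp [quadOfBilin]; ring
  nondegenerate x h := by
    have h1 := of_polar_quadOfBilin (h 1)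
    have h2 := of_polar_quadOfBilin (h Complex.I)
    simp at h1 h2
    exact Complex.ext (by simp; linarith) (by simp; linarith)
  one_ne_zero := by norm_num

noncomputable instance instQuaternion : CompositionAlgebra ℍ[ℝ] where
  normSq := quadOfBilin
    (fun x y => x.re * y.re + x.imI * y.imI + x.imJ * y.imJ + x.imK * y.imK)
    (by intros; simp; ring) (by intros; simp; ring) (by intros; simp; ring) (by intros; simp; ring)
  normSq_mul x y := by simp [quadOfBilin]; ring
  nondegenerate x h := by
    have h1 := of_polar_quadOfBilin (h ⟨1, 0, 0, 0⟩)
    have h2 := of_polar_quadOfBilin (h ⟨0, 1, 0, 0⟩)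
    have h3 := of_polar_quadOfBilin (h ⟨0, 0, 1, 0⟩)
    have h4 := of_polar_quadOfBilin (h ⟨0, 0, 0, 1⟩)
    simp at h1 h2 h3 h4
    exact QuaternionAlgebra.ext (by simp; linarith) (by simp; linarith) (by simp; linarith)
      (by simp; linarith)
  one_ne_zero := by norm_num

end CompositionAlgebra

/-- The octonions, obtained from the quaternions by the Cayley-Dickson process. -/
def Octonion : Type := ℍ[ℝ] × ℍ[ℝ]

namespace Octonion

noncomputable instance : AddCommGroup Octonion := inferInstanceAs (AddCommGroup (ℍ[ℝ] × ℍ[ℝ]))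
noncomputable instance : Module ℝ Octonion := inferInstanceAs (Module ℝ (ℍ[ℝ] × ℍ[ℝ]))

/-- `(a, b) (c, d) = (a c - d̄ b, d a + b c̄)`. -/
noncomputable instance : Mul Octonion where
  mul x y := (x.1 * y.1 - star y.2 * x.2, y.2 * x.1 + x.2 * star y.1)

noncomputable instance : One Octonion where
  one := ((1, 0) : ℍ[ℝ] × ℍ[ℝ])

@[ext] theorem ext {x y : Octonion} (h1 : x.1 = y.1) (h2 : x.2 = y.2) : x = y := Prod.ext h1 h2
@[simp] theorem fst_mul (x y : Octonion) : (x * y).1 = x.1 * y.1 - star y.2 * x.2 := rfl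
@[simp] theorem snd_mul (x y : Octonion) : (x * y).2 = y.2 * x.1 + x.2 * star y.1 := rfl
@[simp] theorem fst_add (x y : Octonion) : (x + y).1 = x.1 + y.1 := rfl
@[simp] theorem snd_add (x y : Octonion) : (x + y).2 = x.2 + y.2 := rfl
@[simp] theorem fst_zero : (0 : Octonion).1 = 0 := rfl
@[simp] theorem snd_zero : (0 : Octonion).2 = 0 := rfl
@[simp] theorem fst_one : (1 : Octonion).1 = 1 := rfl
@[simp] theorem snd_one : (1 : Octonion).2 = 0 := rfl
@[simp] theorem fst_smul (r : ℝ) (x : Octonion) : (r • x).1 = r • x.1 := rfl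
@[simp] theorem snd_smul (r : ℝ) (x : Octonion) : (r • x).2 = r • x.2 := rfl

noncomputable instance : NonAssocRing Octonion where
  left_distrib x y z := by ext <;> simp <;> ring
  right_distrib x y z := by ext <;> simp <;> ring
  zero_mul x := by ext <;> simp
  mul_zero x := by ext <;> simp
  one_mul x := by ext <;> simp
  mul_one x := by ext <;> simp

instance : IsScalarTower ℝ Octonion Octonion where
  smul_assoc r x y := by ext <;> simp <;> ring

instance : SMulCommClass ℝ Octonion Octonion where
  smul_comm r x y := by ext <;> simp <;> ring

end Octonion

namespace CompositionAlgebra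

noncomputable instance instOctonion : CompositionAlgebra Octonion where
  normSq := quadOfBilin
    (fun x y => (x.1.re * y.1.re + x.1.imI * y.1.imI + x.1.imJ * y.1.imJ + x.1.imK * y.1.imK)
      + (x.2.re * y.2.re + x.2.imI * y.2.imI + x.2.imJ * y.2.imJ + x.2.imK * y.2.imK))
    (by intros; simp; ring) (by intros; simp; ring) (by intros; simp; ring) (by intros; simp; ring)
  normSq_mul x y := by simp [quadOfBilin]; ring
  nondegenerate x h := by
    have h1 := of_polar_quadOfBilin (h (⟨1, 0, 0, 0⟩, 0))
    have h2 := of_polar_quadOfBilin (h (⟨0, 1, 0, 0⟩, 0))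
    have h3 := of_polar_quadOfBilin (h (⟨0, 0, 1, 0⟩, 0))
    have h4 := of_polar_quadOfBilin (h (⟨0, 0, 0, 1⟩, 0))
    have h5 := of_polar_quadOfBilin (h (0, ⟨1, 0, 0, 0⟩))
    have h6 := of_polar_quadOfBilin (h (0, ⟨0, 1, 0, 0⟩))
    have h7 := of_polar_quadOfBilin (h (0, ⟨0, 0, 1, 0⟩))
    have h8 := of_polar_quadOfBilin (h (0, ⟨0, 0, 0, 1⟩))
    simp at h1 h2 h3 h4 h5 h6 h7 h8
    exact Octonion.ext
      (QuaternionAlgebra.ext (by simp; linarith) (by simp; linarith)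
        (by simp; linarith) (by simp; linarith))
      (QuaternionAlgebra.ext (by simp; linarith) (by simp; linarith)
        (by simp; linarith) (by simp; linarith))
  one_ne_zero h := by
    have := congrArg (fun x : Octonion => x.1) h
    simp at this

end CompositionAlgebra

/-! ## The split algebras -/

/-- The split complex numbers: `ℝ + ℝ i` with `i² = 1`. -/
abbrev SplitComplex : Type := QuadraticAlgebra ℝ 1 0

/-- The split quaternions: `i² = j² = 1`, `k = i j = - j i`, hence `k² = -1`. -/
abbrev SplitQuaternion : Type := ℍ[ℝ, 1, 0, 1]

/-- The imaginary unit of the split complex numbers. -/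
def SplitComplex.i : SplitComplex := ⟨0, 1⟩

/-- The imaginary units of the split quaternions. -/
def SplitQuaternion.i : SplitQuaternion := ⟨0, 1, 0, 0⟩
def SplitQuaternion.j : SplitQuaternion := ⟨0, 0, 1, 0⟩
def SplitQuaternion.k : SplitQuaternion := ⟨0, 0, 0, 1⟩

namespace CompositionAlgebra

noncomputable instance instSplitComplex : CompositionAlgebra SplitComplex where
  normSq := quadOfBilin (fun x y => x.re * y.re - x.im * y.im)
    (by intros; simp; ring) (by intros; simp; ring) (by intros; simp; ring) (by intros; simp; ring)
  normSq_mul x y := by simp [quadOfBilin]; ring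
  nondegenerate x h := by
    have h1 := of_polar_quadOfBilin (h ⟨1, 0⟩)
    have h2 := of_polar_quadOfBilin (h ⟨0, 1⟩)
    simp at h1 h2
    exact QuadraticAlgebra.ext (by simp; linarith) (by simp; linarith)
  one_ne_zero h := by
    have := congrArg QuadraticAlgebra.re h
    rw [QuadraticAlgebra.re_one] at this
    exact absurd this (by simp)

noncomputable instance instSplitQuaternion : CompositionAlgebra SplitQuaternion where
  normSq := quadOfBilin
    (fun x y => x.re * y.re - x.imI * y.imI - x.imJ * y.imJ + x.imK * y.imK)
    (by intros; simp; ring) (by intros; simp; ring) (by intros; simp; ring) (by intros; simp; ring)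
  normSq_mul x y := by simp [quadOfBilin]; ring
  nondegenerate x h := by
    have h1 := of_polar_quadOfBilin (h ⟨1, 0, 0, 0⟩)
    have h2 := of_polar_quadOfBilin (h ⟨0, 1, 0, 0⟩)
    have h3 := of_polar_quadOfBilin (h ⟨0, 0, 1, 0⟩)
    have h4 := of_polar_quadOfBilin (h ⟨0, 0, 0, 1⟩)
    simp at h1 h2 h3 h4
    exact QuaternionAlgebra.ext (by simp; linarith) (by simp; linarith) (by simp; linarith)
      (by simp; linarith)
  one_ne_zero h := by
    have := congrArg QuaternionAlgebra.re h
    simp at this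

end CompositionAlgebra

/-! ## Lie algebras cut out of a space with a bilinear bracket -/

/-- The subspace `L` is closed under the bilinear bracket `b`, and `b` makes it a Lie algebra. -/
structure IsLie {V : Type*} [AddCommGroup V] [Module ℝ V] (b : V →ₗ[ℝ] V →ₗ[ℝ] V)
    (L : Submodule ℝ V) : Prop where
  closed : ∀ x ∈ L, ∀ y ∈ L, b x y ∈ L
  self : ∀ x ∈ L, b x x = 0
  jacobi : ∀ x ∈ L, ∀ y ∈ L, ∀ z ∈ L, b x (b y z) = b (b x y) z + b y (b x z)

namespace IsLie

variable {V : Type*} [AddCommGroup V] [Module ℝ V] {b : V →ₗ[ℝ] V →ₗ[ℝ] V} {L : Submodule ℝ V}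

/-- The Lie algebra with underlying space `L` and bracket `b`. -/
def Carrier (_ : IsLie b L) : Type _ := L

variable (h : IsLie b L)

instance : AddCommGroup h.Carrier := inferInstanceAs (AddCommGroup L)
instance : Module ℝ h.Carrier := inferInstanceAs (Module ℝ L)

/-- The inclusion of the Lie algebra `L` in the ambient space. -/
def val : h.Carrier →ₗ[ℝ] V := L.subtype

instance : LieRing h.Carrier where
  bracket x y := ⟨b (h.val x) (h.val y), h.closed _ x.2 _ y.2⟩
  add_lie x y z := Subtype.ext (by simp; rfl)
  lie_add x y z := Subtype.ext (by simp; rfl)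
  lie_self x := Subtype.ext (h.self _ x.2)
  leibniz_lie x y z := Subtype.ext (h.jacobi _ x.2 _ y.2 _ z.2)

instance : LieAlgebra ℝ h.Carrier where
  lie_smul r x y := Subtype.ext (by simp [Bracket.bracket]; rfl)

end IsLie

/-- `[a, b] = a b - b a` in a not necessarily associative algebra. -/
def commBr (A : Type*) [NonUnitalNonAssocRing A] [Module ℝ A] [IsScalarTower ℝ A A]
    [SMulCommClass ℝ A A] : A →ₗ[ℝ] A →ₗ[ℝ] A :=
  LinearMap.mul ℝ A - (LinearMap.mul ℝ A).flip

/-- The derivations of the algebra with underlying space `V` and product `m`. -/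
def derivations {V : Type*} [AddCommGroup V] [Module ℝ V] (m : V →ₗ[ℝ] V →ₗ[ℝ] V) :
    Submodule ℝ (Module.End ℝ V) where
  carrier := {D | ∀ x y, D (m x y) = m (D x) y + m x (D y)}
  add_mem' {D E} hD hE x y := by
    simp only [Set.mem_ofPred_eq] at hD hE
    simp only [LinearMap.add_apply, hD, hE, map_add]; abel
  zero_mem' x y := by simp
  smul_mem' c D hD x y := by
    simp only [Set.mem_ofPred_eq] at hD
    simp [hD]

namespace CompositionAlgebra

section Algebras

variable (K : Type*) [NonAssocRing K] [Module ℝ K] [IsScalarTower ℝ K K] [SMulCommClass ℝ K K]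
  [CompositionAlgebra K]

/-- The Lie algebra `Der K`, as a space of endomorphisms of `K`. -/
def der : Submodule ℝ (Module.End ℝ K) := derivations (LinearMap.mul ℝ K)

/-- `D_{x,y} = [L_x, L_y] + [L_x, R_y] + [R_x, R_y]`. -/
def innerDer : K →ₗ[ℝ] K →ₗ[ℝ] Module.End ℝ K :=
  (commBr (Module.End ℝ K)).compl₁₂ (LinearMap.mul ℝ K) (LinearMap.mul ℝ K)
    + (commBr (Module.End ℝ K)).compl₁₂ (LinearMap.mul ℝ K) (LinearMap.mul ℝ K).flip
    + (commBr (Module.End ℝ K)).compl₁₂ (LinearMap.mul ℝ K).flip (LinearMap.mul ℝ K).flip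

/-! ### Matrices over a composition algebra -/

section Matrices

variable (n : Type*) [Fintype n] [DecidableEq n]

/-- The hermitian conjugate, `(X†)_{ij} = conj (X_{ji})`. -/
noncomputable def dagger : Matrix n n K →ₗ[ℝ] Matrix n n K where
  toFun X := (X.map (conj K)).transpose
  map_add' X Y := by ext; simp
  map_smul' c X := by ext; simp

/-- The space of hermitian matrices. -/
noncomputable def herm : Submodule ℝ (Matrix n n K) where
  carrier := {X | dagger K n X = X}
  add_mem' {X Y} hX hY := by
    simp only [Set.mem_ofPred_eq] at hX hY
    simp [hX, hY]
  zero_mem' := by simp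
  smul_mem' c X hX := by
    simp only [Set.mem_ofPred_eq] at hX
    simp [hX]

/-- The space of traceless matrices. -/
def traceless : Submodule ℝ (Matrix n n K) := LinearMap.ker (Matrix.traceLinearMap n ℝ K)

/-- The space of traceless antihermitian matrices. -/
noncomputable def antihermTraceless : Submodule ℝ (Matrix n n K) where
  carrier := {X | dagger K n X = -X ∧ X.trace = 0}
  add_mem' {X Y} hX hY := by
    simp only [Set.mem_ofPred_eq] at hX hY
    simp [hX, hY, add_comm]
  zero_mem' := by simp
  smul_mem' c X hX := by
    simp only [Set.mem_ofPred_eq] at hX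
    simp [hX]

variable {K n}

theorem dagger_mul (X Y : Matrix n n K) : dagger K n (X * Y) = dagger K n Y * dagger K n X := by
  ext i j
  simp [dagger, Matrix.mul_apply, conj_mul]

theorem conj_one : conj K (1 : K) = 1 := by
  rw [conj_apply, form_one_one]; module

theorem dagger_one : dagger K n (1 : Matrix n n K) = 1 := by
  ext i j
  by_cases h : i = j
  · subst h; simp [dagger, conj_one]
  · simp [dagger, h, Ne.symm h]

variable (K n)

/-- The Jordan product `X · Y = X Y + Y X` of hermitian matrices. -/
noncomputable def jordan : herm K n →ₗ[ℝ] herm K n →ₗ[ℝ] herm K n :=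
  LinearMap.mk₂ ℝ
    (fun X Y => ⟨X.1 * Y.1 + Y.1 * X.1, by
      have hX : dagger K n X.1 = X.1 := X.2
      have hY : dagger K n Y.1 = Y.1 := Y.2
      change dagger K n _ = _
      rw [map_add, dagger_mul, dagger_mul, hX, hY, add_comm]⟩)
    (fun X X' Y => Subtype.ext (by simp [add_mul, mul_add]; abel))
    (fun c X Y => Subtype.ext (by simp))
    (fun X Y Y' => Subtype.ext (by simp [add_mul, mul_add]; abel))
    (fun c X Y => Subtype.ext (by simp))

/-- The identity matrix as a hermitian matrix. -/
noncomputable def hermOne : herm K n := ⟨1, dagger_one⟩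

/-- The (real) trace of a hermitian matrix. -/
noncomputable def hermTrace : herm K n →ₗ[ℝ] ℝ :=
  re K ∘ₗ Matrix.traceLinearMap n ℝ K ∘ₗ (herm K n).subtype

/-- The space of traceless hermitian matrices. -/
noncomputable def hermTraceless : Submodule ℝ (herm K n) := (traceless K n).comap (herm K n).subtype

/-- `⟨A, B⟩ = Re (tr (A · B))`. -/
noncomputable def hermForm : herm K n →ₗ[ℝ] herm K n →ₗ[ℝ] ℝ := (jordan K n).compr₂ (hermTrace K n)

/-- `[L_A, L_B]`, where `L_A` is the multiplication by `A` in the Jordan algebra. -/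
noncomputable def jordanComm : herm K n →ₗ[ℝ] herm K n →ₗ[ℝ] Module.End ℝ (herm K n) :=
  (commBr (Module.End ℝ (herm K n))).compl₁₂ (jordan K n) (jordan K n)

/-- `A * B = A · B - (1/N) tr (A · B) I`, the traceless part of the Jordan product, for matrices of
size `N`. -/
noncomputable def starProd : herm K n →ₗ[ℝ] herm K n →ₗ[ℝ] herm K n :=
  (jordan K n).compr₂
    (LinearMap.id - (Fintype.card n : ℝ)⁻¹ • (hermTrace K n).smulRight (hermOne K n))

/-! ### The matrix Lie algebras -/

/-- The formal sums `X + D I` of a matrix `X` over `K` and a multiple `D I` of the identity matrix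
by an endomorphism `D` of `K`. -/
abbrev MatEnd : Type _ := Matrix n n K × Module.End ℝ K

/-- The bracket of the matrix Lie algebras, for matrices of size `N`:
`[X, Y] = (X Y - Y X) - (1/N) tr (X Y - Y X) I + (1/N) ∑ D_{x_{ij}, y_{ji}}`,
`[D, X] = D(X)` (entry by entry), `[D, E] = D E - E D`. -/
noncomputable def matBracket : MatEnd K n →ₗ[ℝ] MatEnd K n →ₗ[ℝ] MatEnd K n :=
  LinearMap.mk₂ ℝ
    (fun u v =>
      (u.1 * v.1 - v.1 * u.1
          - (Fintype.card n : ℝ)⁻¹ • Matrix.diagonal (fun _ => (u.1 * v.1 - v.1 * u.1).trace)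
          + v.1.map u.2 - u.1.map v.2,
        (Fintype.card n : ℝ)⁻¹ • ∑ i, ∑ j, innerDer K (u.1 i j) (v.1 j i) + commBr _ u.2 v.2))
    (fun u u' v => by
      refine Prod.ext ?_ ?_
      · ext i j
        by_cases h : i = j
        · subst h; simp [add_mul, mul_add, smul_sub]; abel
        · simp [add_mul, mul_add, h]; abel
      · simp [Finset.sum_add_distrib]; abel)
    (fun c u v => by
      refine Prod.ext ?_ ?_
      · ext i j
        by_cases h : i = j
        · subst h; simp [smul_sub, smul_comm c]
        · simp [smul_sub, h]
      · simp [← Finset.smul_sum, smul_comm c])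
    (fun u v v' => by
      refine Prod.ext ?_ ?_
      · ext i j
        by_cases h : i = j
        · subst h; simp [add_mul, mul_add, smul_sub]; abel
        · simp [add_mul, mul_add, h]; abel
      · simp [Finset.sum_add_distrib]; abel)
    (fun c u v => by
      refine Prod.ext ?_ ?_
      · ext i j
        by_cases h : i = j
        · subst h; simp [smul_sub, smul_comm c]
        · simp [smul_sub, h]
      · simp [← Finset.smul_sum, smul_comm c])

/-- `sa(N, K)`: the sums `X + D I` with `X† = - X`, `tr X = 0`, `D ∈ Der K`. -/
noncomputable def sa : Submodule ℝ (MatEnd K n) := (antihermTraceless K n).prod (der K)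

/-- `sl(N, K)`: the sums `X + D I` with `tr X = 0`, `D ∈ Der K`. -/
noncomputable def sl : Submodule ℝ (MatEnd K n) := (traceless K n).prod (der K)

/-- `J = (0, I; -I, 0)`. -/
def symplJ : Matrix (n ⊕ n) (n ⊕ n) K := Matrix.fromBlocks 0 1 (-1) 0

/-- The traceless matrices `X` of size `2 N` with `X† J + J X = 0`. -/
noncomputable def symplTraceless : Submodule ℝ (Matrix (n ⊕ n) (n ⊕ n) K) where
  carrier := {X | dagger K (n ⊕ n) X * symplJ K n + symplJ K n * X = 0 ∧ X.trace = 0}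
  add_mem' {X Y} hX hY := by
    simp only [Set.mem_ofPred_eq] at hX hY ⊢
    refine ⟨?_, by simp [hX.2, hY.2]⟩
    rw [map_add, add_mul, mul_add, add_add_add_comm, hX.1, hY.1, add_zero]
  zero_mem' := by simp
  smul_mem' c X hX := by
    simp only [Set.mem_ofPred_eq] at hX ⊢
    refine ⟨?_, by simp [hX.2]⟩
    rw [map_smul, smul_mul_assoc, mul_smul_comm, ← smul_add, hX.1, smul_zero]

/-- `sp(2 N, K)`: the sums `X + D I` with `X† J + J X = 0`, `tr X = 0`, `D ∈ Der K`. -/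
noncomputable def sp : Submodule ℝ (MatEnd K (n ⊕ n)) := (symplTraceless K n).prod (der K)

end Matrices

/-! ### The Lie algebras `L₃(K₁, K₂)` -/

/-- The Jordan algebra `H₃(K)` of hermitian `3 × 3` matrices. -/
abbrev H3 : Type _ := herm K (Fin 3)

/-- `Der H₃(K)`, the derivations of the Jordan algebra `H₃(K)`. -/
noncomputable def derH3 : Submodule ℝ (Module.End ℝ (H3 K)) := derivations (jordan K (Fin 3))

variable {K} in
/-- `T` is the endomorphism `X ↦ [A, X] + D(X)` of `H₃(K)`, with `D` acting entry by entry. -/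
def ActsAs (T : Module.End ℝ (H3 K)) (A : Matrix (Fin 3) (Fin 3) K) (D : Module.End ℝ K) : Prop :=
  ∀ X : H3 K, (T X : Matrix (Fin 3) (Fin 3) K) = A * X.1 - X.1 * A + X.1.map D

variable (K₁ : Type*) [NonAssocRing K₁] [Module ℝ K₁] [IsScalarTower ℝ K₁ K₁]
  [SMulCommClass ℝ K₁ K₁] [CompositionAlgebra K₁]
  (K₂ : Type*) [NonAssocRing K₂] [Module ℝ K₂] [IsScalarTower ℝ K₂ K₂]
  [SMulCommClass ℝ K₂ K₂] [CompositionAlgebra K₂]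

/-- The space `End H₃(K₁) ∔ H₃(K₁) ⊗ K₂ ∔ End K₂`, which contains `L₃(K₁, K₂)`. -/
abbrev TitsSpace : Type _ :=
  Module.End ℝ (H3 K₁) × (H3 K₁ ⊗[ℝ] K₂) × Module.End ℝ K₂

/-- `L₃(K₁, K₂) = Der H₃(K₁) ∔ H₃'(K₁) ⊗ K₂' ∔ Der K₂`. -/
noncomputable def L3 : Submodule ℝ (TitsSpace K₁ K₂) :=
  (derH3 K₁).prod
    ((LinearMap.range (TensorProduct.mapIncl (hermTraceless K₁ (Fin 3)) (imag K₂))).prod (der K₂))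

/-- `(A ⊗ x, B ⊗ y) ↦ ⟨x, y⟩ [L_A, L_B]`. -/
noncomputable def titsFst :
    H3 K₁ ⊗[ℝ] K₂ →ₗ[ℝ] H3 K₁ ⊗[ℝ] K₂ →ₗ[ℝ] Module.End ℝ (H3 K₁) :=
  (TensorProduct.map₂ (jordanComm K₁ (Fin 3)) (form K₂)).compr₂
    (TensorProduct.rid ℝ (Module.End ℝ (H3 K₁))).toLinearMap

/-- `(A ⊗ x, B ⊗ y) ↦ (A * B) ⊗ ½ [x, y]`. -/
noncomputable def titsSnd :
    H3 K₁ ⊗[ℝ] K₂ →ₗ[ℝ] H3 K₁ ⊗[ℝ] K₂ →ₗ[ℝ] H3 K₁ ⊗[ℝ] K₂ :=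
  TensorProduct.map₂ (starProd K₁ (Fin 3))
    ((1 / 2 : ℝ) • commBr K₂)

/-- `(A ⊗ x, B ⊗ y) ↦ (1/6) ⟨A, B⟩ D_{x,y}`. -/
noncomputable def titsThd :
    H3 K₁ ⊗[ℝ] K₂ →ₗ[ℝ] H3 K₁ ⊗[ℝ] K₂ →ₗ[ℝ] Module.End ℝ K₂ :=
  (TensorProduct.map₂ ((1 / 6 : ℝ) • hermForm K₁ (Fin 3)) (innerDer K₂)).compr₂
    (TensorProduct.lid ℝ (Module.End ℝ K₂)).toLinearMap

/-- Tits's bracket: `[D, A ⊗ x] = D(A) ⊗ x`, `[E, A ⊗ x] = A ⊗ E(x)`, `[D, E] = 0`,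
`[A ⊗ x, B ⊗ y] = (1/6) ⟨A, B⟩ D_{x,y} + (A * B) ⊗ ½ [x, y] - ⟨x, y⟩ [L_A, L_B]`
for `D ∈ Der H₃(K₁)`, `E ∈ Der K₂`, and commutators on `Der H₃(K₁)` and `Der K₂`. -/
noncomputable def titsBracket :
    TitsSpace K₁ K₂ →ₗ[ℝ] TitsSpace K₁ K₂ →ₗ[ℝ] TitsSpace K₁ K₂ :=
  LinearMap.mk₂ ℝ
    (fun u v =>
      (commBr _ u.1 v.1 - titsFst K₁ K₂ u.2.1 v.2.1,
        (u.1.rTensor K₂ v.2.1 + u.2.2.lTensor (H3 K₁) v.2.1)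
          - (v.1.rTensor K₂ u.2.1 + v.2.2.lTensor (H3 K₁) u.2.1) + titsSnd K₁ K₂ u.2.1 v.2.1,
        commBr _ u.2.2 v.2.2 + titsThd K₁ K₂ u.2.1 v.2.1))
    (fun u u' v => by
      refine Prod.ext ?_ (Prod.ext ?_ ?_) <;> simp [LinearMap.rTensor_add, LinearMap.lTensor_add] <;>
        abel)
    (fun c u v => by
      refine Prod.ext ?_ (Prod.ext ?_ ?_)
      · simp; exact (smul_sub c (commBr _ u.1 v.1) (titsFst K₁ K₂ u.2.1 v.2.1)).symm
      · simp [LinearMap.rTensor_smul, LinearMap.lTensor_smul, smul_sub]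
      · simp)
    (fun u v v' => by
      refine Prod.ext ?_ (Prod.ext ?_ ?_) <;> simp [LinearMap.rTensor_add, LinearMap.lTensor_add] <;>
        abel)
    (fun c u v => by
      refine Prod.ext ?_ (Prod.ext ?_ ?_)
      · simp; exact (smul_sub c (commBr _ u.1 v.1) (titsFst K₁ K₂ u.2.1 v.2.1)).symm
      · simp [LinearMap.rTensor_smul, LinearMap.lTensor_smul, smul_sub]
      · simp)

end Algebras

end CompositionAlgebra

/-! The heart of the matter is a description of the derivations of the Jordan algebra H₃(K) by
matrices. A composition algebra is alternative: its associator is alternating, vanishes on real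
arguments and changes sign when one argument is conjugated, and D_{x,y} z = [[x,y],z] - 3(x,y,z)
(`innerDer_apply`). With these rules, entrywise cancellation for 3×3 matrices gives three facts. The
map T_{A,D} is a derivation of H₃(K) (`act_mem_derH3`). The commutator of X ↦ [A,X] and X ↦ [B,X] is
the action of the matrix bracket of A and B (`comm_action_antiherm`). For hermitian A, B the same is
true of the commutator [L_A, L_B] of Jordan multiplications (`comm_action_herm`). The trace and
inner derivation terms of the matrix bracket are what the associators demand.

Conversely, a Peirce argument with the diagonal idempotents shows that each derivation of H₃(K) is
T_{A,D} for exactly one element A + DI of sa(3,K) (`exists_act_eq`, `act_injOn`). As L₃(K,ℝ) is just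
Der H₃(K), this is ψ. It also yields, without further computation, that sa(3,K) is closed, that
every D_{x,y} is a derivation and that every [L_A, L_B] is one. The last fact and the associative,
nondegenerate trace form imply the Jordan identity (`jordan_identity_of_form`).

For the split quaternions, I ⊗ x is identified with the inner derivation C_x = [x, ·]. All
derivations being inner, H₃' ⊗ K₂' ∔ Der K₂ becomes H₃ ⊗ K₂', and Tits's bracket becomes the
Tits-Kantor-Koecher bracket on Der H₃ ∔ H₃i ∔ H₃j ∔ H₃k, whose Jacobi identity rests on the
linearized Jordan identity (`tkkBracket_jacobi`). On the matrix side the units are real 2×2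
matrices, and sp(6,K) consists of the sums 1 ⊗ A + i ⊗ S₁ + j ⊗ S₂ + k ⊗ S₃ + DI; multiplying 2×2
matrices gives the same structure constants (`matBracket_matQuaternion`). The split complex case
keeps the unit i alone; there C_i = 0, so only traceless hermitian matrices occur, and A + H is the
splitting of a traceless matrix into antihermitian and hermitian parts.

The Jacobi identity is never checked for matrices: `IsLie.exists_lieEquiv_of_param` carries it over
from Tits's side. -/

namespace CompositionAlgebra

/-! ### Alternativity and the formula for inner derivations -/

section Alternative

variable {K : Type*} [NonAssocRing K] [Module ℝ K] [IsScalarTower ℝ K K] [SMulCommClass ℝ K K]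
  [CompositionAlgebra K]

theorem re_apply (x : K) : re K x = form K x 1 := rfl

theorem conj_eq (x : K) : conj K x = (2 * re K x) • (1 : K) - x := conj_apply x

theorem conj_conj (x : K) : conj K (conj K x) = x := by
  simp only [conj_apply, map_sub, map_smul, form_one_one]
  module

theorem re_one : re K (1 : K) = 1 := form_one_one

/-- L_x multiplies the form by |x|², and its adjoint is left multiplication by the conjugate of x;
nondegeneracy turns this into an identity in K. -/
theorem conj_mul_cancel_left (x y : K) : conj K x * (x * y) = normSq x • y := by
  refine ext_form fun z => ?_
  rw [form_comm, ← form_conj_left, form_mul_left, form_comm z y]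
  simp

theorem mul_conj_cancel_right (x y : K) : y * x * conj K x = normSq x • y := by
  refine ext_form fun z => ?_
  rw [form_comm, ← form_conj_right, form_mul_right, form_comm z y]
  simp

theorem conj_mul_self (x : K) : conj K x * x = normSq x • (1 : K) := by
  simpa using conj_mul_cancel_left x 1

theorem re_mul_conj (x y : K) : re K (x * conj K y) = form K x y := by
  rw [re_apply, form_conj_right, conj_conj, one_mul]

theorem re_mul_comm (x y : K) : re K (x * y) = re K (y * x) := by
  rw [re_apply, re_apply, form_conj_right, form_conj_left, mul_one, one_mul, form_comm,
    form_conj, form_comm]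

theorem re_associator (x y z : K) : re K (associator x y z) = 0 := by
  have h : re K (x * y * z) = re K (x * (y * z)) := by
    rw [re_mul_comm x (y * z), re_apply, re_apply, form_conj_right, form_conj_right (y * z) x,
      one_mul, one_mul, form_conj_left, ← form_conj_right]
  rw [associator, map_sub, h, sub_self]

theorem mul_self_eq (x : K) : x * x = (2 * re K x) • x - normSq x • (1 : K) := by
  have h := conj_mul_self x
  rw [conj_eq, sub_mul, smul_mul_assoc, one_mul] at h
  rw [← h]; abel

/-- Since x̄ = 2 Re x - x, this is `conj_mul_cancel_left` rewritten with the quadratic equation of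
x. -/
theorem associator_self_left (x y : K) : associator x x y = 0 := by
  have h := conj_mul_cancel_left x y
  rw [conj_eq, sub_mul, smul_mul_assoc, one_mul] at h
  rw [associator, mul_self_eq, sub_mul, smul_mul_assoc, smul_mul_assoc, one_mul, ← h]; abel

theorem associator_self_right (x y : K) : associator y x x = 0 := by
  have h := mul_conj_cancel_right x y
  rw [conj_eq, mul_sub, mul_smul_comm, mul_one] at h
  rw [associator, mul_self_eq, mul_sub, mul_smul_comm, mul_smul_comm, mul_one, ← h]; abel

section Multilinear

variable {R : Type*} [NonUnitalNonAssocRing R]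

theorem associator_add_left (x x' y z : R) :
    associator (x + x') y z = associator x y z + associator x' y z := by
  simp [associator, add_mul]; abel

theorem associator_add_mid (x y y' z : R) :
    associator x (y + y') z = associator x y z + associator x y' z := by
  simp [associator, add_mul, mul_add]; abel

theorem associator_add_right (x y z z' : R) :
    associator x y (z + z') = associator x y z + associator x y z' := by
  simp [associator, mul_add]; abel

theorem associator_neg_left (x y z : R) : associator (-x) y z = -associator x y z := by
  simp [associator]; abel

theorem associator_neg_mid (x y z : R) : associator x (-y) z = -associator x y z := by
  simp [associator]; abel

end Multilinear

theorem associator_swap_left (x y z : K) : associator y x z = -associator x y z := by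
  have h := associator_self_left (x + y) z
  rw [associator_add_left, associator_add_mid, associator_add_mid, associator_self_left,
    associator_self_left] at h
  rw [eq_neg_iff_add_eq_zero, ← h]; abel

theorem associator_swap_right (x y z : K) : associator x z y = -associator x y z := by
  have h := associator_self_right (y + z) x
  rw [associator_add_mid, associator_add_right, associator_add_right, associator_self_right,
    associator_self_right] at h
  rw [eq_neg_iff_add_eq_zero, ← h]; abel

theorem associator_rotate (x y z : K) : associator y z x = associator x y z := by
  rw [associator_swap_right, associator_swap_left, neg_neg]

theorem associator_smul_one_left (r : ℝ) (y z : K) : associator (r • (1 : K)) y z = 0 := by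
  simp [associator, smul_mul_assoc]

theorem associator_smul_one_mid (r : ℝ) (x z : K) : associator x (r • (1 : K)) z = 0 := by
  simp [associator, smul_mul_assoc, mul_smul_comm]

theorem associator_smul_one_right (r : ℝ) (x y : K) : associator x y (r • (1 : K)) = 0 := by
  simp [associator, mul_smul_comm]

theorem associator_conj_left (x y z : K) : associator (conj K x) y z = -associator x y z := by
  rw [conj_eq, sub_eq_add_neg, associator_add_left, associator_smul_one_left,
    associator_neg_left, zero_add]

theorem associator_conj_mid (x y z : K) : associator x (conj K y) z = -associator x y z := by
  rw [associator_swap_left, associator_conj_left, associator_swap_left y]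

theorem associator_conj_right (x y z : K) : associator x y (conj K z) = -associator x y z := by
  rw [associator_swap_right, associator_conj_mid, associator_swap_right x z]

/-- Each of the six products that occur can be rebracketed at the cost of one associator, and
alternation makes every such associator equal to ±(x,y,z). The signs add up to -3. -/
theorem innerDer_apply (x y z : K) :
    innerDer K x y z = (x * y - y * x) * z - z * (x * y - y * x) - (3 : ℝ) • associator x y z := by
  have h1 : innerDer K x y z = (x * (y * z) - y * (x * z)) + (x * (z * y) - (x * z) * y)
      + ((z * y) * x - (z * x) * y) := by
    simp [innerDer, commBr]
  have e1 : x * (y * z) = x * y * z - associator x y z := by simp [associator]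
  have e2 : y * (x * z) = y * x * z + associator x y z := by
    rw [← neg_eq_iff_eq_neg.mpr (associator_swap_left x y z)]; simp [associator]
  have e3 : x * (z * y) - (x * z) * y = associator x y z := by
    rw [← neg_eq_iff_eq_neg.mpr (associator_swap_right x y z)]; simp [associator]
  have e4 : (z * y) * x = z * (y * x) - associator x y z := by
    rw [associator_rotate z, ← neg_eq_iff_eq_neg.mpr (associator_swap_right z x y)]
    simp [associator]
  have e5 : (z * x) * y = z * (x * y) + associator x y z := by
    rw [associator_rotate z]; simp [associator]
  rw [h1, e3, e1, e2, e4, e5, sub_mul, mul_sub]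
  module

end Alternative

end CompositionAlgebra

namespace CompositionAlgebra

/-! ### Associator identities for 3×3 matrices -/

section MatrixAssociators

theorem matrix_associator_apply {n R : Type*} [Fintype n] [NonUnitalNonAssocRing R]
    (X Y Z : Matrix n n R) (i j : n) :
    associator X Y Z i j = ∑ k, ∑ l, associator (X i k) (Y k l) (Z l j) := by
  simp only [associator, Matrix.sub_apply, Matrix.mul_apply, Finset.sum_mul, Finset.mul_sum,
    Finset.sum_sub_distrib]
  rw [Finset.sum_comm]

variable {K : Type*} [NonAssocRing K] [Module ℝ K] [IsScalarTower ℝ K K] [SMulCommClass ℝ K K]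
  [CompositionAlgebra K] {n : Type*} [Fintype n] [DecidableEq n]

theorem eq_re_smul_one {x : K} (h : conj K x = x) : x = re K x • (1 : K) := by
  rw [conj_eq, sub_eq_iff_eq_add, ← two_smul ℝ x, mul_smul] at h
  exact (smul_right_injective K (two_ne_zero (α := ℝ)) h).symm

theorem dagger_apply (X : Matrix n n K) (i j : n) : dagger K n X i j = conj K (X j i) := rfl

theorem herm_apply {X : Matrix n n K} (h : dagger K n X = X) (i j : n) :
    X i j = conj K (X j i) := by
  conv_lhs => rw [← h]
  rfl

theorem herm_diag {X : Matrix n n K} (h : dagger K n X = X) (i : n) :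
    X i i = re K (X i i) • (1 : K) :=
  eq_re_smul_one (herm_apply h i i).symm

theorem antiherm_apply {X : Matrix n n K} (h : dagger K n X = -X) (i j : n) :
    X i j = -conj K (X j i) := by
  rw [← dagger_apply, h]; simp

/-- The associators that measure the failure of the action of an antihermitian matrix to be a
derivation. -/
theorem associator_antiherm_herm {A X : Matrix (Fin 3) (Fin 3) K} (hA : dagger K (Fin 3) A = -A)
    (ht : A.trace = 0) (hX : dagger K (Fin 3) X = X) :
    associator A X X - associator X A X + associator X X A = 0 := by
  have A10 := antiherm_apply hA 1 0
  have A20 := antiherm_apply hA 2 0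
  have A21 := antiherm_apply hA 2 1
  have X10 := herm_apply hX 1 0
  have X20 := herm_apply hX 2 0
  have X21 := herm_apply hX 2 1
  have X00 := herm_diag hX 0
  have X11 := herm_diag hX 1
  have X22 := herm_diag hX 2
  have A22 : A 2 2 = -(A 0 0) + -(A 1 1) := by
    rw [Matrix.trace_fin_three] at ht
    rw [← sub_eq_zero, ← ht]; abel
  generalize re K (X 0 0) = r at X00
  generalize re K (X 1 1) = s at X11
  generalize re K (X 2 2) = t at X22
  -- The rules below bring the entry of A to the front and put the entries of X in a fixed order.
  -- With real diagonal entries of X dropped and the lower triangle expressed by the upper one, what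
  -- remains cancels formally.
  have p1 (a : K) : associator a (X 0 2) (X 0 1) = -associator a (X 0 1) (X 0 2) :=
    associator_swap_right ..
  have p2 (a : K) : associator a (X 1 2) (X 0 1) = -associator a (X 0 1) (X 1 2) :=
    associator_swap_right ..
  have p3 (a : K) : associator a (X 1 2) (X 0 2) = -associator a (X 0 2) (X 1 2) :=
    associator_swap_right ..
  have q1 (i j k l m o) : associator (X i j) (A k l) (X m o)
      = -associator (A k l) (X i j) (X m o) :=
    associator_swap_left ..
  have q2 (i j k l m o) : associator (X i j) (X k l) (A m o) = associator (A m o) (X i j) (X k l) :=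
    associator_rotate ..
  ext i j
  simp only [Matrix.add_apply, Matrix.sub_apply, matrix_associator_apply, q1, q2, Matrix.zero_apply]
  fin_cases i <;> fin_cases j <;>
  simp only [Fin.sum_univ_three, Fin.zero_eta, Fin.mk_one, Fin.reduceFinMk, A10, A20, A21, A22,
    X10, X20, X21, X00, X11,
    X22, associator_smul_one_mid, associator_smul_one_right, associator_conj_left,
    associator_conj_mid, associator_conj_right, associator_neg_left, associator_add_left,
    p1, p2, p3,
    associator_self_right] <;> abel

/-- The six associators are the error in rebracketing [A,[B,X]] - [B,[A,X]]. Their sum collapses to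
one trilinear expression in the single entry X i j, which is what the inner derivations in the
matrix bracket supply. Both vanishing traces enter, by eliminating the last diagonal entries. -/
theorem associator_antiherm_antiherm {A B X : Matrix (Fin 3) (Fin 3) K}
    (hA : dagger K (Fin 3) A = -A) (hB : dagger K (Fin 3) B = -B)
    (hAt : A.trace = 0) (hBt : B.trace = 0) (hX : dagger K (Fin 3) X = X) (i j : Fin 3) :
    (-associator A B X + associator B A X + associator X B A - associator X A B
      + associator A X B - associator B X A) i j
      = -∑ k, ∑ l, associator (A k l) (B l k) (X i j) := by
  have A10 := antiherm_apply hA 1 0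
  have A20 := antiherm_apply hA 2 0
  have A21 := antiherm_apply hA 2 1
  have B10 := antiherm_apply hB 1 0
  have B20 := antiherm_apply hB 2 0
  have B21 := antiherm_apply hB 2 1
  have X10 := herm_apply hX 1 0
  have X20 := herm_apply hX 2 0
  have X21 := herm_apply hX 2 1
  have X00 := herm_diag hX 0
  have X11 := herm_diag hX 1
  have X22 := herm_diag hX 2
  have A22 : A 2 2 = -(A 0 0) + -(A 1 1) := by
    rw [Matrix.trace_fin_three] at hAt
    rw [← sub_eq_zero, ← hAt]; abel
  have B22 : B 2 2 = -(B 0 0) + -(B 1 1) := by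
    rw [Matrix.trace_fin_three] at hBt
    rw [← sub_eq_zero, ← hBt]; abel
  generalize re K (X 0 0) = r at X00
  generalize re K (X 1 1) = s at X11
  generalize re K (X 2 2) = t at X22
  have q1 (i j k l m o) : associator (B i j) (A k l) (X m o)
      = -associator (A k l) (B i j) (X m o) :=
    associator_swap_left ..
  have q2 (i j k l m o) : associator (X i j) (B k l) (A m o)
      = -associator (A m o) (B k l) (X i j) := by
    rw [associator_rotate, associator_swap_right]
  have q3 (i j k l m o) : associator (X i j) (A k l) (B m o) = associator (A k l) (B m o) (X i j) :=
    (associator_rotate ..).symm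
  have q4 (i j k l m o) : associator (A i j) (X k l) (B m o)
      = -associator (A i j) (B m o) (X k l) :=
    associator_swap_right ..
  have q5 (i j k l m o) : associator (B i j) (X k l) (A m o) = associator (A m o) (B i j) (X k l) :=
    associator_rotate ..
  simp only [Matrix.add_apply, Matrix.sub_apply, Matrix.neg_apply, matrix_associator_apply,
    q1, q2, q3, q4, q5]
  fin_cases i <;> fin_cases j <;>
  simp only [Fin.sum_univ_three, Fin.zero_eta, Fin.mk_one, Fin.reduceFinMk, A10, A20, A21, A22,
    B10, B20, B21, B22, X10, X20, X21, X00, X11,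
    X22, associator_smul_one_right, associator_conj_left,
    associator_conj_mid, associator_conj_right, associator_neg_left, associator_add_left,
    associator_neg_mid, associator_add_mid] <;> abel

/-- The analogue for [L_A, L_B]. The diagonal entries are real and drop out of all associators, so
no condition on the traces is needed. -/
theorem associator_herm_herm {A B X : Matrix (Fin 3) (Fin 3) K}
    (hA : dagger K (Fin 3) A = A) (hB : dagger K (Fin 3) B = B)
    (hX : dagger K (Fin 3) X = X) (i j : Fin 3) :
    (-associator A B X + associator B A X + associator X B A - associator X A B
      - associator A X B + associator B X A) i j
      = -∑ k, ∑ l, associator (A k l) (B l k) (X i j) := by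
  have A10 := herm_apply hA 1 0
  have A20 := herm_apply hA 2 0
  have A21 := herm_apply hA 2 1
  have A00 := herm_diag hA 0
  have A11 := herm_diag hA 1
  have A22 := herm_diag hA 2
  have B10 := herm_apply hB 1 0
  have B20 := herm_apply hB 2 0
  have B21 := herm_apply hB 2 1
  have B00 := herm_diag hB 0
  have B11 := herm_diag hB 1
  have B22 := herm_diag hB 2
  have X10 := herm_apply hX 1 0
  have X20 := herm_apply hX 2 0
  have X21 := herm_apply hX 2 1
  have X00 := herm_diag hX 0
  have X11 := herm_diag hX 1
  have X22 := herm_diag hX 2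
  generalize re K (X 0 0) = r at X00
  generalize re K (X 1 1) = s at X11
  generalize re K (X 2 2) = t at X22
  generalize re K (A 0 0) = r at A00
  generalize re K (A 1 1) = s at A11
  generalize re K (A 2 2) = t at A22
  generalize re K (B 0 0) = r at B00
  generalize re K (B 1 1) = s at B11
  generalize re K (B 2 2) = t at B22
  have q1 (i j k l m o) : associator (B i j) (A k l) (X m o)
      = -associator (A k l) (B i j) (X m o) :=
    associator_swap_left ..
  have q2 (i j k l m o) : associator (X i j) (B k l) (A m o)
      = -associator (A m o) (B k l) (X i j) := by
    rw [associator_rotate, associator_swap_right]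
  have q3 (i j k l m o) : associator (X i j) (A k l) (B m o) = associator (A k l) (B m o) (X i j) :=
    (associator_rotate ..).symm
  have q4 (i j k l m o) : associator (A i j) (X k l) (B m o)
      = -associator (A i j) (B m o) (X k l) :=
    associator_swap_right ..
  have q5 (i j k l m o) : associator (B i j) (X k l) (A m o) = associator (A m o) (B i j) (X k l) :=
    associator_rotate ..
  simp only [Matrix.add_apply, Matrix.sub_apply, Matrix.neg_apply, matrix_associator_apply,
    q1, q2, q3, q4, q5]
  fin_cases i <;> fin_cases j <;>
  simp only [Fin.sum_univ_three, Fin.zero_eta, Fin.mk_one, Fin.reduceFinMk, A10, A20, A21, A00, A11,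
    A22, B10, B20, B21, B00, B11, B22, X10, X20, X21, X00, X11,
    X22, associator_smul_one_left, associator_smul_one_mid, associator_smul_one_right,
    associator_conj_left, associator_conj_mid, associator_conj_right] <;> abel

end MatrixAssociators

end CompositionAlgebra

namespace CompositionAlgebra

/-! ### Derivations of a composition algebra -/

section Derivations

variable {K : Type*} [NonAssocRing K] [Module ℝ K] [IsScalarTower ℝ K K] [SMulCommClass ℝ K K]
  [CompositionAlgebra K]

theorem mem_der {D : Module.End ℝ K} : D ∈ der K ↔ ∀ x y, D (x * y) = D x * y + x * D y := Iff.rfl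

theorem der_one {D : Module.End ℝ K} (hD : D ∈ der K) : D 1 = 0 := by
  have h := mem_der.mp hD 1 1
  simpa using h

theorem mul_add_mul_swap (x y : K) :
    x * y + y * x = (2 * re K x) • y + (2 * re K y) • x - (2 * form K x y) • (1 : K) := by
  have h := mul_self_eq (x + y)
  have e : (x + y) * (x + y) = x * x + y * y + (x * y + y * x) := by
    simp only [add_mul, mul_add]; abel
  rw [e, mul_self_eq, mul_self_eq, normSq_add, map_add, ← eq_sub_iff_add_eq'] at h
  rw [h]; module

/-- Applying D to the quadratic equation of x and comparing with its polarization gives 2 Re(Dx) x =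
2⟨x, Dx⟩ 1. If Re(Dx) were nonzero, x would be a real multiple of 1 and Dx would vanish. -/
theorem re_der {D : Module.End ℝ K} (hD : D ∈ der K) (x : K) : re K (D x) = 0 := by
  have h := congrArg D (mul_self_eq x)
  rw [mem_der.mp hD, add_comm, mul_add_mul_swap, map_sub, map_smul, map_smul, der_one hD, smul_zero,
    sub_zero, add_sub_assoc, add_eq_left] at h
  by_contra hr
  have hx : x = ((2 * re K (D x))⁻¹ * (2 * form K x (D x))) • (1 : K) := by
    rw [mul_smul, ← sub_eq_zero.mp h, smul_smul, inv_mul_cancel₀ (by simpa using hr), one_smul]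
  apply hr
  rw [hx, map_smul, der_one hD, smul_zero, map_zero]

theorem der_conj {D : Module.End ℝ K} (hD : D ∈ der K) (x : K) :
    D (conj K x) = conj K (D x) := by
  simp [conj_eq, re_der hD, der_one hD]

end Derivations

/-! ### The action of sa(n,K) on hermitian matrices -/

section Action

variable {K : Type*} [NonAssocRing K] [Module ℝ K] [IsScalarTower ℝ K K] [SMulCommClass ℝ K K]
  [CompositionAlgebra K] {n : Type*} [Fintype n] [DecidableEq n]

theorem dagger_dagger (X : Matrix n n K) : dagger K n (dagger K n X) = X := by
  ext i j; simp [dagger_apply, conj_conj]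

theorem trace_dagger (X : Matrix n n K) : (dagger K n X).trace = conj K X.trace := by
  simp [Matrix.trace, dagger_apply]

theorem mem_herm {X : Matrix n n K} : X ∈ herm K n ↔ dagger K n X = X := Iff.rfl

variable (K n) in
/-- The hermitian part `½ (X + X†)` of a matrix. -/
noncomputable def hermPart : Matrix n n K →ₗ[ℝ] herm K n :=
  ((1 / 2 : ℝ) • (LinearMap.id + dagger K n)).codRestrict (herm K n) fun X => by
    simp [mem_herm, dagger_dagger, add_comm]

theorem hermPart_coe (X : Matrix n n K) :
    (hermPart K n X : Matrix n n K) = (1 / 2 : ℝ) • (X + dagger K n X) := rfl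

theorem hermPart_of_herm {X : Matrix n n K} (h : dagger K n X = X) :
    (hermPart K n X : Matrix n n K) = X := by
  rw [hermPart_coe, h]; module

theorem map_add_end (D E : Module.End ℝ K) (X : Matrix n n K) :
    X.map (D + E : Module.End ℝ K) = X.map D + X.map E := by
  ext; simp

theorem map_mul_der {D : Module.End ℝ K} (hD : D ∈ der K) (X Y : Matrix n n K) :
    (X * Y).map D = X.map D * Y + X * Y.map D := by
  ext i j
  simp [Matrix.mul_apply, mem_der.mp hD, Finset.sum_add_distrib]

theorem dagger_map_der {D : Module.End ℝ K} (hD : D ∈ der K) (X : Matrix n n K) :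
    dagger K n (X.map D) = (dagger K n X).map D := by
  ext i j
  simp [dagger_apply, der_conj hD]

theorem trace_map (D : Module.End ℝ K) (X : Matrix n n K) : (X.map D).trace = D X.trace := by
  simp [Matrix.trace]

variable (K n) in
/-- The map `(A, D) ↦ (X ↦ A X - X A + D(X))` on hermitian matrices. -/
noncomputable def act : MatEnd K n →ₗ[ℝ] Module.End ℝ (herm K n) :=
  LinearMap.mk₂ ℝ (fun u X => hermPart K n (u.1 * X.1 - X.1 * u.1 + X.1.map u.2))
    (fun u v X => by
      rw [← map_add]; congr 1
      simp only [Prod.fst_add, Prod.snd_add, map_add_end, add_mul, mul_add]; abel)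
    (fun c u X => by
      rw [← map_smul]; congr 1
      have : X.1.map (c • u.2 : Module.End ℝ K) = c • X.1.map u.2 := by ext; simp
      simp only [Prod.smul_fst, Prod.smul_snd, this, smul_mul_assoc, mul_smul_comm, smul_add,
        smul_sub])
    (fun u X Y => by
      rw [← map_add]; congr 1
      simp only [Submodule.coe_add, Matrix.map_add _ (map_add u.2), add_mul, mul_add]; abel)
    (fun c u X => by
      rw [← map_smul]; congr 1
      have : (c • X.1).map u.2 = c • X.1.map u.2 := by ext; simp
      simp only [Submodule.coe_smul, this, smul_mul_assoc, mul_smul_comm, smul_add, smul_sub])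

theorem mem_sa {u : MatEnd K n} :
    u ∈ sa K n ↔ (dagger K n u.1 = -u.1 ∧ u.1.trace = 0) ∧ u.2 ∈ der K := Iff.rfl

/-- The projection to the hermitian part only serves to make `act` linear on all of `MatEnd`; here
the value is hermitian already. -/
theorem act_coe {u : MatEnd K n} (h1 : dagger K n u.1 = -u.1) (h2 : u.2 ∈ der K) (X : herm K n) :
    (act K n u X : Matrix n n K) = u.1 * X.1 - X.1 * u.1 + X.1.map u.2 := by
  have hX : dagger K n X.1 = X.1 := X.2
  apply hermPart_of_herm
  rw [map_add, map_sub, dagger_mul, dagger_mul, dagger_map_der h2, h1, hX]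
  simp only [mul_neg, neg_mul]; abel

theorem jordan_coe (X Y : herm K n) :
    (jordan K n X Y : Matrix n n K) = X.1 * Y.1 + Y.1 * X.1 := rfl

theorem jordan_comm (X Y : herm K n) : jordan K n X Y = jordan K n Y X :=
  Subtype.ext (add_comm _ _)

/-- Polarization: for a commutative product the Leibniz rule need only be checked on squares. -/
theorem mem_derivations_of_sq {V : Type*} [AddCommGroup V] [Module ℝ V] {m : V →ₗ[ℝ] V →ₗ[ℝ] V}
    (hm : ∀ x y, m x y = m y x) {T : Module.End ℝ V}
    (h : ∀ x, T (m x x) = (2 : ℝ) • m x (T x)) : T ∈ derivations m := by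
  intro x y
  have e := h (x + y)
  simp only [map_add, LinearMap.add_apply, h, smul_add, hm y x] at e
  have : (2 : ℝ) • T (m x y) = (2 : ℝ) • (m (T x) y + m x (T y)) := by
    rw [hm (T x) y, two_smul]
    rw [← sub_eq_zero] at e ⊢
    rw [← e]; module
  exact smul_right_injective V (two_ne_zero (α := ℝ)) this

/-- The two sides differ by the associators of `associator_antiherm_herm`. -/
theorem antiherm_comm_mul_self {A X : Matrix (Fin 3) (Fin 3) K} (hA : dagger K (Fin 3) A = -A)
    (ht : A.trace = 0) (hX : dagger K (Fin 3) X = X) :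
    A * (X * X) - X * X * A = (A * X - X * A) * X + X * (A * X - X * A) := by
  rw [← sub_eq_zero, ← neg_eq_zero, ← associator_antiherm_herm hA ht hX]
  simp only [associator, sub_mul, mul_sub]; abel

theorem act_jordan_self {u : MatEnd K (Fin 3)} (hu : u ∈ sa K (Fin 3)) (X : H3 K) :
    act K (Fin 3) u (jordan K (Fin 3) X X)
      = (2 : ℝ) • jordan K (Fin 3) X (act K (Fin 3) u X) := by
  obtain ⟨⟨h1, ht⟩, h2⟩ := mem_sa.mp hu
  apply Subtype.ext
  have hX : dagger K (Fin 3) X.1 = X.1 := X.2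
  have e := antiherm_comm_mul_self h1 ht hX
  rw [act_coe h1 h2, jordan_coe, Submodule.coe_smul, jordan_coe, act_coe h1 h2]
  generalize X.1 = Y at *
  rw [Matrix.map_add _ (map_add u.2), map_mul_der h2, mul_add, add_mul, mul_add, add_mul]
  have e2 : u.1 * (Y * Y) + u.1 * (Y * Y) - (Y * Y * u.1 + Y * Y * u.1)
      = (2 : ℝ) • ((u.1 * Y - Y * u.1) * Y + Y * (u.1 * Y - Y * u.1)) := by
    rw [← e, two_smul]; abel
  rw [e2, two_smul, two_smul]
  abel

theorem act_mem_derH3 {u : MatEnd K (Fin 3)} (hu : u ∈ sa K (Fin 3)) :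
    act K (Fin 3) u ∈ derH3 K :=
  mem_derivations_of_sq (m := jordan K (Fin 3)) jordan_comm (act_jordan_self hu)

end Action

end CompositionAlgebra

namespace CompositionAlgebra

/-! ### Commutators of actions and the matrix bracket -/

section Brackets

variable {K : Type*} [NonAssocRing K] [Module ℝ K] [IsScalarTower ℝ K K] [SMulCommClass ℝ K K]
  [CompositionAlgebra K] {n : Type*} [Fintype n] [DecidableEq n]

theorem matBracket_fst (u v : MatEnd K n) : (matBracket K n u v).1 = u.1 * v.1 - v.1 * u.1
    - (Fintype.card n : ℝ)⁻¹ • Matrix.diagonal (fun _ => (u.1 * v.1 - v.1 * u.1).trace)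
    + v.1.map u.2 - u.1.map v.2 := rfl

theorem matBracket_snd (u v : MatEnd K n) : (matBracket K n u v).2 =
    (Fintype.card n : ℝ)⁻¹ • ∑ i, ∑ j, innerDer K (u.1 i j) (v.1 j i) + commBr _ u.2 v.2 := rfl

theorem commBr_apply {A : Type*} [NonUnitalNonAssocRing A] [Module ℝ A] [IsScalarTower ℝ A A]
    [SMulCommClass ℝ A A] (x y : A) : commBr A x y = x * y - y * x := rfl

/-- The commutators of the entries add up to tr[A,B]. Hence a third of this sum, for size 3, cancels
the action of the correction -(1/3) tr[A,B] I and leaves only associators. -/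
theorem sum_innerDer_apply (A B : Matrix n n K) (z : K) :
    (∑ i, ∑ j, innerDer K (A i j) (B j i)) z
      = (A * B - B * A).trace * z - z * (A * B - B * A).trace
        - (3 : ℝ) • ∑ i, ∑ j, associator (A i j) (B j i) z := by
  have ht : (A * B - B * A).trace = ∑ i, ∑ j, (A i j * B j i - B j i * A i j) := by
    rw [Matrix.trace_sub]
    simp only [Matrix.trace, Matrix.diag_apply, Matrix.mul_apply, Finset.sum_sub_distrib]
    congr 1
    exact Finset.sum_comm
  rw [ht]
  simp only [LinearMap.sum_apply, innerDer_apply, Finset.sum_mul, Finset.mul_sum, Finset.smul_sum]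
  simp only [← Finset.sum_sub_distrib]

theorem innerDer_one (x y : K) : innerDer K x y 1 = 0 := by
  rw [innerDer_apply]
  simp [associator]

/-- The action of the bracket of two matrices of size `3`, up to associators. -/
theorem matBracket_action (A B X : Matrix (Fin 3) (Fin 3) K) (i j : Fin 3) :
    ((matBracket K (Fin 3) (A, 0) (B, 0)).1 * X - X * (matBracket K (Fin 3) (A, 0) (B, 0)).1
        + X.map (matBracket K (Fin 3) (A, 0) (B, 0)).2) i j
      = ((A * B - B * A) * X - X * (A * B - B * A)) i j
        - ∑ k, ∑ l, associator (A k l) (B l k) (X i j) := by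
  have h1 : (matBracket K (Fin 3) (A, 0) (B, 0)).1 = A * B - B * A
      - (3 : ℝ)⁻¹ • Matrix.diagonal (fun _ => (A * B - B * A).trace) := by
    rw [matBracket_fst]
    have e0 (Y : Matrix (Fin 3) (Fin 3) K) : Y.map (0 : Module.End ℝ K) = 0 := by ext; simp
    simp [e0]
  have h2 : (matBracket K (Fin 3) (A, 0) (B, 0)).2
      = (3 : ℝ)⁻¹ • ∑ i, ∑ j, innerDer K (A i j) (B j i) := by
    rw [matBracket_snd]; simp
  rw [h1, h2]
  simp only [Matrix.add_apply, Matrix.map_apply, LinearMap.smul_apply, sum_innerDer_apply]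
  generalize (A * B - B * A).trace = t
  simp only [sub_mul, mul_sub, smul_mul_assoc, mul_smul_comm, Matrix.sub_apply, Matrix.smul_apply,
    Matrix.diagonal_mul, Matrix.mul_diagonal]
  module

/-- Rebracketing the double commutators produces the six associators of
`associator_antiherm_antiherm`, and their value is the associator term of `matBracket_action`. -/
theorem comm_action_antiherm {A B X : Matrix (Fin 3) (Fin 3) K}
    (hA : dagger K (Fin 3) A = -A) (hB : dagger K (Fin 3) B = -B)
    (hAt : A.trace = 0) (hBt : B.trace = 0) (hX : dagger K (Fin 3) X = X) :
    A * (B * X - X * B) - (B * X - X * B) * A - (B * (A * X - X * A) - (A * X - X * A) * B)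
      = (matBracket K (Fin 3) (A, 0) (B, 0)).1 * X - X * (matBracket K (Fin 3) (A, 0) (B, 0)).1
        + X.map (matBracket K (Fin 3) (A, 0) (B, 0)).2 := by
  ext i j
  rw [matBracket_action, sub_eq_add_neg _ (∑ k, _),
    ← associator_antiherm_antiherm hA hB hAt hBt hX, ← Matrix.add_apply]
  refine congrArg (fun M : Matrix (Fin 3) (Fin 3) K => M i j) ?_
  simp only [associator, sub_mul, mul_sub]; abel

theorem comm_action_herm {A B X : Matrix (Fin 3) (Fin 3) K}
    (hA : dagger K (Fin 3) A = A) (hB : dagger K (Fin 3) B = B) (hX : dagger K (Fin 3) X = X) :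
    A * (B * X + X * B) + (B * X + X * B) * A - (B * (A * X + X * A) + (A * X + X * A) * B)
      = (matBracket K (Fin 3) (A, 0) (B, 0)).1 * X - X * (matBracket K (Fin 3) (A, 0) (B, 0)).1
        + X.map (matBracket K (Fin 3) (A, 0) (B, 0)).2 := by
  ext i j
  rw [matBracket_action, sub_eq_add_neg _ (∑ k, _),
    ← associator_herm_herm hA hB hX, ← Matrix.add_apply]
  refine congrArg (fun M : Matrix (Fin 3) (Fin 3) K => M i j) ?_
  simp only [associator, sub_mul, mul_sub, add_mul, mul_add]; abel

theorem matBracket_split (u v : MatEnd K n) :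
    matBracket K n u v = matBracket K n (u.1, 0) (v.1, 0)
      + (v.1.map u.2 - u.1.map v.2, commBr _ u.2 v.2) := by
  refine Prod.ext ?_ ?_
  · simp only [Prod.fst_add, matBracket_fst]
    have e0 (Y : Matrix n n K) : Y.map (0 : Module.End ℝ K) = 0 := by ext; simp
    rw [e0, e0]; abel
  · simp only [Prod.snd_add, matBracket_snd]
    simp

/-- The right side is spelled out instead of being written with `act`: the second component of the
bracket is not yet known to be a derivation, so `act_coe` does not apply to it. -/
theorem comm_act_coe {u v : MatEnd K (Fin 3)} (hu : u ∈ sa K (Fin 3)) (hv : v ∈ sa K (Fin 3))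
    (X : H3 K) :
    (commBr _ (act K (Fin 3) u) (act K (Fin 3) v) X : Matrix (Fin 3) (Fin 3) K)
      = (matBracket K (Fin 3) u v).1 * X.1 - X.1 * (matBracket K (Fin 3) u v).1
        + X.1.map (matBracket K (Fin 3) u v).2 := by
  obtain ⟨⟨hA, hAt⟩, hD⟩ := mem_sa.mp hu
  obtain ⟨⟨hB, hBt⟩, hE⟩ := mem_sa.mp hv
  have hX : dagger K (Fin 3) X.1 = X.1 := X.2
  have key := comm_action_antiherm hA hB hAt hBt hX
  have e : (commBr _ u.2 v.2 : Module.End ℝ K) = u.2 * v.2 - v.2 * u.2 := rfl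
  have e1 : X.1.map (u.2 * v.2 - v.2 * u.2 : Module.End ℝ K)
      = (X.1.map v.2).map u.2 - (X.1.map u.2).map v.2 := by ext; simp
  rw [matBracket_split, Prod.fst_add, Prod.snd_add, map_add_end, e, e1]
  rw [commBr_apply, LinearMap.sub_apply, Submodule.coe_sub, Module.End.mul_apply,
    Module.End.mul_apply]
  simp only [act_coe hA hD, act_coe hB hE]
  generalize X.1 = Y at *
  simp only [Matrix.map_add _ (map_add u.2), Matrix.map_add _ (map_add v.2),
    Matrix.map_sub _ (map_sub u.2), Matrix.map_sub _ (map_sub v.2), map_mul_der hD, map_mul_der hE,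
    mul_add, add_mul, mul_sub, sub_mul] at key ⊢
  rw [← sub_eq_zero] at key ⊢
  rw [← key]; abel

theorem comm_jordan_coe (A B X : H3 K) :
    (jordanComm K (Fin 3) A B X : Matrix (Fin 3) (Fin 3) K)
      = (matBracket K (Fin 3) (A.1, 0) (B.1, 0)).1 * X.1
        - X.1 * (matBracket K (Fin 3) (A.1, 0) (B.1, 0)).1
        + X.1.map (matBracket K (Fin 3) (A.1, 0) (B.1, 0)).2 :=
  comm_action_herm A.2 B.2 X.2

theorem trace_smul_diagonal (t : K) :
    ((3 : ℝ)⁻¹ • Matrix.diagonal (fun _ : Fin 3 => t)).trace = t := by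
  rw [Matrix.trace_smul, Matrix.trace_diagonal, Fin.sum_univ_three]; module

theorem dagger_diagonal (t : n → K) :
    dagger K n (Matrix.diagonal t) = Matrix.diagonal fun i => conj K (t i) := by
  ext i j
  by_cases h : i = j
  · subst h; simp [dagger_apply]
  · simp [dagger_apply, h, Ne.symm h]

theorem dagger_comm_of_antiherm {A B : Matrix n n K} (hA : dagger K n A = -A)
    (hB : dagger K n B = -B) : dagger K n (A * B - B * A) = -(A * B - B * A) := by
  rw [map_sub, dagger_mul, dagger_mul, hA, hB]
  simp only [neg_mul, mul_neg, neg_neg]; abel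

theorem dagger_comm_of_herm {A B : Matrix n n K} (hA : dagger K n A = A)
    (hB : dagger K n B = B) : dagger K n (A * B - B * A) = -(A * B - B * A) := by
  rw [map_sub, dagger_mul, dagger_mul, hA, hB]; abel

/-- The trace t of an antihermitian matrix satisfies t̄ = -t, so subtracting (t/3) I keeps the
matrix antihermitian while removing its trace. -/
theorem matBracket_fst_mem {A B : Matrix (Fin 3) (Fin 3) K}
    (h : dagger K (Fin 3) (A * B - B * A) = -(A * B - B * A)) :
    (matBracket K (Fin 3) (A, 0) (B, 0)).1 ∈ antihermTraceless K (Fin 3) := by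
  have h1 : (matBracket K (Fin 3) (A, 0) (B, 0)).1 = A * B - B * A
      - (3 : ℝ)⁻¹ • Matrix.diagonal (fun _ => (A * B - B * A).trace) := by
    rw [matBracket_fst]
    have e0 (Y : Matrix (Fin 3) (Fin 3) K) : Y.map (0 : Module.End ℝ K) = 0 := by ext; simp
    simp [e0]
  rw [h1]
  constructor
  · rw [map_sub, map_smul, dagger_diagonal, h, ← trace_dagger, h, Matrix.trace_neg]
    have : Matrix.diagonal (fun _ : Fin 3 => -(A * B - B * A).trace)
      = -Matrix.diagonal (fun _ : Fin 3 => (A * B - B * A).trace) := by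
      rw [← Matrix.diagonal_neg]
    rw [this]; module
  · rw [Matrix.trace_sub, trace_smul_diagonal, sub_self]

end Brackets

end CompositionAlgebra

namespace CompositionAlgebra

/-! ### Diagonal idempotents and Peirce spaces -/

section Peirce

variable {K : Type*} [NonAssocRing K] [Module ℝ K] [IsScalarTower ℝ K K] [SMulCommClass ℝ K K]
  [CompositionAlgebra K] {n : Type*} [Fintype n] [DecidableEq n]

/-- The diagonal idempotents of the algebra of hermitian matrices. -/
noncomputable def diagIdem (i : n) : herm K n :=
  ⟨Matrix.diagonal (Pi.single i 1), by
    rw [mem_herm, dagger_diagonal]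
    congr 1; ext j
    by_cases h : j = i
    · subst h; simp [conj_one]
    · simp [h]⟩

/-- The hermitian matrix with the entry `x` in the place `(i, j)`. -/
noncomputable def offDiag (i j : n) : K →ₗ[ℝ] herm K n where
  toFun x := ⟨Matrix.single i j x + Matrix.single j i (conj K x), by
    rw [mem_herm, map_add]
    ext a b
    simp only [Matrix.add_apply, dagger_apply, Matrix.single_apply, apply_ite (conj K), conj_conj,
      map_zero, and_comm, add_comm]⟩
  map_add' x y := Subtype.ext (by simp [Matrix.single_add]; abel)
  map_smul' c x := Subtype.ext (by simp [Matrix.smul_single])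

theorem offDiag_apply (i j : n) (x : K) (a b : n) : (offDiag i j x : herm K n).1 a b
    = (if i = a ∧ j = b then x else 0) + (if j = a ∧ i = b then conj K x else 0) := by
  change (Matrix.single i j x + Matrix.single j i (conj K x)) a b = _
  rw [Matrix.add_apply, Matrix.single_apply, Matrix.single_apply]

theorem diagIdem_apply (i a b : n) : (diagIdem i : herm K n).1 a b
    = if a = b ∧ a = i then 1 else 0 := by
  change Matrix.diagonal (Pi.single i 1) a b = _
  by_cases h : a = b
  · subst h; simp [Pi.single_apply]
  · simp [h]

theorem diagIdem_mul_apply (i : n) (M : Matrix n n K) (a b : n) :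
    ((diagIdem i : herm K n).1 * M) a b = if a = i then M a b else 0 := by
  change ((Matrix.diagonal (Pi.single i 1) : Matrix n n K) * M) a b = _
  rw [Matrix.diagonal_mul]
  simp [Pi.single_apply]

theorem mul_diagIdem_apply (i : n) (M : Matrix n n K) (a b : n) :
    (M * (diagIdem i : herm K n).1) a b = if b = i then M a b else 0 := by
  change (M * (Matrix.diagonal (Pi.single i 1) : Matrix n n K)) a b = _
  rw [Matrix.mul_diagonal]
  simp [Pi.single_apply]

theorem jordan_diagIdem_apply (i : n) (M : herm K n) (a b : n) :
    (jordan K n (diagIdem i) M).1 a b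
      = (if a = i then M.1 a b else 0) + (if b = i then M.1 a b else 0) := by
  rw [jordan_coe, Matrix.add_apply, diagIdem_mul_apply, mul_diagIdem_apply]

theorem jordan_diagIdem_self (i : n) :
    jordan K n (diagIdem i) (diagIdem i) = (2 : ℝ) • diagIdem i := by
  ext a b
  rw [jordan_diagIdem_apply, Submodule.coe_smul, Matrix.smul_apply, diagIdem_apply]
  by_cases h : a = b
  · subst h; by_cases h' : a = i <;> simp [h', two_smul]
  · simp [h]

theorem jordan_diagIdem_of_ne {i j : n} (h : i ≠ j) :
    jordan K n (diagIdem i) (diagIdem j) = 0 := by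
  ext a b
  rw [jordan_diagIdem_apply, diagIdem_apply]
  by_cases h1 : a = b
  · subst h1; by_cases h' : a = i <;> simp [h', h]
  · simp [h1]

theorem mem_derivations {V : Type*} [AddCommGroup V] [Module ℝ V] {m : V →ₗ[ℝ] V →ₗ[ℝ] V}
    {T : Module.End ℝ V} : T ∈ derivations m ↔ ∀ x y, T (m x y) = m (T x) y + m x (T y) := Iff.rfl

theorem jordan_diagIdem_offDiag {i j : n} (h : i ≠ j) (x : K) :
    jordan K n (diagIdem i) (offDiag i j x) = offDiag i j x := by
  ext a b
  rw [jordan_diagIdem_apply, offDiag_apply]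
  have h' := h.symm
  by_cases ha : i = a <;> by_cases hb : i = b
  · subst ha; subst hb; simp [h']
  · subst ha; simp [hb, h', Ne.symm hb]
  · subst hb; simp [ha, h', Ne.symm ha]
  · simp [ha, hb]

theorem offDiag_swap (i j : n) (x : K) :
    offDiag i j x = (offDiag j i (conj K x) : herm K n) := by
  ext a b
  rw [offDiag_apply, offDiag_apply, conj_conj, add_comm]

/-- A derivation that kills the idempotents commutes with multiplication by them, so it preserves
their common eigenspaces. The matrices `offDiag i j x` form the space where both the i-th and the
j-th idempotent have eigenvalue 1. -/
theorem der_offDiag {T : Module.End ℝ (herm K n)} (hT : T ∈ derivations (jordan K n))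
    (h0 : ∀ i, T (diagIdem i) = 0) {i j : n} (h : i ≠ j) (x : K) :
    T (offDiag i j x) = offDiag i j ((T (offDiag i j x)).1 i j) := by
  have key (k l : n) (hkl : k ≠ l) (y : K) :
      jordan K n (diagIdem k) (T (offDiag k l y)) = T (offDiag k l y) := by
    have e := mem_derivations.mp hT (diagIdem k) (offDiag k l y)
    rw [jordan_diagIdem_offDiag hkl, h0, map_zero, LinearMap.zero_apply, zero_add] at e
    exact e.symm
  have k1 := key i j h x
  have k2 := key j i h.symm (conj K x)
  rw [← offDiag_swap] at k2
  have hM := (T (offDiag i j x)).2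
  generalize T (offDiag i j x) = M at *
  ext a b
  have e1 := congrArg (fun N : herm K n => N.1 a b) k1
  have e2 := congrArg (fun N : herm K n => N.1 a b) k2
  simp only [jordan_diagIdem_apply] at e1 e2
  rw [offDiag_apply]
  have h' := h.symm
  -- `e2` clears row i and column i except for the places (i,j) and (j,i); `e1` clears everything
  -- outside them.
  by_cases ha : a = i
  · subst ha
    by_cases hb : b = j
    · subst hb; simp [h']
    · simp [h, hb] at e2
      simp [Ne.symm hb, h', ← e2]
  · by_cases hb : b = i
    · subst hb
      by_cases ha' : a = j
      · subst ha'
        simp [h, h']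
        exact herm_apply hM _ _
      · simp [h, ha'] at e2
        simp [Ne.symm ha', Ne.symm ha, ← e2]
    · simp [ha, hb] at e1
      simp [Ne.symm ha, Ne.symm hb, ← e1]

theorem herm_eq_sum (X : H3 K) : X = re K (X.1 0 0) • diagIdem 0 + re K (X.1 1 1) • diagIdem 1
    + re K (X.1 2 2) • diagIdem 2 + offDiag 0 1 (X.1 0 1) + offDiag 1 2 (X.1 1 2)
    + offDiag 0 2 (X.1 0 2) := by
  have X00 := herm_diag X.2 0
  have X11 := herm_diag X.2 1
  have X22 := herm_diag X.2 2
  have X10 := herm_apply X.2 1 0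
  have X20 := herm_apply X.2 2 0
  have X21 := herm_apply X.2 2 1
  ext a b
  simp only [Submodule.coe_add, Submodule.coe_smul, Matrix.add_apply, Matrix.smul_apply,
    diagIdem_apply, offDiag_apply]
  fin_cases a <;> fin_cases b <;> simp <;> assumption

/-- The multiplication of K is recovered from the Jordan product of two Peirce spaces; this is how a
derivation of H₃(K) comes to induce one of K. -/
theorem offDiag_mul (x y : K) : jordan K (Fin 3) (offDiag 0 1 x) (offDiag 1 2 y)
    = offDiag 0 2 (x * y) := by
  ext a b
  simp only [jordan_coe, Matrix.add_apply, Matrix.mul_apply, offDiag_apply, Fin.sum_univ_three]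
  fin_cases a <;> fin_cases b <;> simp [conj_mul]

theorem offDiag_sq {i j : Fin 3} (h : i ≠ j) (y : K) :
    (jordan K (Fin 3) (offDiag i j 1) (offDiag i j y)).1 i i = y + conj K y := by
  have h' := h.symm
  simp only [jordan_coe, Matrix.add_apply, Matrix.mul_apply, offDiag_apply, conj_one]
  simp [h', add_comm, ← ite_and]

theorem offDiag_one_sq {i j : Fin 3} (h : i ≠ j) :
    jordan K (Fin 3) (offDiag i j 1) (offDiag i j 1)
      = (2 : ℝ) • (diagIdem i + diagIdem j) := by
  have h' := h.symm
  ext a b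
  simp only [jordan_coe, Matrix.add_apply, Matrix.mul_apply, offDiag_apply, conj_one,
    Submodule.coe_smul, Submodule.coe_add, Matrix.smul_apply, diagIdem_apply]
  fin_cases i <;> fin_cases j <;> simp at h <;> fin_cases a <;> fin_cases b <;>
    simp [two_smul]

end Peirce

end CompositionAlgebra

namespace CompositionAlgebra

/-! ### Derivations of H₃(K) are the elements of sa(3,K) -/

section ActionEquiv

variable {K : Type*} [NonAssocRing K] [Module ℝ K] [IsScalarTower ℝ K K] [SMulCommClass ℝ K K]
  [CompositionAlgebra K]

/-- Idempotents detect the off-diagonal entries of A. Off-diagonal matrices give a_ii x - x a_jj +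
Dx = 0; at x = 1 this makes all diagonal entries equal, then the trace condition kills them, and Dx
= 0 is left. Of D only D1 = 0 is required. -/
theorem action_faithful {A : Matrix (Fin 3) (Fin 3) K} {D : Module.End ℝ K} (ht : A.trace = 0)
    (hD : D 1 = 0) (h : ∀ X : H3 K, A * X.1 - X.1 * A + X.1.map D = 0) : A = 0 ∧ D = 0 := by
  have hoff (i j : Fin 3) (hij : i ≠ j) : A i j = 0 := by
    have e := congrFun (congrFun (h (diagIdem j)) i) j
    rw [Matrix.add_apply, Matrix.sub_apply, mul_diagIdem_apply, diagIdem_mul_apply,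
      Matrix.map_apply, diagIdem_apply] at e
    simpa [hij] using e
  have hdiag (i j : Fin 3) (hij : i ≠ j) (x : K) : A i i * x - x * A j j + D x = 0 := by
    have e := congrFun (congrFun (h (offDiag i j x)) i) j
    have hji := hij.symm
    rw [Matrix.add_apply, Matrix.sub_apply, Matrix.mul_apply, Matrix.mul_apply,
      Matrix.map_apply] at e
    simpa [offDiag_apply, hji, hij] using e
  have h1 (i j : Fin 3) (hij : i ≠ j) : A j j = A i i := by
    have e := hdiag i j hij 1
    rw [hD, add_zero, mul_one, one_mul, sub_eq_zero] at e
    exact e.symm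
  have h00 : A 0 0 = 0 := by
    rw [Matrix.trace_fin_three, h1 0 1 (by decide), h1 0 2 (by decide)] at ht
    have : (3 : ℝ) • A 0 0 = 0 := by rw [← ht]; module
    simpa using this
  constructor
  · ext i j
    by_cases hij : i = j
    · subst hij
      by_cases hi : i = 0
      · subst hi; simpa using h00
      · rw [h1 0 i (Ne.symm hi), h00]; rfl
    · simpa using hoff i j hij
  · ext x
    have e := hdiag 0 1 (by decide) x
    rw [h1 0 1 (by decide), h00] at e
    simpa using e

theorem sub_mem_derivations {V : Type*} [AddCommGroup V] [Module ℝ V] {m : V →ₗ[ℝ] V →ₗ[ℝ] V}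
    {S T : Module.End ℝ V} (hS : S ∈ derivations m) (hT : T ∈ derivations m) :
    S - T ∈ derivations m := by
  rw [mem_derivations] at *
  intro x y
  simp only [LinearMap.sub_apply, hS, hT, map_sub]
  abel

/-- T acts on the three off-diagonal Peirce spaces by maps with F₀₂(xy) = F₀₁(x) y + x F₁₂(y).
Setting x = 1 or y = 1, where F₀₁ and F₁₂ vanish, shows that the three coincide, and the relation
becomes the Leibniz rule in K. -/
theorem eq_act_of_fixed {T : Module.End ℝ (H3 K)} (hT : T ∈ derH3 K)
    (h0 : ∀ i, T (diagIdem i) = 0) (h01 : (T (offDiag 0 1 1)).1 0 1 = 0)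
    (h12 : (T (offDiag 1 2 1)).1 1 2 = 0) : ∃ u ∈ sa K (Fin 3), act K (Fin 3) u = T := by
  have hT' : T ∈ derivations (jordan K (Fin 3)) := hT
  let F (i j : Fin 3) : Module.End ℝ K :=
    { toFun := fun x => (T (offDiag i j x)).1 i j
      map_add' := fun x y => by simp
      map_smul' := fun c x => by simp }
  have hF (i j : Fin 3) (hij : i ≠ j) (x : K) : T (offDiag i j x) = offDiag i j (F i j x) :=
    der_offDiag hT' h0 hij x
  have offDiag_inj (x y : K) (h : (offDiag 0 2 x : H3 K) = offDiag 0 2 y) : x = y := by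
    have e := congrArg (fun N : H3 K => N.1 0 2) h
    simpa [offDiag_apply] using e
  have hmul (x y : K) : F 0 2 (x * y) = F 0 1 x * y + x * F 1 2 y := by
    apply offDiag_inj
    have e := mem_derivations.mp hT' (offDiag 0 1 x) (offDiag 1 2 y)
    rwa [offDiag_mul, hF 0 2 (by decide), hF 0 1 (by decide), hF 1 2 (by decide), offDiag_mul,
      offDiag_mul, ← map_add] at e
  have e01 (x : K) : F 0 1 x = F 0 2 x := by
    have e := hmul x 1
    have z : F 1 2 1 = 0 := h12
    rw [z, mul_one, mul_one, mul_zero, add_zero] at e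
    exact e.symm
  have e12 (x : K) : F 1 2 x = F 0 2 x := by
    have e := hmul 1 x
    have z : F 0 1 1 = 0 := h01
    rw [z, one_mul, one_mul, zero_mul, zero_add] at e
    exact e.symm
  have hD : F 0 2 ∈ der K := fun x y => by
    have e := hmul x y
    rwa [e01, e12] at e
  have hu : ((0, F 0 2) : MatEnd K (Fin 3)) ∈ sa K (Fin 3) := ⟨⟨by simp, by simp⟩, hD⟩
  refine ⟨(0, F 0 2), hu, LinearMap.ext fun X => ?_⟩
  have a0 (i : Fin 3) : act K (Fin 3) (0, F 0 2) (diagIdem i) = 0 := by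
    ext a b
    rw [act_coe (by simp) hD]
    by_cases hab : a = b
    · subst hab; by_cases hi : a = i <;> simp [diagIdem_apply, der_one hD, hi]
    · simp [diagIdem_apply, hab]
  have a1 (i j : Fin 3) (hij : i ≠ j) (x : K) :
      act K (Fin 3) (0, F 0 2) (offDiag i j x) = offDiag i j (F 0 2 x) := by
    ext a b
    rw [act_coe (by simp) hD]
    simp [offDiag_apply, apply_ite (F 0 2), der_conj hD]
  rw [herm_eq_sum X]
  simp only [map_add, map_smul, h0, a0]
  rw [hF 0 1 (by decide), hF 1 2 (by decide), hF 0 2 (by decide), e01, e12, a1 0 1 (by decide),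
    a1 1 2 (by decide), a1 0 2 (by decide)]

/-- Differentiating e·e = 2e gives Te = e·Te, so Te lies in the eigenspace of e for the eigenvalue
1: only entries with exactly one index equal to i survive. -/
theorem der_diagIdem {T : Module.End ℝ (H3 K)} (hT : T ∈ derH3 K) (i a b : Fin 3) :
    (T (diagIdem i)).1 a b = (if a = i then (T (diagIdem i)).1 a b else 0)
      + (if b = i then (T (diagIdem i)).1 a b else 0) := by
  have e := mem_derivations.mp hT (diagIdem i) (diagIdem i)
  rw [jordan_diagIdem_self, map_smul, jordan_comm (T _), ← two_smul ℝ] at e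
  have e' := smul_right_injective _ (two_ne_zero (α := ℝ)) e
  conv_lhs => rw [e']
  rw [jordan_diagIdem_apply]

theorem der_diagIdem_add {T : Module.End ℝ (H3 K)} (hT : T ∈ derH3 K) {i j : Fin 3}
    (hij : i ≠ j) : (T (diagIdem i)).1 i j + (T (diagIdem j)).1 i j = 0 := by
  have e := mem_derivations.mp hT (diagIdem i) (diagIdem j)
  rw [jordan_diagIdem_of_ne hij, map_zero, jordan_comm (T _)] at e
  have e' := congrArg (fun N : H3 K => N.1 i j) e
  simp only [Submodule.coe_add, Matrix.add_apply, jordan_diagIdem_apply] at e'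
  simpa [hij, hij.symm] using e'.symm

theorem act_matrix_coe {A : Matrix (Fin 3) (Fin 3) K} (hA : dagger K (Fin 3) A = -A)
    (X : H3 K) : (act K (Fin 3) (A, 0) X).1 = A * X.1 - X.1 * A := by
  have h := act_coe (u := (A, 0)) hA (Submodule.zero_mem (der K)) X
  have e0 : X.1.map (0 : Module.End ℝ K) = 0 := by ext; simp
  rw [h, e0, add_zero]

/-- Column j of [A, e_j] is column j of A off the diagonal, so A must be assembled from the columns
of the T(e_j). Differentiating e_i·e_j = 0 says that this A is antihermitian. -/
theorem exists_act_sub_fixes_diagIdem {T : Module.End ℝ (H3 K)} (hT : T ∈ derH3 K) :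
    ∃ u ∈ sa K (Fin 3), ∀ i, (T - act K (Fin 3) u) (diagIdem i) = 0 := by
  have hdiag (i : Fin 3) : (T (diagIdem i)).1 i i = 0 := by
    have e := der_diagIdem hT i i i
    simpa using e
  let A : Matrix (Fin 3) (Fin 3) K := fun a b => (T (diagIdem b)).1 a b
  have hA : dagger K (Fin 3) A = -A := by
    ext a b
    change conj K ((T (diagIdem a)).1 b a) = -(T (diagIdem b)).1 a b
    rw [← herm_apply (T (diagIdem a)).2]
    by_cases hab : a = b
    · subst hab; simp [hdiag]
    · exact eq_neg_of_add_eq_zero_left (der_diagIdem_add hT hab)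
  have ht : A.trace = 0 := by
    change ∑ i, (T (diagIdem i)).1 i i = 0
    simp [hdiag]
  have hu : ((A, 0) : MatEnd K (Fin 3)) ∈ sa K (Fin 3) := ⟨⟨hA, ht⟩, Submodule.zero_mem _⟩
  refine ⟨(A, 0), hu, fun j => Subtype.ext ?_⟩
  ext a b
  rw [LinearMap.sub_apply, Submodule.coe_sub, act_matrix_coe hA, Matrix.sub_apply,
    Matrix.sub_apply, mul_diagIdem_apply, diagIdem_mul_apply]
  change (T (diagIdem j)).1 a b - ((if b = j then (T (diagIdem b)).1 a b else 0)
    - (if a = j then (T (diagIdem b)).1 a b else 0)) = 0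
  have e1 := der_diagIdem hT j a b
  by_cases hb : b = j
  · subst hb
    by_cases ha : a = b
    · subst ha; simp [hdiag]
    · simp [ha]
  · by_cases ha : a = j
    · subst ha
      simpa [hb] using der_diagIdem_add hT (Ne.symm hb)
    · simpa [ha, hb] using e1

/-- The square of `offDiag i j 1` is twice a sum of idempotents and is therefore killed; its (i,i)
entry forces the coefficient to be imaginary. -/
theorem conj_der_offDiag_one {S : Module.End ℝ (H3 K)} (hS : S ∈ derivations (jordan K (Fin 3)))
    (h0 : ∀ i, S (diagIdem i) = 0) {i j : Fin 3} (hij : i ≠ j) :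
    conj K ((S (offDiag i j 1)).1 i j) = -(S (offDiag i j 1)).1 i j := by
  have e := mem_derivations.mp hS (offDiag i j 1) (offDiag i j 1)
  rw [offDiag_one_sq hij, map_smul, map_add, h0, h0, add_zero, jordan_comm (S _), ← two_smul ℝ,
    smul_zero, der_offDiag hS h0 hij] at e
  have e' := (smul_eq_zero.mp e.symm).resolve_left two_ne_zero
  have e2 := congrArg (fun N : H3 K => N.1 i i) e'
  simp only [offDiag_sq hij] at e2
  exact (neg_eq_of_add_eq_zero_right e2).symm

theorem exists_diagonal_antiherm {a b : K} (ha : conj K a = -a) (hb : conj K b = -b) :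
    ∃ d : Fin 3 → K, dagger K (Fin 3) (Matrix.diagonal d) = -Matrix.diagonal d ∧
      (Matrix.diagonal d).trace = 0 ∧ d 0 - d 1 = a ∧ d 1 - d 2 = b := by
  -- The unique solution of d₀ - d₁ = a, d₁ - d₂ = b, d₀ + d₁ + d₂ = 0.
  refine ⟨![(1 / 3 : ℝ) • ((2 : ℝ) • a + b), (1 / 3 : ℝ) • (b - a),
    (1 / 3 : ℝ) • (-a - (2 : ℝ) • b)], ?_, ?_, ?_, ?_⟩
  · rw [dagger_diagonal]
    refine Eq.trans (congrArg Matrix.diagonal (funext fun i => ?_)) (Matrix.diagonal_neg _).symm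
    fin_cases i <;> simp [ha, hb] <;> module
  · rw [Matrix.trace_diagonal, Fin.sum_univ_three]
    simp; module
  · simp; module
  · simp; module

/-- A diagonal matrix d kills the idempotents and multiplies the coefficient 1 at (i,j) into d_i -
d_j. Subtracting a suitable one reduces to `eq_act_of_fixed`. -/
theorem exists_act_eq_of_fixes_diagIdem {S : Module.End ℝ (H3 K)} (hS : S ∈ derH3 K)
    (h0 : ∀ i, S (diagIdem i) = 0) : ∃ u ∈ sa K (Fin 3), act K (Fin 3) u = S := by
  obtain ⟨d, hA, ht, h1, h2⟩ := exists_diagonal_antiherm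
    (conj_der_offDiag_one hS h0 (i := 0) (j := 1) (by decide))
    (conj_der_offDiag_one hS h0 (i := 1) (j := 2) (by decide))
  have hv : ((Matrix.diagonal d, 0) : MatEnd K (Fin 3)) ∈ sa K (Fin 3) :=
    ⟨⟨hA, ht⟩, Submodule.zero_mem _⟩
  have act_apply (X : H3 K) (i j : Fin 3) : (act K (Fin 3) (Matrix.diagonal d, 0) X).1 i j
      = d i * X.1 i j - X.1 i j * d j := by
    rw [act_matrix_coe hA, Matrix.sub_apply, Matrix.diagonal_mul, Matrix.mul_diagonal]
  have hmem : S - act K (Fin 3) (Matrix.diagonal d, 0) ∈ derH3 K :=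
    sub_mem_derivations hS (act_mem_derH3 hv)
  generalize hV : act K (Fin 3) (Matrix.diagonal d, 0) = V at hmem act_apply
  have g0 (i : Fin 3) : (S - V) (diagIdem i) = 0 := by
    rw [LinearMap.sub_apply, h0, zero_sub, neg_eq_zero]
    ext p q
    rw [act_apply, diagIdem_apply]
    by_cases hpq : p = q
    · subst hpq; by_cases hi : p = i <;> simp [hi]
    · simp [hpq]
  have g1 : ((S - V) (offDiag 0 1 1)).1 0 1 = 0 := by
    rw [LinearMap.sub_apply, Submodule.coe_sub, Matrix.sub_apply, ← h1, act_apply, offDiag_apply]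
    simp
  have g2 : ((S - V) (offDiag 1 2 1)).1 1 2 = 0 := by
    rw [LinearMap.sub_apply, Submodule.coe_sub, Matrix.sub_apply, ← h2, act_apply, offDiag_apply]
    simp
  obtain ⟨w, hw, e⟩ := eq_act_of_fixed hmem g0 g1 g2
  refine ⟨(Matrix.diagonal d, 0) + w, Submodule.add_mem _ hv hw, ?_⟩
  rw [map_add, hV, e]
  exact LinearMap.ext fun X => by simp

theorem exists_act_eq {T : Module.End ℝ (H3 K)} (hT : T ∈ derH3 K) :
    ∃ u ∈ sa K (Fin 3), act K (Fin 3) u = T := by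
  obtain ⟨u, hu, h0⟩ := exists_act_sub_fixes_diagIdem hT
  have hS : T - act K (Fin 3) u ∈ derH3 K := sub_mem_derivations hT (act_mem_derH3 hu)
  obtain ⟨w, hw, e⟩ := exists_act_eq_of_fixes_diagIdem hS h0
  refine ⟨u + w, Submodule.add_mem _ hu hw, ?_⟩
  rw [map_add, e]
  exact LinearMap.ext fun X => by simp

/-- Asking only that the second components kill 1, instead of being derivations, lets this apply to
a bracket whose membership in `sa` is still open. -/
theorem eq_of_action_eq {u v : MatEnd K (Fin 3)} (hut : u.1.trace = 0) (hvt : v.1.trace = 0)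
    (hu1 : u.2 1 = 0) (hv1 : v.2 1 = 0)
    (h : ∀ X : H3 K, u.1 * X.1 - X.1 * u.1 + X.1.map u.2
      = v.1 * X.1 - X.1 * v.1 + X.1.map v.2) : u = v := by
  have := action_faithful (A := u.1 - v.1) (D := u.2 - v.2)
    (by rw [Matrix.trace_sub, hut, hvt, sub_zero]) (by simp [hu1, hv1]) (fun X => by
      have e := h X
      have e' : X.1.map (u.2 - v.2 : Module.End ℝ K) = X.1.map u.2 - X.1.map v.2 := by ext; simp
      rw [e', ← sub_eq_zero.mpr e, sub_mul, mul_sub]; abel)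
  exact Prod.ext (sub_eq_zero.mp this.1) (sub_eq_zero.mp this.2)

theorem act_injOn {u v : MatEnd K (Fin 3)} (hu : u ∈ sa K (Fin 3)) (hv : v ∈ sa K (Fin 3))
    (h : act K (Fin 3) u = act K (Fin 3) v) : u = v := by
  obtain ⟨⟨hA, hAt⟩, hD⟩ := mem_sa.mp hu
  obtain ⟨⟨hB, hBt⟩, hE⟩ := mem_sa.mp hv
  refine eq_of_action_eq hAt hBt (der_one hD) (der_one hE) fun X => ?_
  rw [← act_coe hA hD, ← act_coe hB hE, h]

theorem commBr_mem_derivations {V : Type*} [AddCommGroup V] [Module ℝ V] {m : V →ₗ[ℝ] V →ₗ[ℝ] V}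
    {S T : Module.End ℝ V} (hS : S ∈ derivations m) (hT : T ∈ derivations m) :
    commBr _ S T ∈ derivations m := by
  rw [mem_derivations] at *
  intro x y
  simp only [commBr_apply, LinearMap.sub_apply, Module.End.mul_apply, hS, hT, map_add, map_sub]
  abel

theorem matBracket_fst_split_antiherm {u v : MatEnd K (Fin 3)} (hu : u ∈ sa K (Fin 3))
    (hv : v ∈ sa K (Fin 3)) : (matBracket K (Fin 3) u v).1 ∈ antihermTraceless K (Fin 3) := by
  obtain ⟨⟨hA, hAt⟩, hD⟩ := mem_sa.mp hu
  obtain ⟨⟨hB, hBt⟩, hE⟩ := mem_sa.mp hv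
  rw [matBracket_split, Prod.fst_add]
  refine Submodule.add_mem _ (matBracket_fst_mem (dagger_comm_of_antiherm hA hB))
    (Submodule.sub_mem _ ⟨?_, ?_⟩ ⟨?_, ?_⟩)
  · rw [dagger_map_der hD, hB]; ext; simp
  · rw [trace_map, hBt, map_zero]
  · rw [dagger_map_der hE, hA]; ext; simp
  · rw [trace_map, hAt, map_zero]

theorem matBracket_snd_one {u v : MatEnd K (Fin 3)} (hu : u.2 1 = 0) (hv : v.2 1 = 0) :
    (matBracket K (Fin 3) u v).2 1 = 0 := by
  rw [matBracket_snd]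
  simp [innerDer_one, commBr_apply, hu, hv]

/-- Closure without computing in K: the commutator of two derivations of H₃(K) is a derivation,
hence the action of some w in `sa`; the bracket acts in the same way, so it equals w. -/
theorem matBracket_mem_sa {u v : MatEnd K (Fin 3)} (hu : u ∈ sa K (Fin 3))
    (hv : v ∈ sa K (Fin 3)) : matBracket K (Fin 3) u v ∈ sa K (Fin 3) := by
  obtain ⟨w, hw, e⟩ := exists_act_eq (T := commBr _ (act K (Fin 3) u) (act K (Fin 3) v))
    (commBr_mem_derivations (act_mem_derH3 hu) (act_mem_derH3 hv))
  obtain ⟨⟨hC, hCt⟩, hF⟩ := mem_sa.mp hw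
  have := eq_of_action_eq (u := matBracket K (Fin 3) u v) (v := w)
    (matBracket_fst_split_antiherm hu hv).2 hCt
    (matBracket_snd_one (der_one hu.2) (der_one hv.2)) (der_one hF) (fun X => by
      rw [← comm_act_coe hu hv, ← act_coe hC hF, e])
  rwa [this]

theorem act_matBracket {u v : MatEnd K (Fin 3)} (hu : u ∈ sa K (Fin 3))
    (hv : v ∈ sa K (Fin 3)) : act K (Fin 3) (matBracket K (Fin 3) u v)
      = commBr _ (act K (Fin 3) u) (act K (Fin 3) v) := by
  refine LinearMap.ext fun X => Subtype.ext ?_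
  obtain ⟨⟨hA, hAt⟩, hD⟩ := mem_sa.mp (matBracket_mem_sa hu hv)
  rw [comm_act_coe hu hv, act_coe hA hD]

theorem innerDer_conj (x y : K) : innerDer K (conj K x) (conj K y) = innerDer K x y := by
  have h1 (z : K) : innerDer K 1 z = 0 := by
    ext w; rw [innerDer_apply]; simp [associator]
  have h2 (z : K) : innerDer K z 1 = 0 := by
    ext w; rw [innerDer_apply]; simp [associator]
  simp [conj_eq, h1, h2]

/-- Read off from the closure of sa(3,K), for two antihermitian matrices with a single pair of
nonzero entries. -/
theorem innerDer_mem_der (x y : K) : innerDer K x y ∈ der K := by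
  let A (z : K) : Matrix (Fin 3) (Fin 3) K := Matrix.single 0 1 z - Matrix.single 1 0 (conj K z)
  have hA (z : K) : ((A z, 0) : MatEnd K (Fin 3)) ∈ sa K (Fin 3) := by
    refine ⟨⟨?_, ?_⟩, Submodule.zero_mem _⟩
    · ext i j
      fin_cases i <;> fin_cases j <;> simp [A, dagger_apply, conj_conj]
    · simp [A]
  have h := (matBracket_mem_sa (hA x) (hA (conj K y))).2
  rw [matBracket_snd] at h
  -- The entries contribute D_{x,-y} and D_{-x̄,ȳ}, and D is unchanged when both arguments are
  -- conjugated.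
  have e : ∑ i, ∑ j, innerDer K (A x i j) (A (conj K y) j i) = (-2 : ℝ) • innerDer K x y := by
    simp [Fin.sum_univ_three, A, conj_conj, innerDer_conj]
    module
  simp only [e, map_zero, add_zero] at h
  rw [smul_smul] at h
  exact (Submodule.smul_mem_iff _ (by norm_num)).mp h

theorem matBracket_herm_mem_sa (A B : H3 K) :
    matBracket K (Fin 3) (A.1, 0) (B.1, 0) ∈ sa K (Fin 3) := by
  refine ⟨matBracket_fst_mem (dagger_comm_of_herm A.2 B.2), ?_⟩
  rw [matBracket_snd]
  refine Submodule.add_mem _ (Submodule.smul_mem _ _ (Submodule.sum_mem _ fun i _ =>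
    Submodule.sum_mem _ fun j _ => innerDer_mem_der _ _)) ?_
  simp

theorem act_matBracket_herm (A B : H3 K) :
    act K (Fin 3) (matBracket K (Fin 3) (A.1, 0) (B.1, 0)) = jordanComm K (Fin 3) A B := by
  refine LinearMap.ext fun X => Subtype.ext ?_
  obtain ⟨⟨hC, hCt⟩, hD⟩ := mem_sa.mp (matBracket_herm_mem_sa A B)
  rw [comm_jordan_coe, act_coe hC hD]

/-- Usually a consequence of the Jordan identity; here it comes first, from matrices, and serves to
prove that identity. -/
theorem jordanComm_mem_derH3 (A B : H3 K) : jordanComm K (Fin 3) A B ∈ derH3 K := by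
  rw [← act_matBracket_herm]
  exact act_mem_derH3 (matBracket_herm_mem_sa A B)

end ActionEquiv

end CompositionAlgebra

/-! ### The Jordan identity and the Tits-Kantor-Koecher bracket -/

section JordanIdentity

variable {V : Type*} [AddCommGroup V] [Module ℝ V] {m : V →ₗ[ℝ] V →ₗ[ℝ] V}

open CompositionAlgebra

/-- If the commutators of multiplications of a commutative algebra are derivations and there is a
nondegenerate associative symmetric form, then the algebra is a Jordan algebra. -/
theorem jordan_identity_of_form (hm : ∀ x y, m x y = m y x)
    (hder : ∀ a b, commBr (Module.End ℝ V) (m a) (m b) ∈ derivations m) (f : V →ₗ[ℝ] V →ₗ[ℝ] ℝ)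
    (hf : ∀ x y z, f (m x y) z = f y (m x z)) (hnd : ∀ x, (∀ y, f x y = 0) → x = 0) (a x : V) :
    m a (m (m a a) x) = m (m a a) (m a x) := by
  -- The Leibniz rule for [L_a, L_b] on a·a; in operators, 3 L_a L_{a²} = L_{a³} + 2 L_a³.
  have key (b : V) : (3 : ℝ) • m a (m (m a a) b)
      = m (m a (m a a)) b + (2 : ℝ) • m a (m a (m a b)) := by
    have e := mem_derivations.mp (hder a b) a a
    simp only [commBr_apply, LinearMap.sub_apply, Module.End.mul_apply] at e
    rw [hm (m a (m b a) - _) a, hm b (m a a), hm b (m a (m a a)), hm b a, map_sub] at e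
    rw [← sub_eq_zero] at e ⊢
    rw [← e]; module
  rw [← sub_eq_zero]
  refine hnd _ fun y => ?_
  -- Multiplications are self-adjoint for f. By `key` so is L_a L_{a²}, whose adjoint is L_{a²} L_a;
  -- hence the two commute.
  have k1 := congrArg (fun v => f v y) (key x)
  have k2 := congrArg (fun v => f x v) (key y)
  simp only [map_add, map_smul, LinearMap.add_apply, LinearMap.smul_apply, hf, smul_eq_mul]
    at k1 k2
  simp only [map_sub, LinearMap.sub_apply, hf]
  linarith

theorem jordan_identity_linearized (hm : ∀ x y, m x y = m y x)
    (h : ∀ a x, m a (m (m a a) x) = m (m a a) (m a x)) (a b c : V) :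
    commBr (Module.End ℝ V) (m a) (m (m b c)) + commBr (Module.End ℝ V) (m b) (m (m c a))
      + commBr (Module.End ℝ V) (m c) (m (m a b)) = 0 := by
  have h' (a : V) : commBr (Module.End ℝ V) (m a) (m (m a a)) = 0 := by
    ext x
    simp [commBr_apply, h]
  have h2 (a b : V) : (2 : ℝ) • commBr (Module.End ℝ V) (m a) (m (m a b))
      + commBr (Module.End ℝ V) (m b) (m (m a a)) = 0 := by
    -- The difference of the values at a + b and a - b isolates the part that is linear in b, the
    -- cubic part being zero.
    have e1 := h' (a + b)
    have e2 := h' (a - b)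
    simp only [map_add, map_sub, LinearMap.add_apply, LinearMap.sub_apply, h', hm b a] at e1 e2
    refine (smul_eq_zero.mp ?_).resolve_left (two_ne_zero (α := ℝ))
    linear_combination (norm := module) e1 - e2
  have e1 := h2 (a + c) b
  have e2 := h2 a b
  have e3 := h2 c b
  simp only [map_add, LinearMap.add_apply, hm c b] at e1
  rw [hm c b] at e3
  refine (smul_eq_zero.mp ?_).resolve_left (two_ne_zero (α := ℝ))
  rw [hm c a] at e1 ⊢
  linear_combination (norm := module) e1 - e2 - e3

/-- The Tits-Kantor-Koecher bracket of elements `(T, a₁, a₂, a₃)`, which stand for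
`T + a₁ ⊗ i + a₂ ⊗ j + a₃ ⊗ k` with the split quaternion units `i, j, k`. -/
def tkkBracket (m : V →ₗ[ℝ] V →ₗ[ℝ] V) (u v : Module.End ℝ V × V × V × V) :
    Module.End ℝ V × V × V × V :=
  (commBr _ u.1 v.1 + commBr (Module.End ℝ V) (m u.2.1) (m v.2.1)
      + commBr (Module.End ℝ V) (m u.2.2.1) (m v.2.2.1)
      - commBr (Module.End ℝ V) (m u.2.2.2) (m v.2.2.2),
    u.1 v.2.1 - v.1 u.2.1 - (m u.2.2.1 v.2.2.2 - m u.2.2.2 v.2.2.1),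
    u.1 v.2.2.1 - v.1 u.2.2.1 - (m u.2.2.2 v.2.1 - m u.2.1 v.2.2.2),
    u.1 v.2.2.2 - v.1 u.2.2.2 + (m u.2.1 v.2.2.1 - m u.2.2.1 v.2.1))

theorem tkkBracket_self (u : Module.End ℝ V × V × V × V) (hm : ∀ x y, m x y = m y x) :
    tkkBracket m u u = 0 := by
  refine Prod.ext ?_ (Prod.ext ?_ (Prod.ext ?_ ?_))
  · simp [tkkBracket, commBr_apply]
  · simp [tkkBracket, hm u.2.2.1]
  · simp [tkkBracket, hm u.2.1]
  · simp [tkkBracket, hm u.2.1]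

theorem derivation_mul {T : Module.End ℝ V} (hT : T ∈ derivations m) (a : V) :
    T * (m a : Module.End ℝ V) = (m (T a) : Module.End ℝ V) + (m a : Module.End ℝ V) * T :=
  LinearMap.ext fun x => mem_derivations.mp hT a x

theorem derivation_mul_mul {T : Module.End ℝ V} (hT : T ∈ derivations m) (a : V)
    (S : Module.End ℝ V) : T * ((m a : Module.End ℝ V) * S)
      = (m (T a) : Module.End ℝ V) * S + (m a : Module.End ℝ V) * (T * S) := by
  rw [← mul_assoc, derivation_mul hT, add_mul, mul_assoc]

/-- Only the component in End V needs the Jordan identity; the other three follow from commutativity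
and the Leibniz rule of the given derivations. -/
theorem tkkBracket_jacobi (hm : ∀ x y, m x y = m y x)
    (h : ∀ a b c : V, commBr (Module.End ℝ V) (m a) (m (m b c))
      + commBr (Module.End ℝ V) (m b) (m (m c a)) + commBr (Module.End ℝ V) (m c) (m (m a b)) = 0)
    {x y z : Module.End ℝ V × V × V × V} (hx : x.1 ∈ derivations m) (hy : y.1 ∈ derivations m)
    (hz : z.1 ∈ derivations m) :
    tkkBracket m x (tkkBracket m y z)
      = tkkBracket m (tkkBracket m x y) z + tkkBracket m y (tkkBracket m x z) := by
  obtain ⟨S, a₁, a₂, a₃⟩ := x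
  obtain ⟨T, b₁, b₂, b₃⟩ := y
  obtain ⟨U, c₁, c₂, c₃⟩ := z
  dsimp only at hx hy hz
  refine Prod.ext ?_ (Prod.ext ?_ (Prod.ext ?_ ?_))
  · have h1 := h a₁ b₂ c₃
    have h2 := h a₁ b₃ c₂
    have h3 := h a₂ b₁ c₃
    have h4 := h a₂ b₃ c₁
    have h5 := h a₃ b₁ c₂
    have h6 := h a₃ b₂ c₁
    simp only [tkkBracket, Prod.fst_add, commBr_apply] at h1 h2 h3 h4 h5 h6 ⊢
    simp only [map_add, map_sub, add_mul, mul_add, sub_mul,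
      mul_sub, mul_assoc, derivation_mul hx, derivation_mul hy, derivation_mul hz,
      derivation_mul_mul hx, derivation_mul_mul hy, derivation_mul_mul hz] at h1 h2 h3 h4 h5 h6 ⊢
    simp only [hm] at h1 h2 h3 h4 h5 h6 ⊢
    linear_combination (norm := abel) h2 - h1 + h3 - h4 - h5 + h6
  all_goals
    simp only [tkkBracket, Prod.fst_add, Prod.snd_add, commBr_apply, map_add, map_sub,
      LinearMap.add_apply, LinearMap.sub_apply, Module.End.mul_apply, mem_derivations.mp hx,
      mem_derivations.mp hy, mem_derivations.mp hz]
    simp only [hm]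
    abel

end JordanIdentity

namespace CompositionAlgebra

/-! ### The trace form and the mixed brackets -/

section TraceForm

variable {K : Type*} [NonAssocRing K] [Module ℝ K] [IsScalarTower ℝ K K] [SMulCommClass ℝ K K]
  [CompositionAlgebra K] {n : Type*} [Fintype n] [DecidableEq n]

theorem re_trace_mul_comm (X Y : Matrix n n K) : re K (X * Y).trace = re K (Y * X).trace := by
  simp only [Matrix.trace, Matrix.diag_apply, Matrix.mul_apply, map_sum]
  rw [Finset.sum_comm]
  simp only [re_mul_comm]

/-- Matrix multiplication is not associative, but associators in K have real part zero. -/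
theorem re_trace_mul_assoc (X Y Z : Matrix n n K) :
    re K (X * Y * Z).trace = re K (X * (Y * Z)).trace := by
  rw [← sub_eq_zero, ← map_sub, ← Matrix.trace_sub]
  change re K (∑ i, associator X Y Z i i) = 0
  simp [matrix_associator_apply, re_associator]

theorem hermTrace_apply (X : herm K n) : hermTrace K n X = re K X.1.trace := rfl

theorem conj_trace_herm {X : Matrix n n K} (h : dagger K n X = X) : conj K X.trace = X.trace := by
  rw [← trace_dagger, h]

theorem trace_herm (X : herm K n) : X.1.trace = hermTrace K n X • (1 : K) :=
  eq_re_smul_one (conj_trace_herm X.2)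

theorem mem_hermTraceless {X : herm K n} : X ∈ hermTraceless K n ↔ hermTrace K n X = 0 := by
  have h1 : X ∈ hermTraceless K n ↔ X.1.trace = 0 := Iff.rfl
  rw [h1, trace_herm]
  simp [one_ne_zero]

theorem hermTrace_jordan (X Y : herm K n) :
    hermTrace K n (jordan K n X Y) = 2 * re K (X.1 * Y.1).trace := by
  rw [hermTrace_apply, jordan_coe, Matrix.trace_add, map_add, re_trace_mul_comm Y.1]
  ring

theorem hermForm_apply (X Y : herm K n) :
    hermForm K n X Y = hermTrace K n (jordan K n X Y) := rfl

theorem hermForm_assoc (X Y Z : herm K n) :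
    hermForm K n (jordan K n X Y) Z = hermForm K n Y (jordan K n X Z) := by
  rw [hermForm_apply, hermForm_apply, hermTrace_jordan, hermTrace_jordan, jordan_coe, jordan_coe,
    add_mul, mul_add, Matrix.trace_add, Matrix.trace_add, map_add, map_add,
    re_trace_mul_assoc Y.1 X.1, re_trace_mul_assoc X.1 Y.1, re_trace_mul_comm X.1,
    re_trace_mul_assoc Y.1 Z.1]
  ring

/-- Pairing X with `offDiag i j z` gives 4⟨X_ij, z⟩, so the form of K detects every entry. -/
theorem hermForm_nondegenerate {X : herm K n} (h : ∀ Y, hermForm K n X Y = 0) : X = 0 := by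
  ext i j
  refine ext_form fun z => ?_
  have e := h (offDiag i j z)
  rw [hermForm_apply, hermTrace_jordan] at e
  have e2 : (X.1 * (offDiag i j z : herm K n).1).trace = X.1 j i * z + X.1 i j * conj K z := by
    change (X.1 * (Matrix.single i j z + Matrix.single j i (conj K z))).trace = _
    rw [mul_add, Matrix.trace_add]
    simp [Matrix.trace, Matrix.mul_apply, Matrix.single_apply, ite_and]
  rw [e2, map_add, herm_apply X.2 j i, re_mul_comm, re_mul_conj, re_mul_conj, form_comm z] at e
  simp
  linarith

theorem jordan_identity_linearized_H3 (A B C : H3 K) :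
    commBr (Module.End ℝ (H3 K)) (jordan K (Fin 3) A) (jordan K (Fin 3) (jordan K (Fin 3) B C))
      + commBr (Module.End ℝ (H3 K)) (jordan K (Fin 3) B)
        (jordan K (Fin 3) (jordan K (Fin 3) C A))
      + commBr (Module.End ℝ (H3 K)) (jordan K (Fin 3) C)
        (jordan K (Fin 3) (jordan K (Fin 3) A B)) = 0 :=
  jordan_identity_linearized (m := jordan K (Fin 3)) jordan_comm
    (jordan_identity_of_form (m := jordan K (Fin 3)) jordan_comm jordanComm_mem_derH3
      (hermForm K (Fin 3)) hermForm_assoc fun _ => hermForm_nondegenerate) A B C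

theorem hermOne_coe : (hermOne K n : Matrix n n K) = 1 := rfl

theorem jordan_one (X : herm K n) : jordan K n X (hermOne K n) = (2 : ℝ) • X :=
  Subtype.ext (by rw [jordan_coe, hermOne_coe, mul_one, one_mul, ← two_smul ℝ]; rfl)

theorem one_jordan (X : herm K n) : jordan K n (hermOne K n) X = (2 : ℝ) • X := by
  rw [jordan_comm, jordan_one]

theorem hermTrace_one : hermTrace K (Fin 3) (hermOne K (Fin 3)) = 3 := by
  rw [hermTrace_apply, hermOne_coe, Matrix.trace_one]
  have : ((Fintype.card (Fin 3) : ℕ) : K) = (3 : ℝ) • (1 : K) := by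
    rw [Fintype.card_fin, ← Nat.cast_smul_eq_nsmul ℝ 3 (1 : K) |>.trans (nsmul_one 3)]
    norm_num
  rw [this, map_smul, re_one]; norm_num

theorem act_one {u : MatEnd K n} (hu : u ∈ sa K n) : act K n u (hermOne K n) = 0 := by
  obtain ⟨⟨hA, hAt⟩, hD⟩ := mem_sa.mp hu
  refine Subtype.ext ?_
  rw [act_coe hA hD, hermOne_coe, mul_one, one_mul, sub_self, zero_add]
  ext i j
  by_cases h : i = j
  · subst h; simp [der_one hD]
  · simp [h]

theorem hermTrace_act {u : MatEnd K n} (hu : u ∈ sa K n) (X : herm K n) :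
    hermTrace K n (act K n u X) = 0 := by
  obtain ⟨⟨hA, hAt⟩, hD⟩ := mem_sa.mp hu
  rw [hermTrace_apply, act_coe hA hD, Matrix.trace_add, Matrix.trace_sub, map_add, map_sub,
    trace_map, re_der hD, re_trace_mul_comm, sub_self, zero_add]

theorem innerDer_swap (x y : K) : innerDer K y x = -innerDer K x y := by
  ext z
  rw [LinearMap.neg_apply, innerDer_apply, innerDer_apply, associator_swap_left]
  simp only [sub_mul, mul_sub]
  module

/-- Passing to the conjugate transposes changes the sign once and leaves D_{x̄,ȳ} = D_{x,y}, so the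
sum is its own negative. -/
theorem sum_innerDer_antiherm_herm {A H : Matrix n n K} (hA : dagger K n A = -A)
    (hH : dagger K n H = H) : ∑ i, ∑ j, innerDer K (A i j) (H j i) = 0 := by
  have h : ∑ i, ∑ j, innerDer K (A i j) (H j i) = -∑ i, ∑ j, innerDer K (A i j) (H j i) := by
    conv_lhs =>
      enter [2, i, 2, j]
      rw [antiherm_apply hA i j, herm_apply hH j i, map_neg, LinearMap.neg_apply, innerDer_conj]
    simp only [Finset.sum_neg_distrib]
    rw [Finset.sum_comm]
  have h2 : (2 : ℝ) • ∑ i, ∑ j, innerDer K (A i j) (H j i) = 0 := by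
    rw [two_smul]
    nth_rewrite 1 [h]
    exact neg_add_cancel _
  exact (smul_eq_zero.mp h2).resolve_left two_ne_zero

theorem trace_comm_antiherm_herm {A H : Matrix n n K} (hA : dagger K n A = -A)
    (hH : dagger K n H = H) : (A * H - H * A).trace = 0 := by
  have h : dagger K n (A * H - H * A) = A * H - H * A := by
    rw [map_sub, dagger_mul, dagger_mul, hA, hH, mul_neg, neg_mul]; abel
  rw [eq_re_smul_one (conj_trace_herm h), Matrix.trace_sub, map_sub, re_trace_mul_comm, sub_self,
    zero_smul]

theorem matBracket_swap (u v : MatEnd K n) : matBracket K n v u = -matBracket K n u v := by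
  refine Prod.ext ?_ ?_
  · have e : v.1 * u.1 - u.1 * v.1 = -(u.1 * v.1 - v.1 * u.1) := by abel
    have e2 (t : K) : Matrix.diagonal (fun _ : n => -t) = -Matrix.diagonal (fun _ => t) :=
      (Matrix.diagonal_neg _).symm
    rw [Prod.fst_neg, matBracket_fst, matBracket_fst, e, Matrix.trace_neg, e2, smul_neg]
    abel
  · have e : (commBr _ v.2 u.2 : Module.End ℝ K) = -commBr _ u.2 v.2 := by
      rw [commBr_apply, commBr_apply]; abel
    rw [Prod.snd_neg, matBracket_snd, matBracket_snd, e, Finset.sum_comm]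
    simp only [innerDer_swap (u.1 _ _), Finset.sum_neg_distrib, smul_neg]
    rw [neg_add]

theorem matBracket_sa_herm {u : MatEnd K n} (hu : u ∈ sa K n) (H : herm K n) :
    matBracket K n u (H.1, 0) = ((act K n u H).1, 0) := by
  obtain ⟨⟨hA, hAt⟩, hD⟩ := mem_sa.mp hu
  have e0 (Y : Matrix n n K) : Y.map (0 : Module.End ℝ K) = 0 := by ext; simp
  refine Prod.ext ?_ ?_
  · rw [matBracket_fst, trace_comm_antiherm_herm hA H.2, act_coe hA hD, e0]
    simp
  · rw [matBracket_snd, sum_innerDer_antiherm_herm hA H.2]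
    simp

end TraceForm

/-! ### Hermitian matrices with trace in Tits's space -/

section Iota

variable {K : Type*} [NonAssocRing K] [Module ℝ K] [IsScalarTower ℝ K K] [SMulCommClass ℝ K K]
  [CompositionAlgebra K]
  {L : Type*} [NonAssocRing L] [Module ℝ L] [IsScalarTower ℝ L L] [SMulCommClass ℝ L L]
  [CompositionAlgebra L]

variable (K) in
/-- The traceless part of a hermitian matrix of size `3`. -/
noncomputable def tracelessPart : H3 K →ₗ[ℝ] H3 K :=
  LinearMap.id - (3 : ℝ)⁻¹ • (hermTrace K (Fin 3)).smulRight (hermOne K (Fin 3))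

theorem tracelessPart_apply (S : H3 K) :
    tracelessPart K S = S - ((3 : ℝ)⁻¹ * hermTrace K (Fin 3) S) • hermOne K (Fin 3) := by
  simp [tracelessPart, mul_smul]

theorem tracelessPart_one : tracelessPart K (hermOne K (Fin 3)) = 0 := by
  rw [tracelessPart_apply, hermTrace_one]; norm_num

theorem tracelessPart_of_mem {S : H3 K} (h : S ∈ hermTraceless K (Fin 3)) :
    tracelessPart K S = S := by
  rw [tracelessPart_apply, mem_hermTraceless.mp h]; simp

theorem tracelessPart_mem (S : H3 K) : tracelessPart K S ∈ hermTraceless K (Fin 3) := by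
  rw [mem_hermTraceless, tracelessPart_apply, map_sub, map_smul, hermTrace_one, smul_eq_mul]
  ring

theorem eq_tracelessPart_add (S : H3 K) :
    S = tracelessPart K S + ((3 : ℝ)⁻¹ * hermTrace K (Fin 3) S) • hermOne K (Fin 3) := by
  rw [tracelessPart_apply]; abel

theorem starProd_eq (A B : H3 K) :
    starProd K (Fin 3) A B = tracelessPart K (jordan K (Fin 3) A B) := by
  simp [starProd, tracelessPart]

theorem jordan_expand (S S' : H3 K) : jordan K (Fin 3) S S'
    = jordan K (Fin 3) (tracelessPart K S) (tracelessPart K S')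
      + (2 * ((3 : ℝ)⁻¹ * hermTrace K (Fin 3) S)) • tracelessPart K S'
      + (2 * ((3 : ℝ)⁻¹ * hermTrace K (Fin 3) S')) • tracelessPart K S
      + (2 * ((3 : ℝ)⁻¹ * hermTrace K (Fin 3) S) * ((3 : ℝ)⁻¹ * hermTrace K (Fin 3) S'))
        • hermOne K (Fin 3) := by
  conv_lhs => rw [eq_tracelessPart_add S, eq_tracelessPart_add S']
  simp only [map_add, map_smul, LinearMap.add_apply, LinearMap.smul_apply, jordan_one, one_jordan]
  module

theorem jordanComm_tracelessPart (S S' : H3 K) :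
    jordanComm K (Fin 3) (tracelessPart K S) (tracelessPart K S') = jordanComm K (Fin 3) S S' := by
  have h1 (X : H3 K) : jordanComm K (Fin 3) (hermOne K (Fin 3)) X = 0 := by
    refine LinearMap.ext fun Y => ?_
    change jordan K (Fin 3) (hermOne K (Fin 3)) (jordan K (Fin 3) X Y)
      - jordan K (Fin 3) X (jordan K (Fin 3) (hermOne K (Fin 3)) Y) = 0
    rw [one_jordan, one_jordan, map_smul, sub_self]
  have h2 (X : H3 K) : jordanComm K (Fin 3) X (hermOne K (Fin 3)) = 0 := by
    refine LinearMap.ext fun Y => ?_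
    change jordan K (Fin 3) X (jordan K (Fin 3) (hermOne K (Fin 3)) Y)
      - jordan K (Fin 3) (hermOne K (Fin 3)) (jordan K (Fin 3) X Y) = 0
    rw [one_jordan, one_jordan, map_smul, sub_self]
  conv_rhs => rw [eq_tracelessPart_add S, eq_tracelessPart_add S']
  simp only [map_add, map_smul, LinearMap.add_apply, LinearMap.smul_apply, h1, h2, smul_zero,
    add_zero]

/-- The element of Tits's space that represents `S ⊗ x` for a hermitian matrix `S` which need not
be traceless. -/
noncomputable def titsTensor (S : H3 K) (x : L) : TitsSpace K L :=
  (0, tracelessPart K S ⊗ₜ[ℝ] x, ((3 : ℝ)⁻¹ * hermTrace K (Fin 3) S) • commBr L x)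

theorem titsBracket_apply (u v : TitsSpace K L) : titsBracket K L u v
    = (commBr _ u.1 v.1 - titsFst K L u.2.1 v.2.1,
        (u.1.rTensor L v.2.1 + u.2.2.lTensor (H3 K) v.2.1)
          - (v.1.rTensor L u.2.1 + v.2.2.lTensor (H3 K) u.2.1) + titsSnd K L u.2.1 v.2.1,
        commBr _ u.2.2 v.2.2 + titsThd K L u.2.1 v.2.1) := rfl

theorem innerDer_of_assoc (h : ∀ x y z : L, x * y * z = x * (y * z)) (x y : L) :
    innerDer L x y = commBr L (commBr L x y) := by
  ext z
  rw [innerDer_apply, associator, h, sub_self, smul_zero, sub_zero]; rfl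

theorem commBr_commBr_of_assoc (h : ∀ x y z : L, x * y * z = x * (y * z)) (x y : L) :
    commBr (Module.End ℝ L) (commBr L x) (commBr L y) = commBr L (commBr L x y) := by
  ext z
  simp only [commBr_apply, LinearMap.sub_apply, Module.End.mul_apply, mul_sub, sub_mul, h]
  abel

/-- This justifies letting C_x stand for I ⊗ x when the second algebra is associative. There D_{x,y}
= C_{[x,y]}, so (1/6)⟨A,B⟩ D_{x,y} is the trace part of (A·B) ⊗ ½[x,y], while the action of C_x on
the tensors supplies the terms of the Jordan product that involve I. -/
theorem titsBracket_titsTensor (h : ∀ x y z : L, x * y * z = x * (y * z)) (S S' : H3 K)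
    (x y : L) : titsBracket K L (titsTensor S x) (titsTensor S' y)
      = (-(form L x y • jordanComm K (Fin 3) S S'), 0, 0)
        + titsTensor (jordan K (Fin 3) S S') ((1 / 2 : ℝ) • commBr L x y) := by
  rw [titsBracket_apply]
  refine Prod.ext ?_ (Prod.ext ?_ ?_)
  · simp [titsTensor, titsFst, jordanComm_tracelessPart]
  · have e : commBr L y x = -commBr L x y := by
      rw [commBr_apply, commBr_apply]; abel
    simp only [titsTensor, titsSnd, LinearMap.rTensor_zero, LinearMap.zero_apply, zero_add,
      LinearMap.lTensor_tmul, LinearMap.smul_apply, e, TensorProduct.map₂_apply_tmul,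
      TensorProduct.map_tmul, starProd_eq, Prod.snd_add, Prod.fst_add]
    conv_rhs => rw [jordan_expand, map_add, map_add, map_add, map_smul, map_smul, map_smul,
      tracelessPart_one, tracelessPart_of_mem (tracelessPart_mem S),
      tracelessPart_of_mem (tracelessPart_mem S')]
    simp only [TensorProduct.add_tmul, TensorProduct.tmul_smul, ← TensorProduct.smul_tmul',
      TensorProduct.tmul_neg, smul_zero, add_zero]
    module
  · have e : hermTrace K (Fin 3) (jordan K (Fin 3) S S')
        = hermForm K (Fin 3) (tracelessPart K S) (tracelessPart K S')
          + 6 * ((3 : ℝ)⁻¹ * hermTrace K (Fin 3) S) * ((3 : ℝ)⁻¹ * hermTrace K (Fin 3) S') := by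
      rw [jordan_expand, map_add, map_add, map_add, map_smul, map_smul, map_smul, hermTrace_one,
        mem_hermTraceless.mp (tracelessPart_mem S), mem_hermTraceless.mp (tracelessPart_mem S'),
        hermForm_apply, smul_zero, smul_zero, smul_eq_mul]
      ring
    simp only [titsTensor, titsThd, Prod.snd_add, zero_add, e, map_smul, LinearMap.smul_apply,
      LinearMap.compr₂_apply, TensorProduct.map₂_apply_tmul, TensorProduct.map_tmul,
      innerDer_of_assoc h,
      commBr_commBr_of_assoc h, LinearEquiv.coe_coe, TensorProduct.lid_tmul]
    module

/-- Derivations of this form kill I and have traceless values, so they commute with taking traceless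
parts. -/
theorem titsBracket_act_titsTensor {u : MatEnd K (Fin 3)} (hu : u ∈ sa K (Fin 3)) (S : H3 K)
    (x : L) : titsBracket K L (act K (Fin 3) u, 0, 0) (titsTensor S x)
      = titsTensor (act K (Fin 3) u S) x := by
  have e : tracelessPart K (act K (Fin 3) u S) = act K (Fin 3) u (tracelessPart K S) := by
    rw [tracelessPart_apply, tracelessPart_apply, hermTrace_act hu, map_sub, map_smul, act_one hu]
    simp
  rw [titsBracket_apply]
  refine Prod.ext ?_ (Prod.ext ?_ ?_)
  · simp [titsTensor]
    exact sub_zero (0 : Module.End ℝ (H3 K))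
  · simp [titsTensor, e]
  · simp [titsTensor, hermTrace_act hu]

theorem titsBracket_fst (S T : Module.End ℝ (H3 K)) :
    titsBracket K L (S, 0, 0) (T, 0, 0) = (commBr _ S T, 0, 0) := by
  rw [titsBracket_apply]
  simp
  exact sub_zero (commBr (Module.End ℝ (H3 K)) S T)

theorem titsBracket_titsTensor_act {u : MatEnd K (Fin 3)} (hu : u ∈ sa K (Fin 3)) (S : H3 K)
    (x : L) : titsBracket K L (titsTensor S x) (act K (Fin 3) u, 0, 0)
      = -titsTensor (act K (Fin 3) u S) x := by
  have e : tracelessPart K (act K (Fin 3) u S) = act K (Fin 3) u (tracelessPart K S) := by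
    rw [tracelessPart_apply, tracelessPart_apply, hermTrace_act hu, map_sub, map_smul, act_one hu]
    simp
  rw [titsBracket_apply]
  refine Prod.ext ?_ (Prod.ext ?_ ?_)
  · simp [titsTensor]
  · simp [titsTensor, e]
  · simp [titsTensor, hermTrace_act hu]

end Iota

end CompositionAlgebra

/-! ### Transport of Lie brackets along a common parametrization -/

namespace IsLie
variable {V W P : Type*} [AddCommGroup V] [Module ℝ V] [AddCommGroup W] [Module ℝ W]
  [AddCommMonoid P] [Module ℝ P]

/-- Two subspaces that are parametrized injectively by the same space, compatibly with bilinear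
brackets of which one is known to be a Lie bracket, are isomorphic Lie algebras. -/
theorem exists_lieEquiv_of_param {b : V →ₗ[ℝ] V →ₗ[ℝ] V} {b' : W →ₗ[ℝ] W →ₗ[ℝ] W}
    {L : Submodule ℝ V} {L' : Submodule ℝ W} (f : P →ₗ[ℝ] V) (g : P →ₗ[ℝ] W)
    (hf : Function.Injective f) (hg : Function.Injective g) (hfL : LinearMap.range f = L)
    (hgL : LinearMap.range g = L')
    (hbr : ∀ p q, ∃ r, b (f p) (f q) = f r ∧ b' (g p) (g q) = g r)
    (hself : ∀ p, b' (g p) (g p) = 0)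
    (hjac : ∀ p q r, b' (g p) (b' (g q) (g r))
      = b' (b' (g p) (g q)) (g r) + b' (g q) (b' (g p) (g r))) :
    ∃ (hL' : IsLie b' L') (hL : IsLie b L) (e : hL'.Carrier ≃ₗ⁅ℝ⁆ hL.Carrier),
      ∀ p, ∃ u : hL'.Carrier, hL'.val u = g p ∧ hL.val (e u) = f p := by
  subst hfL hgL
  choose β hβf hβg using hbr
  have hL' : IsLie b' (LinearMap.range g) := by
    refine ⟨?_, ?_, ?_⟩
    · rintro _ ⟨p, rfl⟩ _ ⟨q, rfl⟩
      exact ⟨β p q, (hβg p q).symm⟩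
    · rintro _ ⟨p, rfl⟩
      exact hself p
    · rintro _ ⟨p, rfl⟩ _ ⟨q, rfl⟩ _ ⟨r, rfl⟩
      exact hjac p q r
  have hL : IsLie b (LinearMap.range f) := by
    refine ⟨?_, ?_, ?_⟩
    · rintro _ ⟨p, rfl⟩ _ ⟨q, rfl⟩
      exact ⟨β p q, (hβf p q).symm⟩
    · rintro _ ⟨p, rfl⟩
      -- An identity known for `b'` descends to the parameters because `g` is injective, and `f`
      -- then carries it over to `b`.
      have h : β p p = 0 := hg (by rw [← hβg p p, hself, map_zero])
      rw [hβf, h, map_zero]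
    · rintro _ ⟨p, rfl⟩ _ ⟨q, rfl⟩ _ ⟨r, rfl⟩
      have h : β p (β q r) = β (β p q) r + β q (β p r) :=
        hg (by
        rw [map_add, ← hβg p (β q r), ← hβg (β p q) r, ← hβg q (β p r), ← hβg q r, ← hβg p q,
          ← hβg p r, hjac])
      rw [hβf q r, hβf p q, hβf p r, hβf, hβf, hβf, h, map_add]
  let e : LinearMap.range g ≃ₗ[ℝ] LinearMap.range f :=
    (LinearEquiv.ofInjective g hg).symm.trans (LinearEquiv.ofInjective f hf)
  have he (p : P) : e ⟨g p, p, rfl⟩ = ⟨f p, p, rfl⟩ := by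
    have : (LinearEquiv.ofInjective g hg).symm ⟨g p, p, rfl⟩ = p := by
      rw [LinearEquiv.symm_apply_eq]; rfl
    simp only [e, LinearEquiv.trans_apply, this]
    rfl
  let cg (p : P) : hL'.Carrier := (⟨g p, p, rfl⟩ : LinearMap.range g)
  let cf (p : P) : hL.Carrier := (⟨f p, p, rfl⟩ : LinearMap.range f)
  let E : hL'.Carrier ≃ₗ[ℝ] hL.Carrier :=
    { toFun := fun x => e x
      map_add' := fun x y => e.map_add x y
      map_smul' := fun c x => e.map_smul c x
      invFun := fun x => e.symm x
      left_inv := e.left_inv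
      right_inv := e.right_inv }
  have hE (p : P) : E (cg p) = cf p := he p
  have hlie (x y : hL'.Carrier) : E ⁅x, y⁆ = ⁅E x, E y⁆ := by
    obtain ⟨_, p, rfl⟩ := x
    obtain ⟨_, q, rfl⟩ := y
    have h1 : ⁅cg p, cg q⁆ = cg (β p q) := Subtype.ext (hβg p q)
    have h2 : ⁅cf p, cf q⁆ = cf (β p q) := Subtype.ext (hβf p q)
    change E ⁅cg p, cg q⁆ = ⁅E (cg p), E (cg q)⁆
    rw [h1, hE, hE, hE, h2]
  refine ⟨hL', hL, { E with map_lie' := fun {x y} => hlie x y }, fun p => ⟨cg p, rfl, ?_⟩⟩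
  exact congrArg Subtype.val (he p)
end IsLie

namespace CompositionAlgebra

/-! ### Brackets of endomorphisms and tensors -/

section TitsSpace

variable {K : Type*} [NonAssocRing K] [Module ℝ K] [IsScalarTower ℝ K K] [SMulCommClass ℝ K K]
  [CompositionAlgebra K]
  {L : Type*} [NonAssocRing L] [Module ℝ L] [IsScalarTower ℝ L L] [SMulCommClass ℝ L L]
  [CompositionAlgebra L]

variable (K L) in
/-- The inclusion of the endomorphisms of `H₃(K)` in Tits's space. -/
noncomputable def titsEnd : Module.End ℝ (H3 K) →ₗ[ℝ] TitsSpace K L := LinearMap.inl ℝ _ _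

variable (K) in
/-- The map `S ↦ S ⊗ x`, with values in Tits's space. -/
noncomputable def titsTensorₗ (x : L) : H3 K →ₗ[ℝ] TitsSpace K L where
  toFun S := titsTensor S x
  map_add' S S' := by
    refine Prod.ext ?_ (Prod.ext ?_ ?_)
    · simp [titsTensor]
    · simp [titsTensor, TensorProduct.add_tmul]
    · simp [titsTensor, mul_add, add_smul]
  map_smul' c S := by
    refine Prod.ext ?_ (Prod.ext ?_ ?_)
    · simp [titsTensor]
    · simp [titsTensor, TensorProduct.smul_tmul']
    · simp [titsTensor, mul_left_comm _ c, mul_smul]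

theorem titsTensorₗ_apply (x : L) (S : H3 K) : titsTensorₗ K x S = titsTensor S x := rfl

theorem titsTensorₗ_neg (x : L) (S : H3 K) : titsTensorₗ K (-x) S = -titsTensorₗ K x S := by
  refine Prod.ext ?_ (Prod.ext ?_ ?_)
  · exact LinearMap.ext fun X => by simp [titsTensorₗ_apply, titsTensor]
  · simp [titsTensorₗ_apply, titsTensor, TensorProduct.tmul_neg]
  · simp [titsTensorₗ_apply, titsTensor]

theorem titsTensorₗ_zero (S : H3 K) : titsTensorₗ K (0 : L) S = 0 := by
  refine Prod.ext ?_ (Prod.ext ?_ ?_)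
  · simp [titsTensorₗ_apply, titsTensor]
  · simp [titsTensorₗ_apply, titsTensor]
  · simp [titsTensorₗ_apply, titsTensor]

theorem titsBracket_end_end (S T : Module.End ℝ (H3 K)) :
    titsBracket K L (titsEnd K L S) (titsEnd K L T) = titsEnd K L (commBr _ S T) :=
  titsBracket_fst S T

theorem titsBracket_end_tensor {T : Module.End ℝ (H3 K)} (hT : T ∈ derH3 K) (S : H3 K) (x : L) :
    titsBracket K L (titsEnd K L T) (titsTensorₗ K x S) = titsTensorₗ K x (T S) := by
  obtain ⟨u, hu, rfl⟩ := exists_act_eq hT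
  exact titsBracket_act_titsTensor hu S x

theorem titsBracket_tensor_end {T : Module.End ℝ (H3 K)} (hT : T ∈ derH3 K) (S : H3 K) (x : L) :
    titsBracket K L (titsTensorₗ K x S) (titsEnd K L T) = -titsTensorₗ K x (T S) := by
  obtain ⟨u, hu, rfl⟩ := exists_act_eq hT
  exact titsBracket_titsTensor_act hu S x

/-- The bracket of two tensors with the same second factor `x`. -/
theorem titsBracket_tensor_self (h : ∀ x y z : L, x * y * z = x * (y * z)) {x : L} {c : ℝ}
    (hx : form L x x = -c) (S S' : H3 K) :
    titsBracket K L (titsTensorₗ K x S) (titsTensorₗ K x S')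
      = c • titsEnd K L (jordanComm K (Fin 3) S S') := by
  have e : (1 / 2 : ℝ) • commBr L x x = 0 := by rw [commBr_apply, sub_self, smul_zero]
  have e2 : titsTensor (jordan K (Fin 3) S S') (0 : L) = 0 := titsTensorₗ_zero _
  rw [titsTensorₗ_apply, titsTensorₗ_apply, titsBracket_titsTensor h, e, e2, add_zero, hx]
  refine Prod.ext (LinearMap.ext fun X => ?_) ?_
  · simp [titsEnd]
  · simp [titsEnd]

/-- The bracket of two tensors with orthogonal second factors. -/
theorem titsBracket_tensor_orthogonal (h : ∀ x y z : L, x * y * z = x * (y * z)) {x y z : L}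
    (hxy : form L x y = 0) (hz : (1 / 2 : ℝ) • commBr L x y = z) (S S' : H3 K) :
    titsBracket K L (titsTensorₗ K x S) (titsTensorₗ K y S')
      = titsTensorₗ K z (jordan K (Fin 3) S S') := by
  rw [titsTensorₗ_apply, titsTensorₗ_apply, titsBracket_titsTensor h, hxy, hz]
  refine Prod.ext (LinearMap.ext fun X => ?_) (Prod.ext ?_ ?_)
  · simp [titsTensorₗ_apply]
  · simp [titsTensorₗ_apply]
  · simp [titsTensorₗ_apply]

theorem mem_L3 {u : TitsSpace K L} : u ∈ L3 K L ↔ u.1 ∈ derH3 K ∧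
    u.2.1 ∈ LinearMap.range (TensorProduct.mapIncl (hermTraceless K (Fin 3)) (imag L)) ∧
    u.2.2 ∈ der L := Iff.rfl

theorem titsEnd_mem {T : Module.End ℝ (H3 K)} (hT : T ∈ derH3 K) : titsEnd K L T ∈ L3 K L :=
  mem_L3.mpr ⟨hT, Submodule.zero_mem _, Submodule.zero_mem _⟩

theorem commBr_mem_der_of_assoc (h : ∀ x y z : L, x * y * z = x * (y * z)) (x : L) :
    commBr L x ∈ der L := by
  rw [mem_der]
  intro y z
  simp only [commBr_apply, sub_mul, mul_sub, h]
  abel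

theorem titsTensor_mem (h : ∀ x y z : L, x * y * z = x * (y * z)) {x : L} (hx : x ∈ imag L)
    (S : H3 K) : titsTensorₗ K x S ∈ L3 K L :=
  mem_L3.mpr ⟨Submodule.zero_mem _,
    ⟨(⟨_, tracelessPart_mem S⟩ : hermTraceless K (Fin 3)) ⊗ₜ (⟨x, hx⟩ : imag L), rfl⟩,
    Submodule.smul_mem _ _ (commBr_mem_der_of_assoc h x)⟩

/-- The coefficient in `H₃(K)` of an element of `H₃(K) ⊗ L`, with respect to a functional. -/
noncomputable def tensorCoeff (f : L →ₗ[ℝ] ℝ) : H3 K ⊗[ℝ] L →ₗ[ℝ] H3 K :=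
  (TensorProduct.rid ℝ (H3 K)).toLinearMap ∘ₗ f.lTensor (H3 K)

theorem tensorCoeff_tmul (f : L →ₗ[ℝ] ℝ) (H : H3 K) (x : L) :
    tensorCoeff f (H ⊗ₜ[ℝ] x) = f x • H := by
  simp [tensorCoeff]

theorem eq_zero_of_tracelessPart_eq_zero {S : H3 K} (h : tracelessPart K S = 0)
    (ht : hermTrace K (Fin 3) S = 0) : S = 0 := by
  rw [eq_tracelessPart_add S, h, ht]; simp

end TitsSpace

/-! ### Forms, imaginary parts and derivations of the split algebras -/

section SplitAlgebras

theorem form_splitComplex (x y : SplitComplex) :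
    form SplitComplex x y = x.re * y.re - x.im * y.im := by
  rw [form_apply]
  simp [normSq, quadOfBilin]
  ring

theorem form_splitQuaternion (x y : SplitQuaternion) :
    form SplitQuaternion x y = x.re * y.re - x.imI * y.imI - x.imJ * y.imJ + x.imK * y.imK := by
  rw [form_apply]
  simp [normSq, quadOfBilin]
  ring

theorem form_real (x y : ℝ) : form ℝ x y = x * y := by
  rw [form_apply]
  simp [normSq, quadOfBilin]
  ring

theorem mem_imag {L : Type*} [NonAssocRing L] [Module ℝ L] [IsScalarTower ℝ L L]
    [SMulCommClass ℝ L L] [CompositionAlgebra L] {x : L} : x ∈ imag L ↔ form L x 1 = 0 := Iff.rfl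

theorem imag_real {x : ℝ} (h : x ∈ imag ℝ) : x = 0 := by
  simpa [mem_imag, form_real] using h

theorem mem_imag_splitComplex {x : SplitComplex} : x ∈ imag SplitComplex ↔ x.re = 0 := by
  rw [mem_imag, form_splitComplex, QuadraticAlgebra.re_one, QuadraticAlgebra.im_one]
  simp

theorem mem_imag_splitQuaternion {x : SplitQuaternion} : x ∈ imag SplitQuaternion ↔ x.re = 0 := by
  simp [mem_imag, form_splitQuaternion]

theorem der_real {D : Module.End ℝ ℝ} (hD : D ∈ der ℝ) : D = 0 :=
  LinearMap.ext_ring (der_one hD)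

theorem splitComplex_eq (x : SplitComplex) :
    x = x.re • (1 : SplitComplex) + x.im • SplitComplex.i := by
  ext
  · simp only [QuadraticAlgebra.re_add, QuadraticAlgebra.re_smul]
    rw [QuadraticAlgebra.re_one]
    simp [SplitComplex.i]
  · simp only [QuadraticAlgebra.im_add, QuadraticAlgebra.im_smul]
    rw [QuadraticAlgebra.im_one]
    simp [SplitComplex.i]

theorem splitComplex_i_mul_i : SplitComplex.i * SplitComplex.i = 1 := by
  ext
  · rw [QuadraticAlgebra.re_one]; simp [SplitComplex.i]
  · rw [QuadraticAlgebra.im_one]; simp [SplitComplex.i]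

theorem der_splitComplex {D : Module.End ℝ SplitComplex} (hD : D ∈ der SplitComplex) : D = 0 := by
  have h1 := der_one hD
  have hre : (D SplitComplex.i).re = 0 := mem_imag_splitComplex.mp (re_der hD SplitComplex.i)
  have hi := mem_der.mp hD SplitComplex.i SplitComplex.i
  rw [splitComplex_i_mul_i, h1] at hi
  have him := congrArg QuadraticAlgebra.re hi
  simp [SplitComplex.i] at him hre
  have hi0 : D SplitComplex.i = 0 := by
    ext
    · exact hre
    · simp [SplitComplex.i]; linarith
  ext1 x
  rw [splitComplex_eq x, map_add, map_smul, map_smul, h1, hi0]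
  simp

open SplitQuaternion in
theorem splitQuaternion_eq (x : SplitQuaternion) :
    x = x.re • (1 : SplitQuaternion) + x.imI • i + x.imJ • j + x.imK • k := by
  ext <;> simp [i, j, k]

open SplitQuaternion in
-- D is determined by Di and Dj, since k = ij. Differentiating the relations among i and j leaves Di
-- = b j + c k and Dj = -b i + d k.
theorem der_splitQuaternion {D : Module.End ℝ SplitQuaternion} (hD : D ∈ der SplitQuaternion) :
    ∃ r₁ r₂ r₃ : ℝ, D = r₁ • commBr SplitQuaternion i + r₂ • commBr SplitQuaternion j
      + r₃ • commBr SplitQuaternion k := by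
  have h1 := der_one hD
  have hiRe : (D i).re = 0 := mem_imag_splitQuaternion.mp (re_der hD i)
  have hjRe : (D j).re = 0 := mem_imag_splitQuaternion.mp (re_der hD j)
  have ii := mem_der.mp hD i i
  have jj := mem_der.mp hD j j
  have ij := mem_der.mp hD i j
  have ji := mem_der.mp hD j i
  have eii : i * i = 1 := by ext <;> simp [i]
  have ejj : j * j = 1 := by ext <;> simp [j]
  have eij : i * j = k := by ext <;> simp [i, j, k]
  have eji : j * i = -k := by ext <;> simp [i, j, k]
  rw [eii, h1] at ii
  rw [ejj, h1] at jj
  rw [eij] at ij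
  rw [eji, map_neg, ij] at ji
  have a1 := congrArg QuaternionAlgebra.re ii
  have a2 := congrArg QuaternionAlgebra.re jj
  have a3 := congrArg QuaternionAlgebra.re ji
  simp [i, j] at a1 a2 a3
  -- Solved from C_j(i) = -2k, C_k(i) = -2j, C_i(j) = 2k and C_k(j) = 2i.
  refine ⟨(D j).imK / 2, -(D i).imK / 2, -(D i).imJ / 2, ?_⟩
  have hi : D i = ⟨0, 0, (D i).imJ, (D i).imK⟩ := by
    ext
    · exact hiRe
    · simp [i]; linarith
    · rfl
    · rfl
  have hj : D j = ⟨0, -(D i).imJ, 0, (D j).imK⟩ := by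
    ext
    · exact hjRe
    · simp [i, j]; linarith
    · simp [j]; linarith
    · rfl
  generalize (D i).imJ = b at *
  generalize (D i).imK = c at *
  generalize (D j).imK = d at *
  ext1 x
  rw [splitQuaternion_eq x]
  simp only [map_add, map_smul, h1, ij, hi, hj]
  simp only [commBr_apply, LinearMap.add_apply, LinearMap.smul_apply]
  ext <;> simp [i, j, k] <;> ring

end SplitAlgebras

end CompositionAlgebra

namespace CompositionAlgebra

/-! ### L₃(K, split quaternions) as a Tits-Kantor-Koecher algebra -/

section SplitQuaternionTits

variable {K : Type*} [NonAssocRing K] [Module ℝ K] [IsScalarTower ℝ K K] [SMulCommClass ℝ K K]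
  [CompositionAlgebra K]

open SplitQuaternion

variable (K) in
/-- The element `T + S₁ ⊗ i + S₂ ⊗ j + S₃ ⊗ k` of Tits's space for the split quaternions. -/
noncomputable def titsQuaternion : (Module.End ℝ (H3 K) × H3 K × H3 K × H3 K) →ₗ[ℝ]
    TitsSpace K SplitQuaternion :=
  (titsEnd K SplitQuaternion).coprod
    ((titsTensorₗ K i).coprod ((titsTensorₗ K j).coprod (titsTensorₗ K k)))

theorem titsQuaternion_apply (u : Module.End ℝ (H3 K) × H3 K × H3 K × H3 K) :
    titsQuaternion K u = titsEnd K SplitQuaternion u.1 + (titsTensorₗ K i u.2.1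
      + (titsTensorₗ K j u.2.2.1 + titsTensorₗ K k u.2.2.2)) := rfl

theorem splitQuaternion_assoc (x y z : SplitQuaternion) : x * y * z = x * (y * z) :=
  mul_assoc x y z

/-- The units are orthogonal with ⟨i,i⟩ = ⟨j,j⟩ = -1, ⟨k,k⟩ = 1, and ½[i,j] = k, ½[j,k] = -i, ½[k,i]
= -j. These are the signs in `tkkBracket`. -/
theorem titsBracket_titsQuaternion {u v : Module.End ℝ (H3 K) × H3 K × H3 K × H3 K}
    (hu : u.1 ∈ derH3 K) (hv : v.1 ∈ derH3 K) :
    titsBracket K SplitQuaternion (titsQuaternion K u) (titsQuaternion K v)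
      = titsQuaternion K (tkkBracket (jordan K (Fin 3)) u v) := by
  have hii := titsBracket_tensor_self (K := K) splitQuaternion_assoc (x := i) (c := 1)
    (by rw [form_splitQuaternion]; simp [i])
  have hjj := titsBracket_tensor_self (K := K) splitQuaternion_assoc (x := j) (c := 1)
    (by rw [form_splitQuaternion]; simp [j])
  have hkk := titsBracket_tensor_self (K := K) splitQuaternion_assoc (x := k) (c := -1)
    (by rw [form_splitQuaternion]; simp [k])
  have hij := titsBracket_tensor_orthogonal (K := K) splitQuaternion_assoc (x := i) (y := j)
    (z := k) (by rw [form_splitQuaternion]; simp [i, j])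
    (by rw [commBr_apply]; ext <;> simp [i, j, k]; norm_num)
  have hji := titsBracket_tensor_orthogonal (K := K) splitQuaternion_assoc (x := j) (y := i)
    (z := -k) (by rw [form_splitQuaternion]; simp [i, j])
    (by rw [commBr_apply]; ext <;> simp [i, j, k]; norm_num)
  have hjk := titsBracket_tensor_orthogonal (K := K) splitQuaternion_assoc (x := j) (y := k)
    (z := -i) (by rw [form_splitQuaternion]; simp [k, j])
    (by rw [commBr_apply]; ext <;> simp [i, j, k]; norm_num)
  have hkj := titsBracket_tensor_orthogonal (K := K) splitQuaternion_assoc (x := k) (y := j)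
    (z := i) (by rw [form_splitQuaternion]; simp [k, j])
    (by rw [commBr_apply]; ext <;> simp [i, j, k]; norm_num)
  have hki := titsBracket_tensor_orthogonal (K := K) splitQuaternion_assoc (x := k) (y := i)
    (z := -j) (by rw [form_splitQuaternion]; simp [k, i])
    (by rw [commBr_apply]; ext <;> simp [i, j, k]; norm_num)
  have hik := titsBracket_tensor_orthogonal (K := K) splitQuaternion_assoc (x := i) (y := k)
    (z := j) (by rw [form_splitQuaternion]; simp [k, i])
    (by rw [commBr_apply]; ext <;> simp [i, j, k]; norm_num)
  obtain ⟨S, a₁, a₂, a₃⟩ := u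
  obtain ⟨T, b₁, b₂, b₃⟩ := v
  dsimp only at hu hv
  have key : titsEnd K SplitQuaternion (tkkBracket (jordan K (Fin 3)) (S, a₁, a₂, a₃)
      (T, b₁, b₂, b₃)).1 = titsEnd K SplitQuaternion (commBr _ S T)
        + titsEnd K SplitQuaternion (jordanComm K (Fin 3) a₁ b₁)
        + titsEnd K SplitQuaternion (jordanComm K (Fin 3) a₂ b₂)
        - titsEnd K SplitQuaternion (jordanComm K (Fin 3) a₃ b₃) := by
    have hc (a b : H3 K) : jordanComm K (Fin 3) a b
      = commBr (Module.End ℝ (H3 K)) (jordan K (Fin 3) a) (jordan K (Fin 3) b) := rfl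
    refine Prod.ext (LinearMap.ext fun X => ?_) ?_
    · simp [titsEnd, tkkBracket, hc]
    · simp [titsEnd]
      exact (sub_zero (0 : (H3 K ⊗[ℝ] SplitQuaternion) × Module.End ℝ SplitQuaternion)).symm
  have hr := titsQuaternion_apply (tkkBracket (jordan K (Fin 3)) (S, a₁, a₂, a₃) (T, b₁, b₂, b₃))
  rw [key] at hr
  refine Eq.trans ?_ hr.symm
  simp only [titsQuaternion_apply, tkkBracket, map_add, map_sub, LinearMap.add_apply,
    titsBracket_end_end, titsBracket_end_tensor hu, titsBracket_tensor_end hv, hii, hjj, hkk, hij,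
    hji, hjk, hkj, hki, hik, titsTensorₗ_neg]
  module

theorem titsQuaternion_injective : Function.Injective (titsQuaternion K) := by
  refine (injective_iff_map_eq_zero _).mpr ?_
  rintro ⟨T, a₁, a₂, a₃⟩ h
  rw [titsQuaternion_apply] at h
  have h1 : T = 0 := by
    have := congrArg Prod.fst h
    ext1 X
    have := LinearMap.congr_fun this X
    simpa [titsEnd, titsTensorₗ_apply, titsTensor] using this
  have h2 := congrArg (fun u => u.2.1) h
  have h3 := congrArg (fun u => u.2.2) h
  simp only [titsEnd, titsTensorₗ_apply, titsTensor, LinearMap.inl_apply, Prod.snd_add,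
    Prod.fst_add, Prod.snd_zero, Prod.fst_zero, zero_add] at h2 h3
  have c1 := congrArg (tensorCoeff (QuaternionAlgebra.imIₗ 1 0 1)) h2
  have c2 := congrArg (tensorCoeff (QuaternionAlgebra.imJₗ 1 0 1)) h2
  have c3 := congrArg (tensorCoeff (QuaternionAlgebra.imKₗ 1 0 1)) h2
  -- The tensor component determines the traceless parts. The traces are the coefficients of C_i,
  -- C_j, C_k, found by evaluating at i and j.
  have d1 := LinearMap.congr_fun h3 i
  have d2 := LinearMap.congr_fun h3 j
  simp only [LinearMap.add_apply, LinearMap.smul_apply, commBr_apply] at d1 d2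
  have d3 := congrArg QuaternionAlgebra.imK d1
  have d4 := congrArg QuaternionAlgebra.imJ d1
  have d5 := congrArg QuaternionAlgebra.imK d2
  simp [i, j, k] at d3 d4 d5
  simp [tensorCoeff_tmul, i, j, k] at c1 c2 c3
  rw [h1, eq_zero_of_tracelessPart_eq_zero c1 d5,
    eq_zero_of_tracelessPart_eq_zero c2 (d3.resolve_right (by norm_num)),
    eq_zero_of_tracelessPart_eq_zero c3 (d4.resolve_right (by norm_num))]
  rfl

theorem exists_eq_of_mem_range_mapIncl {t : H3 K ⊗[ℝ] SplitQuaternion}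
    (h : t ∈ LinearMap.range
      (TensorProduct.mapIncl (hermTraceless K (Fin 3)) (imag SplitQuaternion))) :
    ∃ H₁ ∈ hermTraceless K (Fin 3), ∃ H₂ ∈ hermTraceless K (Fin 3),
      ∃ H₃ ∈ hermTraceless K (Fin 3), t = H₁ ⊗ₜ[ℝ] i + H₂ ⊗ₜ[ℝ] j + H₃ ⊗ₜ[ℝ] k := by
  obtain ⟨s, rfl⟩ := h
  induction s using TensorProduct.induction_on with
  | zero => exact ⟨0, Submodule.zero_mem _, 0, Submodule.zero_mem _, 0, Submodule.zero_mem _,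
      by simp⟩
  | tmul H x =>
    refine ⟨x.1.imI • H.1, Submodule.smul_mem _ _ H.2, x.1.imJ • H.1, Submodule.smul_mem _ _ H.2,
      x.1.imK • H.1, Submodule.smul_mem _ _ H.2, ?_⟩
    have e := splitQuaternion_eq x.1
    rw [mem_imag_splitQuaternion.mp x.2, zero_smul, zero_add] at e
    change H.1 ⊗ₜ[ℝ] x.1 = _
    conv_lhs => rw [e]
    simp only [TensorProduct.tmul_add, TensorProduct.tmul_smul, TensorProduct.smul_tmul']
  | add s s' hs hs' =>
    obtain ⟨A₁, hA₁, A₂, hA₂, A₃, hA₃, e⟩ := hs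
    obtain ⟨B₁, hB₁, B₂, hB₂, B₃, hB₃, e'⟩ := hs'
    refine ⟨_, Submodule.add_mem _ hA₁ hB₁, _, Submodule.add_mem _ hA₂ hB₂, _,
      Submodule.add_mem _ hA₃ hB₃, ?_⟩
    rw [map_add, e, e']
    simp only [TensorProduct.add_tmul]
    abel

/-- The tensor of a hermitian matrix that is given by its traceless part and its trace. -/
theorem titsTensorₗ_add_smul_one {L : Type*} [NonAssocRing L] [Module ℝ L] [IsScalarTower ℝ L L]
    [SMulCommClass ℝ L L] [CompositionAlgebra L] {H : H3 K} (hH : H ∈ hermTraceless K (Fin 3))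
    (r : ℝ) (x : L) : titsTensorₗ K x (H + r • hermOne K (Fin 3))
      = (0, H ⊗ₜ[ℝ] x, r • commBr L x) := by
  have e : hermTrace K (Fin 3) (H + r • hermOne K (Fin 3)) = 3 * r := by
    rw [map_add, map_smul, hermTrace_one, mem_hermTraceless.mp hH, smul_eq_mul]; ring
  rw [titsTensorₗ_apply, titsTensor, map_add, map_smul, tracelessPart_one,
    tracelessPart_of_mem hH, e, smul_zero, add_zero, inv_mul_cancel_left₀ three_ne_zero]

theorem titsQuaternion_add_smul_one (T : Module.End ℝ (H3 K)) {H₁ H₂ H₃ : H3 K}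
    (h₁ : H₁ ∈ hermTraceless K (Fin 3)) (h₂ : H₂ ∈ hermTraceless K (Fin 3))
    (h₃ : H₃ ∈ hermTraceless K (Fin 3)) (r₁ r₂ r₃ : ℝ) :
    titsQuaternion K (T, H₁ + r₁ • hermOne K (Fin 3), H₂ + r₂ • hermOne K (Fin 3),
        H₃ + r₃ • hermOne K (Fin 3))
      = (T, H₁ ⊗ₜ[ℝ] i + H₂ ⊗ₜ[ℝ] j + H₃ ⊗ₜ[ℝ] k,
        r₁ • commBr SplitQuaternion i + r₂ • commBr SplitQuaternion j
          + r₃ • commBr SplitQuaternion k) := by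
  rw [titsQuaternion_apply]
  simp only [titsTensorₗ_add_smul_one h₁, titsTensorₗ_add_smul_one h₂,
    titsTensorₗ_add_smul_one h₃]
  refine Prod.ext (LinearMap.ext fun X => ?_) (Prod.ext ?_ ?_)
  · simp [titsEnd]
  · simp [titsEnd, add_assoc]
  · simp [titsEnd, add_assoc]

theorem titsQuaternion_mem {u : Module.End ℝ (H3 K) × H3 K × H3 K × H3 K} (hu : u.1 ∈ derH3 K) :
    titsQuaternion K u ∈ L3 K SplitQuaternion := by
  have hmem (x : SplitQuaternion) (hx : x.re = 0) (S : H3 K) :=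
    titsTensor_mem splitQuaternion_assoc (mem_imag_splitQuaternion.mpr hx) S
  exact Submodule.add_mem _ (titsEnd_mem hu) (Submodule.add_mem _ (hmem i rfl _)
    (Submodule.add_mem _ (hmem j rfl _) (hmem k rfl _)))

theorem exists_titsQuaternion_eq {u : TitsSpace K SplitQuaternion}
    (hu : u ∈ L3 K SplitQuaternion) : ∃ v, v.1 ∈ derH3 K ∧ titsQuaternion K v = u := by
  obtain ⟨h1, h2, h3⟩ := mem_L3.mp hu
  obtain ⟨H₁, hH₁, H₂, hH₂, H₃, hH₃, e⟩ := exists_eq_of_mem_range_mapIncl h2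
  obtain ⟨r₁, r₂, r₃, e'⟩ := der_splitQuaternion h3
  refine ⟨(u.1, H₁ + r₁ • hermOne K (Fin 3), H₂ + r₂ • hermOne K (Fin 3),
    H₃ + r₃ • hermOne K (Fin 3)), h1, ?_⟩
  rw [titsQuaternion_add_smul_one _ hH₁ hH₂ hH₃, ← e, ← e']

end SplitQuaternionTits

/-! ### L₃(K, split complex numbers) -/

section SplitComplexTits

variable {K : Type*} [NonAssocRing K] [Module ℝ K] [IsScalarTower ℝ K K] [SMulCommClass ℝ K K]
  [CompositionAlgebra K]

open SplitComplex

variable (K) in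
/-- The element `T + S ⊗ i` of Tits's space for the split complex numbers. -/
noncomputable def titsComplex : (Module.End ℝ (H3 K) × H3 K) →ₗ[ℝ] TitsSpace K SplitComplex :=
  (titsEnd K SplitComplex).coprod (titsTensorₗ K i)

theorem titsComplex_apply (u : Module.End ℝ (H3 K) × H3 K) :
    titsComplex K u = titsEnd K SplitComplex u.1 + titsTensorₗ K i u.2 := rfl

theorem splitComplex_assoc (x y z : SplitComplex) : x * y * z = x * (y * z) :=
  mul_assoc x y z

theorem titsBracket_titsComplex {u v : Module.End ℝ (H3 K) × H3 K}
    (hu : u.1 ∈ derH3 K) (hv : v.1 ∈ derH3 K) :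
    titsBracket K SplitComplex (titsComplex K u) (titsComplex K v)
      = titsComplex K ((tkkBracket (jordan K (Fin 3)) (u.1, u.2, 0, 0) (v.1, v.2, 0, 0)).1,
        (tkkBracket (jordan K (Fin 3)) (u.1, u.2, 0, 0) (v.1, v.2, 0, 0)).2.1) := by
  have hii := titsBracket_tensor_self (K := K) splitComplex_assoc (x := i) (c := 1)
    (by rw [form_splitComplex]; simp [i])
  obtain ⟨S, a⟩ := u
  obtain ⟨T, b⟩ := v
  dsimp only at hu hv
  have key : (tkkBracket (jordan K (Fin 3)) (S, a, 0, 0) (T, b, 0, 0)).1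
      = commBr (Module.End ℝ (H3 K)) S T + jordanComm K (Fin 3) a b := by
    refine LinearMap.ext fun X => ?_
    have : jordanComm K (Fin 3) a b
      = commBr (Module.End ℝ (H3 K)) (jordan K (Fin 3) a) (jordan K (Fin 3) b) := rfl
    simp [tkkBracket, this]
  rw [titsComplex_apply (_, _), key]
  simp only [titsComplex_apply, tkkBracket, map_add, map_sub, LinearMap.add_apply,
    titsBracket_end_end, titsBracket_end_tensor hu, titsBracket_tensor_end hv, hii, map_zero,
    sub_self, sub_zero, one_smul]
  abel

theorem exists_eq_of_mem_range_mapIncl_complex {t : H3 K ⊗[ℝ] SplitComplex}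
    (h : t ∈ LinearMap.range
      (TensorProduct.mapIncl (hermTraceless K (Fin 3)) (imag SplitComplex))) :
    ∃ H ∈ hermTraceless K (Fin 3), t = H ⊗ₜ[ℝ] i := by
  obtain ⟨s, rfl⟩ := h
  induction s using TensorProduct.induction_on with
  | zero => exact ⟨0, Submodule.zero_mem _, by simp⟩
  | tmul H x =>
    refine ⟨x.1.im • H.1, Submodule.smul_mem _ _ H.2, ?_⟩
    have e := splitComplex_eq x.1
    rw [mem_imag_splitComplex.mp x.2, zero_smul, zero_add] at e
    change H.1 ⊗ₜ[ℝ] x.1 = _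
    conv_lhs => rw [e]
    simp only [TensorProduct.tmul_smul, TensorProduct.smul_tmul']
  | add s s' hs hs' =>
    obtain ⟨A, hA, e⟩ := hs
    obtain ⟨B, hB, e'⟩ := hs'
    exact ⟨_, Submodule.add_mem _ hA hB, by rw [map_add, e, e', TensorProduct.add_tmul]⟩

theorem titsComplex_of_mem (T : Module.End ℝ (H3 K)) {H : H3 K}
    (h : H ∈ hermTraceless K (Fin 3)) : titsComplex K (T, H) = (T, H ⊗ₜ[ℝ] i, 0) := by
  have e := titsTensorₗ_add_smul_one h 0 SplitComplex.i
  rw [zero_smul, add_zero, zero_smul] at e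
  rw [titsComplex_apply, e]
  refine Prod.ext (LinearMap.ext fun X => ?_) (Prod.ext ?_ ?_)
  · simp [titsEnd]
  · simp [titsEnd]
  · simp [titsEnd]

theorem titsComplex_mem {u : Module.End ℝ (H3 K) × H3 K} (hu : u.1 ∈ derH3 K) :
    titsComplex K u ∈ L3 K SplitComplex :=
  Submodule.add_mem _ (titsEnd_mem hu)
    (titsTensor_mem splitComplex_assoc (mem_imag_splitComplex.mpr rfl) _)

theorem exists_titsComplex_eq {u : TitsSpace K SplitComplex}
    (hu : u ∈ L3 K SplitComplex) :
    ∃ v, v.1 ∈ derH3 K ∧ v.2 ∈ hermTraceless K (Fin 3) ∧ titsComplex K v = u := by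
  obtain ⟨h1, h2, h3⟩ := mem_L3.mp hu
  obtain ⟨H, hH, e⟩ := exists_eq_of_mem_range_mapIncl_complex h2
  refine ⟨(u.1, H), h1, hH, ?_⟩
  rw [titsComplex_of_mem _ hH, ← e, ← der_splitComplex h3]

/-- The split complex numbers are commutative, so C_i = 0 and I ⊗ i is lost; injectivity therefore
holds only for traceless H. -/
theorem eq_zero_of_titsComplex {T : Module.End ℝ (H3 K)} {H : H3 K}
    (hH : H ∈ hermTraceless K (Fin 3)) (h : titsComplex K (T, H) = 0) : T = 0 ∧ H = 0 := by
  rw [titsComplex_of_mem _ hH] at h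
  refine ⟨congrArg Prod.fst h, ?_⟩
  have e := congrArg (fun u => tensorCoeff (QuadraticAlgebra.imₗ 1 0) u.2.1) h
  simpa [tensorCoeff_tmul, i] using e

end SplitComplexTits

end CompositionAlgebra

namespace CompositionAlgebra

/-! ### Block matrices and sp(2n,K) -/

section Blocks

variable {K : Type*} [NonAssocRing K] [Module ℝ K] [IsScalarTower ℝ K K] [SMulCommClass ℝ K K]
  [CompositionAlgebra K] {n : Type*} [Fintype n] [DecidableEq n]

/-- The Kronecker product `P ⊗ σ` of a matrix with a real matrix of size `2`. -/
def kronTwo (σ : Matrix (Fin 2) (Fin 2) ℝ) (P : Matrix n n K) : Matrix (n ⊕ n) (n ⊕ n) K :=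
  Matrix.fromBlocks (σ 0 0 • P) (σ 0 1 • P) (σ 1 0 • P) (σ 1 1 • P)

theorem kronTwo_mul (σ τ : Matrix (Fin 2) (Fin 2) ℝ) (P Q : Matrix n n K) :
    kronTwo σ P * kronTwo τ Q = kronTwo (σ * τ) (P * Q) := by
  simp only [kronTwo, Matrix.fromBlocks_multiply, Matrix.mul_apply, Fin.sum_univ_two,
    smul_mul_assoc, mul_smul_comm, smul_smul, add_smul, mul_comm (τ _ _)]

theorem kronTwo_trace (σ : Matrix (Fin 2) (Fin 2) ℝ) (P : Matrix n n K) :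
    (kronTwo σ P).trace = σ.trace • P.trace := by
  simp [kronTwo, Matrix.trace, Fintype.sum_sum_type, add_smul, Finset.smul_sum,
    Finset.sum_add_distrib]

theorem kronTwo_add (σ : Matrix (Fin 2) (Fin 2) ℝ) (P Q : Matrix n n K) :
    kronTwo σ (P + Q) = kronTwo σ P + kronTwo σ Q := by
  simp [kronTwo, Matrix.fromBlocks_add]

theorem kronTwo_smul (σ : Matrix (Fin 2) (Fin 2) ℝ) (c : ℝ) (P : Matrix n n K) :
    kronTwo σ (c • P) = c • kronTwo σ P := by
  simp [kronTwo, Matrix.fromBlocks_smul, smul_comm c]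

theorem kronTwo_neg_left (σ : Matrix (Fin 2) (Fin 2) ℝ) (P : Matrix n n K) :
    kronTwo (-σ) P = -kronTwo σ P := by
  simp [kronTwo, Matrix.fromBlocks_neg]

theorem kronTwo_one_diagonal (d : n → K) :
    kronTwo 1 (Matrix.diagonal d) = Matrix.diagonal (Sum.elim d d) := by
  ext (i | i) (j | j) <;> simp [kronTwo, Matrix.diagonal_apply]

theorem kronTwo_map (σ : Matrix (Fin 2) (Fin 2) ℝ) (P : Matrix n n K) (D : Module.End ℝ K) :
    (kronTwo σ P).map D = kronTwo σ (P.map D) := by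
  ext (i | i) (j | j) <;> simp [kronTwo]

variable (K n) in
/-- The map `(P, D) ↦ (P ⊗ 1, D)`. -/
noncomputable def kronOne : MatEnd K n →ₗ[ℝ] MatEnd K (n ⊕ n) where
  toFun u := (kronTwo 1 u.1, u.2)
  map_add' u v := by simp [kronTwo_add]
  map_smul' c u := by simp [kronTwo_smul]

variable (K n) in
/-- The map `S ↦ (S ⊗ σ, 0)` on hermitian matrices. -/
noncomputable def kronHerm (σ : Matrix (Fin 2) (Fin 2) ℝ) : herm K n →ₗ[ℝ] MatEnd K (n ⊕ n) where
  toFun S := (kronTwo σ S.1, 0)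
  map_add' u v := by simp [kronTwo_add]
  map_smul' c u := by simp [kronTwo_smul]

theorem kronOne_apply (u : MatEnd K n) : kronOne K n u = (kronTwo 1 u.1, u.2) := rfl

theorem kronHerm_apply (σ : Matrix (Fin 2) (Fin 2) ℝ) (S : herm K n) :
    kronHerm K n σ S = (kronTwo σ S.1, 0) := rfl

theorem kronHerm_neg (σ : Matrix (Fin 2) (Fin 2) ℝ) (S : herm K n) :
    kronHerm K n (-σ) S = -kronHerm K n σ S := by
  simp [kronHerm_apply, kronTwo_neg_left]

theorem sum_innerDer_kronTwo (σ τ : Matrix (Fin 2) (Fin 2) ℝ) (P Q : Matrix n n K) :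
    ∑ i, ∑ j, innerDer K (kronTwo σ P i j) (kronTwo τ Q j i)
      = (σ * τ).trace • ∑ i, ∑ j, innerDer K (P i j) (Q j i) := by
  simp only [kronTwo, Fintype.sum_sum_type, Matrix.fromBlocks_apply₁₁, Matrix.fromBlocks_apply₁₂,
    Matrix.fromBlocks_apply₂₁, Matrix.fromBlocks_apply₂₂, Matrix.smul_apply, map_smul,
    LinearMap.smul_apply, Finset.sum_add_distrib, ← Finset.smul_sum, Matrix.trace_fin_two,
    Matrix.mul_apply, Fin.sum_univ_two]
  module

theorem card_sum_inv : ((Fintype.card (n ⊕ n) : ℕ) : ℝ)⁻¹ = (1 / 2) * (Fintype.card n : ℝ)⁻¹ := by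
  rw [Fintype.card_sum, Nat.cast_add, ← two_mul, mul_inv]; norm_num

theorem diagonal_const_smul (c : ℝ) (t : K) :
    Matrix.diagonal (fun _ : n => c • t) = c • Matrix.diagonal (fun _ => t) := by
  ext i j
  by_cases h : i = j
  · subst h; simp
  · simp [h]

theorem diagonal_const_sum (t : K) : (Matrix.diagonal fun _ : n ⊕ n => t)
    = kronTwo 1 (Matrix.diagonal fun _ : n => t) := by
  rw [kronTwo_one_diagonal]
  congr 1
  ext (i | i) <;> rfl

/-- Doubling the size doubles both the trace and the sum of inner derivations; the factor 1/(2n) in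
place of 1/n compensates. -/
theorem matBracket_kronOne (u v : MatEnd K n) :
    matBracket K (n ⊕ n) (kronOne K n u) (kronOne K n v) = kronOne K n (matBracket K n u v) := by
  have hneg (P : Matrix n n K) : kronTwo 1 (-P) = -kronTwo 1 P := by
    rw [← neg_one_smul ℝ P, kronTwo_smul, neg_one_smul]
  have e : kronTwo 1 u.1 * kronTwo 1 v.1 - kronTwo 1 v.1 * kronTwo 1 u.1
      = kronTwo 1 (u.1 * v.1 - v.1 * u.1) := by
    rw [kronTwo_mul, kronTwo_mul, mul_one, sub_eq_add_neg, sub_eq_add_neg, kronTwo_add, hneg]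
  refine Prod.ext ?_ ?_
  · rw [matBracket_fst]
    simp only [kronOne_apply]
    rw [e, kronTwo_trace, diagonal_const_smul, kronTwo_map, kronTwo_map, card_sum_inv,
      matBracket_fst, diagonal_const_sum, Matrix.trace_fin_two]
    simp only [sub_eq_add_neg, kronTwo_add, hneg, kronTwo_smul, Matrix.one_apply_eq]
    module
  · rw [matBracket_snd]
    simp only [kronOne_apply]
    rw [sum_innerDer_kronTwo, card_sum_inv, matBracket_snd, mul_one, Matrix.trace_fin_two]
    simp only [Matrix.one_apply_eq]
    module

theorem matBracket_kronOne_kronHerm {u : MatEnd K n} (hu : u ∈ sa K n) (S : herm K n)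
    {σ : Matrix (Fin 2) (Fin 2) ℝ} (hσ : σ.trace = 0) :
    matBracket K (n ⊕ n) (kronOne K n u) (kronHerm K n σ S) = kronHerm K n σ (act K n u S) := by
  obtain ⟨⟨hA, hAt⟩, hD⟩ := mem_sa.mp hu
  have hneg (P : Matrix n n K) : kronTwo σ (-P) = -kronTwo σ P := by
    rw [← neg_one_smul ℝ P, kronTwo_smul, neg_one_smul]
  have e0 (Y : Matrix (n ⊕ n) (n ⊕ n) K) : Y.map (0 : Module.End ℝ K) = 0 := by ext; simp
  refine Prod.ext ?_ ?_
  · rw [matBracket_fst]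
    simp only [kronOne_apply, kronHerm_apply]
    rw [kronTwo_mul, kronTwo_mul, one_mul, mul_one, Matrix.trace_sub, kronTwo_trace, kronTwo_trace,
      hσ, zero_smul, zero_smul, sub_zero, e0, kronTwo_map, act_coe hA hD]
    simp [sub_eq_add_neg, kronTwo_add, hneg]
  · rw [matBracket_snd]
    simp only [kronOne_apply, kronHerm_apply]
    rw [sum_innerDer_kronTwo, one_mul, hσ]
    simp

theorem matBracket_kronHerm_kronOne {u : MatEnd K n} (hu : u ∈ sa K n) (S : herm K n)
    {σ : Matrix (Fin 2) (Fin 2) ℝ} (hσ : σ.trace = 0) :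
    matBracket K (n ⊕ n) (kronHerm K n σ S) (kronOne K n u) = -kronHerm K n σ (act K n u S) := by
  rw [matBracket_swap, matBracket_kronOne_kronHerm hu S hσ]

theorem matBracket_kronHerm_self (S S' : herm K n) {σ : Matrix (Fin 2) (Fin 2) ℝ} {c : ℝ}
    (hσ : σ * σ = c • 1) :
    matBracket K (n ⊕ n) (kronHerm K n σ S) (kronHerm K n σ S')
      = c • kronOne K n (matBracket K n (S.1, 0) (S'.1, 0)) := by
  have hneg (P : Matrix n n K) : kronTwo 1 (-P) = -kronTwo 1 P := by
    rw [← neg_one_smul ℝ P, kronTwo_smul, neg_one_smul]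
  have e0 (Y : Matrix (n ⊕ n) (n ⊕ n) K) : Y.map (0 : Module.End ℝ K) = 0 := by ext; simp
  have e1 (Y : Matrix n n K) : Y.map (0 : Module.End ℝ K) = 0 := by ext; simp
  have e2 (P : Matrix n n K) : kronTwo (c • 1) P = c • kronTwo 1 P := by
    simp [kronTwo, Matrix.fromBlocks_smul]
  have e : kronTwo σ S.1 * kronTwo σ S'.1 - kronTwo σ S'.1 * kronTwo σ S.1
      = c • kronTwo 1 (S.1 * S'.1 - S'.1 * S.1) := by
    rw [kronTwo_mul, kronTwo_mul, hσ, e2, e2, ← smul_sub, sub_eq_add_neg, sub_eq_add_neg,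
      kronTwo_add, hneg]
  refine Prod.ext ?_ ?_
  · rw [matBracket_fst]
    simp only [kronHerm_apply]
    rw [e, Matrix.trace_smul, kronTwo_trace, diagonal_const_smul, diagonal_const_smul, e0, e0,
      card_sum_inv, Prod.smul_fst, kronOne_apply, matBracket_fst, diagonal_const_sum,
      Matrix.trace_fin_two]
    simp only [e1, sub_eq_add_neg, kronTwo_add, hneg, kronTwo_smul, Matrix.one_apply_eq, neg_zero,
      add_zero]
    module
  · rw [matBracket_snd]
    simp only [kronHerm_apply]
    rw [sum_innerDer_kronTwo, card_sum_inv, Prod.smul_snd, kronOne_apply, matBracket_snd, hσ,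
      Matrix.trace_smul, Matrix.trace_fin_two]
    simp only [Matrix.one_apply_eq, map_zero, smul_eq_mul]
    module

/-- Anticommuting σ and τ turn the commutator of matrices into the Jordan product, and tr ρ = 0
removes both corrections. -/
theorem matBracket_kronHerm_anticomm (S S' : herm K n) {σ τ ρ : Matrix (Fin 2) (Fin 2) ℝ}
    (hστ : σ * τ = ρ) (hτσ : τ * σ = -ρ) (hρ : ρ.trace = 0) :
    matBracket K (n ⊕ n) (kronHerm K n σ S) (kronHerm K n τ S')
      = kronHerm K n ρ (jordan K n S S') := by
  have e0 (Y : Matrix (n ⊕ n) (n ⊕ n) K) : Y.map (0 : Module.End ℝ K) = 0 := by ext; simp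
  refine Prod.ext ?_ ?_
  · rw [matBracket_fst]
    simp only [kronHerm_apply]
    rw [kronTwo_mul, kronTwo_mul, hστ, hτσ, kronTwo_neg_left, Matrix.trace_sub, Matrix.trace_neg,
      kronTwo_trace, kronTwo_trace, hρ, e0, e0, jordan_coe, kronTwo_add]
    simp
  · rw [matBracket_snd]
    simp only [kronHerm_apply]
    rw [sum_innerDer_kronTwo, hστ, hρ]
    simp

/-- The real matrix that represents the split quaternion unit `i`. -/
def pauliI : Matrix (Fin 2) (Fin 2) ℝ := !![1, 0; 0, -1]
/-- The real matrix that represents the split quaternion unit `j`. -/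
def pauliJ : Matrix (Fin 2) (Fin 2) ℝ := !![0, 1; 1, 0]
/-- The real matrix that represents the split quaternion unit `k`. -/
def pauliK : Matrix (Fin 2) (Fin 2) ℝ := !![0, 1; -1, 0]

variable (K n) in
/-- The element `u ⊗ 1 + S₁ ⊗ i + S₂ ⊗ j + S₃ ⊗ k` of `sp(2 N, K)`. -/
noncomputable def matQuaternion : (MatEnd K n × herm K n × herm K n × herm K n) →ₗ[ℝ]
    MatEnd K (n ⊕ n) :=
  (kronOne K n).coprod ((kronHerm K n pauliI).coprod
    ((kronHerm K n pauliJ).coprod (kronHerm K n pauliK)))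

theorem matQuaternion_apply (u : MatEnd K n × herm K n × herm K n × herm K n) :
    matQuaternion K n u = kronOne K n u.1 + (kronHerm K n pauliI u.2.1
      + (kronHerm K n pauliJ u.2.2.1 + kronHerm K n pauliK u.2.2.2)) := rfl

theorem matQuaternion_eq (u : MatEnd K n × herm K n × herm K n × herm K n) :
    matQuaternion K n u = (Matrix.fromBlocks (u.1.1 + u.2.1.1) (u.2.2.1.1 + u.2.2.2.1)
      (u.2.2.1.1 - u.2.2.2.1) (u.1.1 - u.2.1.1), u.1.2) := by
  rw [matQuaternion_apply]
  refine Prod.ext ?_ ?_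
  · simp [kronOne_apply, kronHerm_apply, kronTwo, pauliI, pauliJ, pauliK, Matrix.fromBlocks_add,
      sub_eq_add_neg]
  · simp [kronOne_apply, kronHerm_apply]

/-- The three real 2×2 matrices multiply like the split quaternion units, so the structure constants
are those of `tkkBracket`. Only the first component differs: it stays in matrix form, and `act` will
compare it with the derivation. -/
theorem matBracket_matQuaternion {u v : MatEnd K n × herm K n × herm K n × herm K n}
    (hu : u.1 ∈ sa K n) (hv : v.1 ∈ sa K n) :
    matBracket K (n ⊕ n) (matQuaternion K n u) (matQuaternion K n v) = matQuaternion K n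
      (matBracket K n u.1 v.1 + matBracket K n (u.2.1.1, 0) (v.2.1.1, 0)
          + matBracket K n (u.2.2.1.1, 0) (v.2.2.1.1, 0)
          - matBracket K n (u.2.2.2.1, 0) (v.2.2.2.1, 0),
        (tkkBracket (jordan K n) (act K n u.1, u.2) (act K n v.1, v.2)).2) := by
  have ti : pauliI.trace = 0 := by simp [pauliI, Matrix.trace_fin_two]
  have tj : pauliJ.trace = 0 := by simp [pauliJ, Matrix.trace_fin_two]
  have tk : pauliK.trace = 0 := by simp [pauliK, Matrix.trace_fin_two]
  have ii := matBracket_kronHerm_self (K := K) (n := n) (σ := pauliI) (c := 1)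
    (hσ := by simp [pauliI, Matrix.one_fin_two])
  have jj := matBracket_kronHerm_self (K := K) (n := n) (σ := pauliJ) (c := 1)
    (hσ := by simp [pauliJ, Matrix.one_fin_two])
  have kk := matBracket_kronHerm_self (K := K) (n := n) (σ := pauliK) (c := -1)
    (hσ := by simp [pauliK, Matrix.one_fin_two])
  have eij : pauliI * pauliJ = pauliK := by simp [pauliI, pauliJ, pauliK]
  have eji : pauliJ * pauliI = -pauliK := by simp [pauliI, pauliJ, pauliK]
  have ejk : pauliJ * pauliK = -pauliI := by simp [pauliI, pauliJ, pauliK]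
  have ekj : pauliK * pauliJ = pauliI := by simp [pauliI, pauliJ, pauliK]
  have eki : pauliK * pauliI = -pauliJ := by simp [pauliI, pauliJ, pauliK]
  have eik : pauliI * pauliK = pauliJ := by simp [pauliI, pauliJ, pauliK]
  have hij (S S' : herm K n) := matBracket_kronHerm_anticomm S S' eij eji tk
  have hji (S S' : herm K n) := matBracket_kronHerm_anticomm S S' eji (by rw [eij, neg_neg])
    (by rw [Matrix.trace_neg, tk, neg_zero])
  have hkj (S S' : herm K n) := matBracket_kronHerm_anticomm S S' ekj ejk ti
  have hjk (S S' : herm K n) := matBracket_kronHerm_anticomm S S' ejk (by rw [ekj, neg_neg])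
    (by rw [Matrix.trace_neg, ti, neg_zero])
  have hik (S S' : herm K n) := matBracket_kronHerm_anticomm S S' eik eki tj
  have hki (S S' : herm K n) := matBracket_kronHerm_anticomm S S' eki (by rw [eik, neg_neg])
    (by rw [Matrix.trace_neg, tj, neg_zero])
  obtain ⟨p, a₁, a₂, a₃⟩ := u
  obtain ⟨q, b₁, b₂, b₃⟩ := v
  dsimp only at hu hv
  simp only [matQuaternion_apply, tkkBracket, map_add, map_sub, LinearMap.add_apply,
    matBracket_kronOne, matBracket_kronOne_kronHerm hu _ ti, matBracket_kronOne_kronHerm hu _ tj,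
    matBracket_kronOne_kronHerm hu _ tk, matBracket_kronHerm_kronOne hv _ ti,
    matBracket_kronHerm_kronOne hv _ tj, matBracket_kronHerm_kronOne hv _ tk, ii, jj, kk, hij, hji,
    hjk, hkj, hki, hik, kronHerm_neg]
  module

theorem matQuaternion_injective : Function.Injective (matQuaternion K n) := by
  refine (injective_iff_map_eq_zero _).mpr ?_
  rintro ⟨⟨A, D⟩, S₁, S₂, S₃⟩ h
  rw [matQuaternion_eq] at h
  have h1 := congrArg Prod.fst h
  have h2 : D = 0 := congrArg Prod.snd h
  dsimp only [Prod.fst_zero] at h1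
  rw [← Matrix.fromBlocks_zero, Matrix.fromBlocks_inj] at h1
  obtain ⟨e1, e2, e3, e4⟩ := h1
  have half (M : Matrix n n K) (h : M + M = 0) : M = 0 := by
    rw [← two_smul ℝ] at h
    exact (smul_eq_zero.mp h).resolve_left two_ne_zero
  have hA : A = 0 := half A (by linear_combination (norm := module) e1 + e4)
  have hS₁ : S₁.1 = 0 := by rwa [hA, zero_add] at e1
  have hS₂ : S₂.1 = 0 := half _ (by linear_combination (norm := module) e2 + e3)
  have hS₃ : S₃.1 = 0 := by rwa [hS₂, zero_add] at e2
  rw [hA, h2, Subtype.ext (a1 := S₁) (a2 := 0) hS₁, Subtype.ext (a1 := S₂) (a2 := 0) hS₂,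
    Subtype.ext (a1 := S₃) (a2 := 0) hS₃]
  rfl

theorem dagger_fromBlocks (P Q R S : Matrix n n K) :
    dagger K (n ⊕ n) (Matrix.fromBlocks P Q R S)
      = Matrix.fromBlocks (dagger K n P) (dagger K n R) (dagger K n Q) (dagger K n S) := by
  ext (i | i) (j | j) <;> simp [dagger_apply]

theorem symplectic_condition (P Q R S : Matrix n n K) :
    dagger K (n ⊕ n) (Matrix.fromBlocks P Q R S) * symplJ K n
        + symplJ K n * Matrix.fromBlocks P Q R S = 0
      ↔ dagger K n R = R ∧ dagger K n P = -S ∧ dagger K n S = -P ∧ dagger K n Q = Q := by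
  rw [dagger_fromBlocks, symplJ, Matrix.fromBlocks_multiply, Matrix.fromBlocks_multiply,
    Matrix.fromBlocks_add, ← Matrix.fromBlocks_zero, Matrix.fromBlocks_inj]
  simp only [mul_zero, mul_neg, mul_one, zero_mul, one_mul, neg_mul, zero_add, add_zero]
  refine and_congr ?_ (and_congr ?_ (and_congr ?_ ?_))
  · rw [neg_add_eq_zero]
  · rw [eq_neg_iff_add_eq_zero]
  · rw [← neg_add, neg_eq_zero, eq_neg_iff_add_eq_zero]
  · rw [← sub_eq_add_neg, sub_eq_zero]

theorem trace_fromBlocks_sum (P Q R S : Matrix n n K) :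
    (Matrix.fromBlocks P Q R S).trace = P.trace + S.trace := by
  simp [Matrix.trace, Fintype.sum_sum_type]

theorem mem_sp {u : MatEnd K (n ⊕ n)} : u ∈ sp K n ↔
    (dagger K (n ⊕ n) u.1 * symplJ K n + symplJ K n * u.1 = 0 ∧ u.1.trace = 0) ∧ u.2 ∈ der K :=
  Iff.rfl

theorem matQuaternion_mem {u : MatEnd K n × herm K n × herm K n × herm K n} (hu : u.1 ∈ sa K n) :
    matQuaternion K n u ∈ sp K n := by
  obtain ⟨⟨hA, hAt⟩, hD⟩ := mem_sa.mp hu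
  rw [matQuaternion_eq, mem_sp]
  have h1 : dagger K n u.2.1.1 = u.2.1.1 := u.2.1.2
  have h2 : dagger K n u.2.2.1.1 = u.2.2.1.1 := u.2.2.1.2
  have h3 : dagger K n u.2.2.2.1 = u.2.2.2.1 := u.2.2.2.2
  refine ⟨⟨(symplectic_condition _ _ _ _).mpr ⟨?_, ?_, ?_, ?_⟩, ?_⟩, hD⟩
  · rw [map_sub, h2, h3]
  · rw [map_add, hA, h1]; abel
  · rw [map_sub, hA, h1]; abel
  · rw [map_add, h2, h3]
  · rw [trace_fromBlocks_sum, Matrix.trace_add, Matrix.trace_sub, hAt]; abel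

theorem exists_matQuaternion_eq {u : MatEnd K (n ⊕ n)} (hu : u ∈ sp K n) :
    ∃ v, v.1 ∈ sa K n ∧ matQuaternion K n v = u := by
  obtain ⟨⟨h, ht⟩, hD⟩ := mem_sp.mp hu
  obtain ⟨X, D⟩ := u
  dsimp only at h ht hD
  obtain ⟨P, Q, R, S, rfl⟩ : ∃ P Q R S, X = Matrix.fromBlocks P Q R S :=
    ⟨_, _, _, _, (Matrix.fromBlocks_toBlocks X).symm⟩
  rw [trace_fromBlocks_sum] at ht
  obtain ⟨hR, hP, hS, hQ⟩ := (symplectic_condition _ _ _ _).mp h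
  have m1 : (1 / 2 : ℝ) • (P - S) ∈ herm K n := by
    rw [mem_herm, map_smul, map_sub, hP, hS]; congr 1; abel
  have m2 : (1 / 2 : ℝ) • (Q + R) ∈ herm K n := by
    rw [mem_herm, map_smul, map_add, hR, hQ]
  have m3 : (1 / 2 : ℝ) • (Q - R) ∈ herm K n := by
    rw [mem_herm, map_smul, map_sub, hR, hQ]
  -- Half sums and half differences of blocks. The condition tr P + tr S = 0 makes A traceless and
  -- leaves the traces of the three hermitian matrices free.
  refine ⟨(((1 / 2 : ℝ) • (P + S), D), ⟨_, m1⟩, ⟨_, m2⟩, ⟨_, m3⟩), ⟨⟨?_, ?_⟩, hD⟩, ?_⟩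
  · dsimp only
    rw [map_smul, map_add, hP, hS, ← smul_neg]; congr 1; abel
  · dsimp only
    rw [Matrix.trace_smul, Matrix.trace_add, ht, smul_zero]
  · rw [matQuaternion_eq]
    refine Prod.ext (Matrix.fromBlocks_inj.mpr ⟨?_, ?_, ?_, ?_⟩) rfl <;> dsimp only <;> module

end Blocks

end CompositionAlgebra

namespace CompositionAlgebra

/-! ### The three isomorphisms -/

section Isomorphisms

variable {K : Type*} [NonAssocRing K] [Module ℝ K] [IsScalarTower ℝ K K] [SMulCommClass ℝ K K]
  [CompositionAlgebra K]

theorem actsAs_act {A : Matrix (Fin 3) (Fin 3) K} {D : Module.End ℝ K}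
    (hA : A ∈ antihermTraceless K (Fin 3)) (hD : D ∈ der K) :
    ActsAs (act K (Fin 3) (A, D)) A D :=
  act_coe (u := (A, D)) hA.1 hD

theorem mapIncl_imag_real (s : hermTraceless K (Fin 3) ⊗[ℝ] imag ℝ) :
    TensorProduct.mapIncl (hermTraceless K (Fin 3)) (imag ℝ) s = 0 := by
  induction s using TensorProduct.induction_on with
  | zero => exact map_zero _
  | tmul H x =>
    change H.1 ⊗ₜ[ℝ] x.1 = 0
    rw [imag_real x.2, TensorProduct.tmul_zero]
  | add s s' hs hs' => rw [map_add, hs, hs', add_zero]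

theorem eq_titsEnd_of_mem {u : TitsSpace K ℝ} (hu : u ∈ L3 K ℝ) : u = titsEnd K ℝ u.1 := by
  obtain ⟨_, ⟨s, hs⟩, h3⟩ := mem_L3.mp hu
  rw [mapIncl_imag_real] at hs
  exact Prod.ext rfl (Prod.ext hs.symm (der_real h3))

theorem titsEnd_injective {L : Type*} [NonAssocRing L] [Module ℝ L] [IsScalarTower ℝ L L]
    [SMulCommClass ℝ L L] [CompositionAlgebra L] : Function.Injective (titsEnd K L) :=
  fun _ _ h => congrArg Prod.fst h

variable (K) in
theorem exists_lieEquiv_sa :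
    ∃ (hL : IsLie (titsBracket K ℝ) (L3 K ℝ)) (hS : IsLie (matBracket K (Fin 3)) (sa K (Fin 3)))
      (ψ : hL.Carrier ≃ₗ⁅ℝ⁆ hS.Carrier), ∀ p : sa K (Fin 3), ∃ u : hL.Carrier,
        hL.val u = titsEnd K ℝ (act K (Fin 3) p.1) ∧ hS.val (ψ u) = p.1 := by
  refine IsLie.exists_lieEquiv_of_param (b := matBracket K (Fin 3))
    (W := TitsSpace K ℝ) (b' := titsBracket K ℝ) (sa K (Fin 3)).subtype
    (titsEnd K ℝ ∘ₗ act K (Fin 3) ∘ₗ (sa K (Fin 3)).subtype) Subtype.val_injective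
    (fun p q h => ?_) (Submodule.range_subtype _) ?_ ?_ ?_ ?_
  · have h : titsEnd K ℝ (act K (Fin 3) p.1) = titsEnd K ℝ (act K (Fin 3) q.1) := h
    exact Subtype.ext (act_injOn p.2 q.2 (titsEnd_injective h))
  · refine le_antisymm ?_ fun u hu => ?_
    · rintro _ ⟨p, rfl⟩
      exact titsEnd_mem (act_mem_derH3 p.2)
    · obtain ⟨w, hw, e⟩ := exists_act_eq (mem_L3.mp hu).1
      refine ⟨⟨w, hw⟩, ?_⟩
      rw [eq_titsEnd_of_mem hu, ← e]
      rfl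
  · intro p q
    exact ⟨⟨_, matBracket_mem_sa p.2 q.2⟩, rfl, (titsBracket_end_end _ _).trans
      (congrArg _ (act_matBracket p.2 q.2).symm)⟩
  · intro p
    simp only [LinearMap.comp_apply]
    rw [titsBracket_end_end, commBr_apply]
    exact (congrArg _ (sub_self _)).trans (map_zero _)
  · intro p q r
    simp only [LinearMap.comp_apply]
    rw [titsBracket_end_end, titsBracket_end_end, titsBracket_end_end, titsBracket_end_end,
      titsBracket_end_end, titsBracket_end_end, ← map_add]
    simp only [commBr_apply, mul_sub, sub_mul, mul_assoc]
    congr 1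
    abel

theorem tkkBracket_fst_mem {u v : Module.End ℝ (H3 K) × H3 K × H3 K × H3 K} (hu : u.1 ∈ derH3 K)
    (hv : v.1 ∈ derH3 K) : (tkkBracket (jordan K (Fin 3)) u v).1 ∈ derH3 K :=
  sub_mem_derivations (Submodule.add_mem _ (Submodule.add_mem _ (commBr_mem_derivations hu hv)
    (jordanComm_mem_derH3 _ _)) (jordanComm_mem_derH3 _ _)) (jordanComm_mem_derH3 _ _)

/-- `(u, S₁, S₂, S₃) ↦ (T, S₁, S₂, S₃)`, with the derivation `T` of `H₃(K)` that is given by `u`. -/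
noncomputable def actProd (K : Type*) [NonAssocRing K] [Module ℝ K] [IsScalarTower ℝ K K]
    [SMulCommClass ℝ K K] [CompositionAlgebra K] (V : Type*) [AddCommGroup V] [Module ℝ V] :
    (sa K (Fin 3) × V) →ₗ[ℝ] Module.End ℝ (H3 K) × V :=
  (act K (Fin 3) ∘ₗ (sa K (Fin 3)).subtype).prodMap LinearMap.id

theorem actProd_mem {V : Type*} [AddCommGroup V] [Module ℝ V] (p : sa K (Fin 3) × V) :
    (actProd K V p).1 ∈ derH3 K := act_mem_derH3 p.1.2

theorem actProd_injective {V : Type*} [AddCommGroup V] [Module ℝ V] :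
    Function.Injective (actProd K V) := fun p q h => by
  have h1 : act K (Fin 3) p.1.1 = act K (Fin 3) q.1.1 := congrArg Prod.fst h
  have h2 : p.2 = q.2 := (Prod.ext_iff.mp h).2
  exact Prod.ext (Subtype.ext (act_injOn p.1.2 q.1.2 h1)) h2

theorem exists_actProd_eq {V : Type*} [AddCommGroup V] [Module ℝ V]
    {u : Module.End ℝ (H3 K) × V} (hu : u.1 ∈ derH3 K) : ∃ p, actProd K V p = u := by
  obtain ⟨w, hw, e⟩ := exists_act_eq hu
  exact ⟨(⟨w, hw⟩, u.2), Prod.ext e rfl⟩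

/-- The component in `sa(3, K)` of the bracket of two elements of `sp(6, K)`. -/
theorem matBracket_sp_fst_mem (p q : sa K (Fin 3) × H3 K × H3 K × H3 K) :
    matBracket K (Fin 3) p.1.1 q.1.1 + matBracket K (Fin 3) (p.2.1.1, 0) (q.2.1.1, 0)
      + matBracket K (Fin 3) (p.2.2.1.1, 0) (q.2.2.1.1, 0)
      - matBracket K (Fin 3) (p.2.2.2.1, 0) (q.2.2.2.1, 0) ∈ sa K (Fin 3) :=
  Submodule.sub_mem _ (Submodule.add_mem _ (Submodule.add_mem _ (matBracket_mem_sa p.1.2 q.1.2)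
    (matBracket_herm_mem_sa _ _)) (matBracket_herm_mem_sa _ _)) (matBracket_herm_mem_sa _ _)

theorem act_matBracket_sp_fst (p q : sa K (Fin 3) × H3 K × H3 K × H3 K) :
    act K (Fin 3) (matBracket K (Fin 3) p.1.1 q.1.1
      + matBracket K (Fin 3) (p.2.1.1, 0) (q.2.1.1, 0)
      + matBracket K (Fin 3) (p.2.2.1.1, 0) (q.2.2.1.1, 0)
      - matBracket K (Fin 3) (p.2.2.2.1, 0) (q.2.2.2.1, 0))
    = (tkkBracket (jordan K (Fin 3)) (act K (Fin 3) p.1.1, p.2) (act K (Fin 3) q.1.1, q.2)).1 := by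
  rw [map_sub, map_add, map_add, act_matBracket p.1.2 q.1.2, act_matBracket_herm,
    act_matBracket_herm, act_matBracket_herm]
  rfl

theorem titsQuaternion_jacobi {u v w : Module.End ℝ (H3 K) × H3 K × H3 K × H3 K}
    (hu : u.1 ∈ derH3 K) (hv : v.1 ∈ derH3 K) (hw : w.1 ∈ derH3 K) :
    titsBracket K SplitQuaternion (titsQuaternion K u)
        (titsBracket K SplitQuaternion (titsQuaternion K v) (titsQuaternion K w))
      = titsBracket K SplitQuaternion
          (titsBracket K SplitQuaternion (titsQuaternion K u) (titsQuaternion K v))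
          (titsQuaternion K w)
        + titsBracket K SplitQuaternion (titsQuaternion K v)
          (titsBracket K SplitQuaternion (titsQuaternion K u) (titsQuaternion K w)) := by
  rw [titsBracket_titsQuaternion hv hw, titsBracket_titsQuaternion hu hv,
    titsBracket_titsQuaternion hu hw, titsBracket_titsQuaternion hu (tkkBracket_fst_mem hv hw),
    titsBracket_titsQuaternion (tkkBracket_fst_mem hu hv) hw,
    titsBracket_titsQuaternion hv (tkkBracket_fst_mem hu hw)]
  exact (congrArg _ (tkkBracket_jacobi (m := jordan K (Fin 3)) jordan_comm
    jordan_identity_linearized_H3 hu hv hw)).trans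
    (map_add (titsQuaternion K) _ _)

theorem titsBracket_titsQuaternion_self {u : Module.End ℝ (H3 K) × H3 K × H3 K × H3 K}
    (hu : u.1 ∈ derH3 K) :
    titsBracket K SplitQuaternion (titsQuaternion K u) (titsQuaternion K u) = 0 := by
  rw [titsBracket_titsQuaternion hu hu]
  exact (congrArg _ (tkkBracket_self (m := jordan K (Fin 3)) u jordan_comm)).trans
    (map_zero (titsQuaternion K))

variable (K) in
/-- The map `(u, S₁, S₂, S₃) ↦ T + S₁ ⊗ i + S₂ ⊗ j + S₃ ⊗ k`, with the derivation `T` of `H₃(K)`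
that is given by `u`. -/
noncomputable def titsQuaternionAct : (sa K (Fin 3) × H3 K × H3 K × H3 K) →ₗ[ℝ]
    TitsSpace K SplitQuaternion := titsQuaternion K ∘ₗ actProd K _

theorem titsQuaternionAct_apply (p : sa K (Fin 3) × H3 K × H3 K × H3 K) :
    titsQuaternionAct K p = titsQuaternion K (act K (Fin 3) p.1.1, p.2) := rfl

variable (K) in
/-- The restriction of `matQuaternion` to `sa(3, K) × H₃(K)³`. -/
noncomputable def matQuaternionSa : (sa K (Fin 3) × H3 K × H3 K × H3 K) →ₗ[ℝ]
    MatEnd K (Fin 3 ⊕ Fin 3) :=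
  matQuaternion K (Fin 3) ∘ₗ (sa K (Fin 3)).subtype.prodMap LinearMap.id

theorem matQuaternionSa_apply (p : sa K (Fin 3) × H3 K × H3 K × H3 K) :
    matQuaternionSa K p = matQuaternion K (Fin 3) (p.1.1, p.2) := rfl

theorem titsQuaternionAct_injective : Function.Injective (titsQuaternionAct K) :=
  titsQuaternion_injective.comp actProd_injective

theorem matQuaternionSa_injective : Function.Injective (matQuaternionSa K) := fun p q h => by
  rw [matQuaternionSa_apply, matQuaternionSa_apply] at h
  have h := matQuaternion_injective h
  exact Prod.ext (Subtype.ext (Prod.ext_iff.mp h).1) (Prod.ext_iff.mp h).2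

/-- The two brackets are given by one and the same parameter: `act` sends the sa(3,K) component of
the matrix bracket to the derivation component of `tkkBracket`. -/
theorem exists_bracket_quaternion (p q : sa K (Fin 3) × H3 K × H3 K × H3 K) :
    ∃ r, matBracket K (Fin 3 ⊕ Fin 3) (matQuaternionSa K p) (matQuaternionSa K q)
        = matQuaternionSa K r ∧
      titsBracket K SplitQuaternion (titsQuaternionAct K p) (titsQuaternionAct K q)
        = titsQuaternionAct K r := by
  refine ⟨(⟨_, matBracket_sp_fst_mem p q⟩, (tkkBracket (jordan K (Fin 3))
    (act K (Fin 3) p.1.1, p.2) (act K (Fin 3) q.1.1, q.2)).2), ?_, ?_⟩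
  · rw [matQuaternionSa_apply, matQuaternionSa_apply, matQuaternionSa_apply]
    exact matBracket_matQuaternion (u := (p.1.1, p.2)) (v := (q.1.1, q.2)) p.1.2 q.1.2
  · rw [titsQuaternionAct_apply, titsQuaternionAct_apply, titsQuaternionAct_apply,
      titsBracket_titsQuaternion (act_mem_derH3 p.1.2) (act_mem_derH3 q.1.2),
      act_matBracket_sp_fst p q]

theorem range_matQuaternionSa : LinearMap.range (matQuaternionSa K) = sp K (Fin 3) := by
  refine le_antisymm ?_ fun u hu => ?_
  · rintro _ ⟨p, rfl⟩
    exact matQuaternion_mem p.1.2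
  · obtain ⟨v, hv, e⟩ := exists_matQuaternion_eq hu
    exact ⟨(⟨v.1, hv⟩, v.2), e⟩

theorem range_titsQuaternionAct :
    LinearMap.range (titsQuaternionAct K) = L3 K SplitQuaternion := by
  refine le_antisymm ?_ fun u hu => ?_
  · rintro _ ⟨p, rfl⟩
    exact titsQuaternion_mem (actProd_mem p)
  · obtain ⟨v, hv, e⟩ := exists_titsQuaternion_eq hu
    obtain ⟨p, rfl⟩ := exists_actProd_eq hv
    exact ⟨p, e⟩

theorem titsQuaternionAct_bracket_self (p : sa K (Fin 3) × H3 K × H3 K × H3 K) :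
    titsBracket K SplitQuaternion (titsQuaternionAct K p) (titsQuaternionAct K p) = 0 := by
  rw [titsQuaternionAct_apply]
  exact titsBracket_titsQuaternion_self (u := (_, _)) (act_mem_derH3 p.1.2)

theorem titsQuaternionAct_jacobi (p q r : sa K (Fin 3) × H3 K × H3 K × H3 K) :
    titsBracket K SplitQuaternion (titsQuaternionAct K p)
        (titsBracket K SplitQuaternion (titsQuaternionAct K q) (titsQuaternionAct K r))
      = titsBracket K SplitQuaternion 
          (titsBracket K SplitQuaternion (titsQuaternionAct K p) (titsQuaternionAct K q)) (titsQuaternionAct K r)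
        + titsBracket K SplitQuaternion (titsQuaternionAct K q)
          (titsBracket K SplitQuaternion (titsQuaternionAct K p) (titsQuaternionAct K r)) := by
  rw [titsQuaternionAct_apply, titsQuaternionAct_apply, titsQuaternionAct_apply]
  exact titsQuaternion_jacobi (u := (_, _)) (v := (_, _)) (w := (_, _)) (act_mem_derH3 p.1.2)
    (act_mem_derH3 q.1.2) (act_mem_derH3 r.1.2)

variable (K) in
theorem exists_lieEquiv_sp :
    ∃ (hL : IsLie (titsBracket K SplitQuaternion) (L3 K SplitQuaternion))
      (hS : IsLie (matBracket K (Fin 3 ⊕ Fin 3)) (sp K (Fin 3)))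
      (χ : hL.Carrier ≃ₗ⁅ℝ⁆ hS.Carrier), ∀ p : sa K (Fin 3) × H3 K × H3 K × H3 K,
        ∃ u : hL.Carrier, hL.val u = titsQuaternionAct K p ∧
          hS.val (χ u) = matQuaternionSa K p := by
  exact IsLie.exists_lieEquiv_of_param (b := matBracket K (Fin 3 ⊕ Fin 3))
    (W := TitsSpace K SplitQuaternion) (b' := titsBracket K SplitQuaternion)
    (matQuaternionSa K) (titsQuaternionAct K)
    matQuaternionSa_injective titsQuaternionAct_injective range_matQuaternionSa
    range_titsQuaternionAct exists_bracket_quaternion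
    titsQuaternionAct_bracket_self fun p q r => by rw [titsQuaternionAct_jacobi]

theorem tkkBracket_pair (u v : Module.End ℝ (H3 K) × H3 K) :
    tkkBracket (jordan K (Fin 3)) (u.1, u.2, 0, 0) (v.1, v.2, 0, 0)
      = (commBr _ u.1 v.1 + jordanComm K (Fin 3) u.2 v.2, u.1 v.2 - v.1 u.2, 0, 0) := by
  refine Prod.ext (LinearMap.ext fun X => ?_) (Prod.ext ?_ (Prod.ext ?_ ?_))
  · have : jordanComm K (Fin 3) u.2 v.2
      = commBr (Module.End ℝ (H3 K)) (jordan K (Fin 3) u.2) (jordan K (Fin 3) v.2) := rfl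
    simp [tkkBracket, this]
  · simp [tkkBracket]
  · simp [tkkBracket]
  · simp [tkkBracket]

theorem titsBracket_titsComplex_pair {u v : Module.End ℝ (H3 K) × H3 K} (hu : u.1 ∈ derH3 K)
    (hv : v.1 ∈ derH3 K) :
    titsBracket K SplitComplex (titsComplex K u) (titsComplex K v)
      = titsComplex K (commBr _ u.1 v.1 + jordanComm K (Fin 3) u.2 v.2, u.1 v.2 - v.1 u.2) := by
  rw [titsBracket_titsComplex hu hv, tkkBracket_pair]

/-- The elements (T, a, 0, 0) are closed under `tkkBracket`, so this is a special case of
`tkkBracket_jacobi`. -/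
theorem titsComplex_jacobi {u v w : Module.End ℝ (H3 K) × H3 K}
    (hu : u.1 ∈ derH3 K) (hv : v.1 ∈ derH3 K) (hw : w.1 ∈ derH3 K) :
    titsBracket K SplitComplex (titsComplex K u)
        (titsBracket K SplitComplex (titsComplex K v) (titsComplex K w))
      = titsBracket K SplitComplex
          (titsBracket K SplitComplex (titsComplex K u) (titsComplex K v))
          (titsComplex K w)
        + titsBracket K SplitComplex (titsComplex K v)
          (titsBracket K SplitComplex (titsComplex K u) (titsComplex K w)) := by
  have hmem {u v : Module.End ℝ (H3 K) × H3 K} (hu : u.1 ∈ derH3 K) (hv : v.1 ∈ derH3 K) :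
      commBr _ u.1 v.1 + jordanComm K (Fin 3) u.2 v.2 ∈ derH3 K :=
    Submodule.add_mem _ (commBr_mem_derivations hu hv) (jordanComm_mem_derH3 _ _)
  have key := tkkBracket_jacobi (m := jordan K (Fin 3)) jordan_comm jordan_identity_linearized_H3
    (x := (u.1, u.2, 0, 0)) (y := (v.1, v.2, 0, 0)) (z := (w.1, w.2, 0, 0)) hu hv hw
  rw [tkkBracket_pair, tkkBracket_pair, tkkBracket_pair] at key
  have key := congrArg (fun t => (t.1, t.2.1)) key
  rw [titsBracket_titsComplex_pair hv hw, titsBracket_titsComplex_pair hu hv,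
    titsBracket_titsComplex_pair hu hw, titsBracket_titsComplex hu (hmem hv hw),
    titsBracket_titsComplex (hmem hu hv) hw, titsBracket_titsComplex hv (hmem hu hw), ← map_add]
  exact congrArg _ key

variable (K) in
/-- The map `((A, D), H) ↦ (A + H, D)` from `sa(3, K) ⊕ H₃'(K)` to `sl(3, K)`. -/
noncomputable def matComplex : (sa K (Fin 3) × hermTraceless K (Fin 3)) →ₗ[ℝ] MatEnd K (Fin 3) :=
  (sa K (Fin 3)).subtype.coprod
    (LinearMap.inl ℝ _ _ ∘ₗ (herm K (Fin 3)).subtype ∘ₗ (hermTraceless K (Fin 3)).subtype)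

theorem matComplex_apply (p : sa K (Fin 3) × hermTraceless K (Fin 3)) :
    matComplex K p = p.1.1 + (p.2.1.1, 0) := rfl

/-- The mixed terms are plain commutators [A,H] with D applied to the entries of H, since both
corrections vanish there; they form the hermitian part of the result. -/
theorem matBracket_matComplex (p q : sa K (Fin 3) × hermTraceless K (Fin 3)) :
    matBracket K (Fin 3) (matComplex K p) (matComplex K q)
      = (matBracket K (Fin 3) p.1.1 q.1.1 + matBracket K (Fin 3) (p.2.1.1, 0) (q.2.1.1, 0))
        + ((act K (Fin 3) p.1.1 q.2.1 - act K (Fin 3) q.1.1 p.2.1).1, 0) := by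
  rw [matComplex_apply, matComplex_apply, map_add, map_add, LinearMap.add_apply,
    LinearMap.add_apply, matBracket_sa_herm p.1.2, matBracket_swap q.1.1 (p.2.1.1, 0),
    matBracket_sa_herm q.1.2]
  have e : (((act K (Fin 3) p.1.1 q.2.1 - act K (Fin 3) q.1.1 p.2.1).1, 0) : MatEnd K (Fin 3))
      = ((act K (Fin 3) p.1.1 q.2.1).1, 0) - ((act K (Fin 3) q.1.1 p.2.1).1, 0) :=
    Prod.ext rfl (sub_zero _).symm
  rw [e]
  abel

theorem matComplex_injective : Function.Injective (matComplex K) := by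
  refine (injective_iff_map_eq_zero _).mpr fun p h => ?_
  obtain ⟨⟨hA, hAt⟩, hD⟩ := mem_sa.mp p.1.2
  have hH : dagger K (Fin 3) p.2.1.1 = p.2.1.1 := p.2.1.2
  have h1 : p.1.1.1 + p.2.1.1 = 0 := congrArg Prod.fst h
  have h2 : p.1.1.2 + 0 = 0 := congrArg Prod.snd h
  have h3 := congrArg (dagger K (Fin 3)) h1
  rw [map_add, hA, hH, map_zero] at h3
  have h4 : (2 : ℝ) • p.2.1.1 = 0 := by
    linear_combination (norm := module) h1 + h3
  have h5 : p.2.1.1 = 0 := (smul_eq_zero.mp h4).resolve_left two_ne_zero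
  rw [h5, add_zero] at h1
  rw [add_zero] at h2
  exact Prod.ext (Subtype.ext (Prod.ext h1 h2)) (Subtype.ext (Subtype.ext h5))

theorem range_matComplex : LinearMap.range (matComplex K) = sl K (Fin 3) := by
  refine le_antisymm ?_ fun u hu => ?_
  · rintro _ ⟨p, rfl⟩
    obtain ⟨⟨hA, hAt⟩, hD⟩ := mem_sa.mp p.1.2
    have hH : p.2.1.1.trace = 0 := p.2.2
    refine ⟨?_, ?_⟩
    · change (p.1.1.1 + p.2.1.1).trace = 0
      rw [Matrix.trace_add, hAt, hH, add_zero]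
    · exact Submodule.add_mem _ hD (Submodule.zero_mem _)
  · have ht : u.1.trace = 0 := hu.1
    have hdt : (dagger K (Fin 3) u.1).trace = 0 := by rw [trace_dagger, ht, map_zero]
    -- The antihermitian and the hermitian part of the matrix.
    refine ⟨(⟨((1 / 2 : ℝ) • (u.1 - dagger K (Fin 3) u.1), u.2), ⟨?_, ?_⟩, hu.2⟩,
      ⟨hermPart K (Fin 3) u.1, ?_⟩), ?_⟩
    · dsimp only
      rw [map_smul, map_sub, dagger_dagger, ← smul_neg, neg_sub]
    · dsimp only
      rw [Matrix.trace_smul, Matrix.trace_sub, ht, hdt, sub_zero, smul_zero]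
    · change (hermPart K (Fin 3) u.1).1.trace = 0
      rw [hermPart_coe, Matrix.trace_smul, Matrix.trace_add, ht, hdt, add_zero, smul_zero]
    · rw [matComplex_apply]
      refine Prod.ext ?_ (add_zero _)
      change (1 / 2 : ℝ) • (u.1 - dagger K (Fin 3) u.1) + (hermPart K (Fin 3) u.1).1 = u.1
      rw [hermPart_coe]
      module

theorem titsBracket_titsComplex_self {u : Module.End ℝ (H3 K) × H3 K} (hu : u.1 ∈ derH3 K) :
    titsBracket K SplitComplex (titsComplex K u) (titsComplex K u) = 0 := by
  rw [titsBracket_titsComplex hu hu, tkkBracket_self (m := jordan K (Fin 3)) _ jordan_comm]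
  exact map_zero (titsComplex K)

variable (K) in
/-- The map `(u, H) ↦ T + H ⊗ i`, with the derivation `T` of `H₃(K)` that is given by `u`. -/
noncomputable def titsComplexAct : (sa K (Fin 3) × hermTraceless K (Fin 3)) →ₗ[ℝ]
    TitsSpace K SplitComplex :=
  titsComplex K ∘ₗ
    (act K (Fin 3) ∘ₗ (sa K (Fin 3)).subtype).prodMap (hermTraceless K (Fin 3)).subtype

theorem titsComplexAct_apply (p : sa K (Fin 3) × hermTraceless K (Fin 3)) :
    titsComplexAct K p = titsComplex K (act K (Fin 3) p.1.1, p.2.1) := rfl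

theorem titsComplexAct_injective : Function.Injective (titsComplexAct K) := by
  refine (injective_iff_map_eq_zero _).mpr fun p h => ?_
  rw [titsComplexAct_apply] at h
  obtain ⟨h1, h2⟩ := eq_zero_of_titsComplex p.2.2 h
  refine Prod.ext (Subtype.ext ?_) (Subtype.ext h2)
  exact act_injOn p.1.2 (Submodule.zero_mem _) (h1.trans (map_zero _).symm)

theorem exists_bracket_complex (p q : sa K (Fin 3) × hermTraceless K (Fin 3)) :
    ∃ r, matBracket K (Fin 3) (matComplex K p) (matComplex K q) = matComplex K r ∧
      titsBracket K SplitComplex (titsComplexAct K p) (titsComplexAct K q)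
        = titsComplexAct K r := by
  refine ⟨(⟨_, Submodule.add_mem _ (matBracket_mem_sa p.1.2 q.1.2)
    (matBracket_herm_mem_sa p.2.1 q.2.1)⟩, ⟨_, Submodule.sub_mem _
      (mem_hermTraceless.mpr (hermTrace_act p.1.2 q.2.1))
      (mem_hermTraceless.mpr (hermTrace_act q.1.2 p.2.1))⟩), matBracket_matComplex p q, ?_⟩
  rw [titsComplexAct_apply, titsComplexAct_apply, titsComplexAct_apply,
    titsBracket_titsComplex_pair (act_mem_derH3 p.1.2) (act_mem_derH3 q.1.2), map_add,
    act_matBracket p.1.2 q.1.2, act_matBracket_herm]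

theorem range_titsComplexAct : LinearMap.range (titsComplexAct K) = L3 K SplitComplex := by
  refine le_antisymm ?_ fun u hu => ?_
  · rintro _ ⟨p, rfl⟩
    exact titsComplex_mem (act_mem_derH3 p.1.2)
  · obtain ⟨⟨T, H⟩, hv, hv2, rfl⟩ := exists_titsComplex_eq hu
    obtain ⟨w, hw, rfl⟩ := exists_act_eq hv
    exact ⟨(⟨w, hw⟩, ⟨H, hv2⟩), rfl⟩

theorem titsComplexAct_bracket_self (p : sa K (Fin 3) × hermTraceless K (Fin 3)) :
    titsBracket K SplitComplex (titsComplexAct K p) (titsComplexAct K p) = 0 := by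
  rw [titsComplexAct_apply]
  exact titsBracket_titsComplex_self (u := (_, _)) (act_mem_derH3 p.1.2)

theorem titsComplexAct_jacobi (p q r : sa K (Fin 3) × hermTraceless K (Fin 3)) :
    titsBracket K SplitComplex (titsComplexAct K p)
        (titsBracket K SplitComplex (titsComplexAct K q) (titsComplexAct K r))
      = titsBracket K SplitComplex 
          (titsBracket K SplitComplex (titsComplexAct K p) (titsComplexAct K q)) (titsComplexAct K r)
        + titsBracket K SplitComplex (titsComplexAct K q)
          (titsBracket K SplitComplex (titsComplexAct K p) (titsComplexAct K r)) := by
  rw [titsComplexAct_apply, titsComplexAct_apply, titsComplexAct_apply]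
  exact titsComplex_jacobi (u := (_, _)) (v := (_, _)) (w := (_, _)) (act_mem_derH3 p.1.2)
    (act_mem_derH3 q.1.2) (act_mem_derH3 r.1.2)

variable (K) in
theorem exists_lieEquiv_sl :
    ∃ (hL : IsLie (titsBracket K SplitComplex) (L3 K SplitComplex))
      (hS : IsLie (matBracket K (Fin 3)) (sl K (Fin 3)))
      (φ : hL.Carrier ≃ₗ⁅ℝ⁆ hS.Carrier), ∀ p : sa K (Fin 3) × hermTraceless K (Fin 3),
        ∃ u : hL.Carrier, hL.val u = titsComplexAct K p ∧ hS.val (φ u) = matComplex K p := by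
  refine IsLie.exists_lieEquiv_of_param (W := TitsSpace K SplitComplex)
    (b := matBracket K (Fin 3)) (b' := titsBracket K SplitComplex) (matComplex K)
    (titsComplexAct K) matComplex_injective titsComplexAct_injective ?_ ?_
    (fun p q => ?_) (fun p => ?_) fun p q r => ?_
  · rw [range_matComplex]
  · rw [range_titsComplexAct]
  · obtain ⟨r, h, h'⟩ := exists_bracket_complex p q
    exact ⟨r, by rw [h], by rw [h']⟩
  · rw [titsComplexAct_bracket_self]
  · rw [titsComplexAct_jacobi]

end Isomorphisms

end CompositionAlgebra

open CompositionAlgebra in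
theorem theorem8 {K : Type*} [NonAssocRing K] [Module ℝ K] [IsScalarTower ℝ K K]
    [SMulCommClass ℝ K K] [CompositionAlgebra K] (hK : ∀ x : K, x ≠ 0 → 0 < normSq x) :
    (∃ (hL : IsLie (titsBracket K ℝ) (L3 K ℝ)) (hS : IsLie (matBracket K (Fin 3)) (sa K (Fin 3)))
      (ψ : hL.Carrier ≃ₗ⁅ℝ⁆ hS.Carrier),
      ∀ A ∈ antihermTraceless K (Fin 3), ∀ D ∈ der K,
        ∃ u : hL.Carrier, ∃ T : Module.End ℝ (H3 K), ActsAs T A D ∧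
          hL.val u = ((T, 0, 0) : TitsSpace K ℝ) ∧ hS.val (ψ u) = (A, D)) ∧
    (∃ (hL : IsLie (titsBracket K SplitComplex) (L3 K SplitComplex))
      (hS : IsLie (matBracket K (Fin 3)) (sl K (Fin 3))) (φ : hL.Carrier ≃ₗ⁅ℝ⁆ hS.Carrier),
      ∀ A ∈ antihermTraceless K (Fin 3), ∀ D ∈ der K, ∀ H ∈ hermTraceless K (Fin 3),
        ∃ u : hL.Carrier, ∃ T : Module.End ℝ (H3 K), ActsAs T A D ∧
          hL.val u = ((T, H ⊗ₜ[ℝ] SplitComplex.i, 0) : TitsSpace K SplitComplex) ∧ hS.val (φ u) = (A + H.1, D)) ∧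
    (∃ (hL : IsLie (titsBracket K SplitQuaternion) (L3 K SplitQuaternion))
      (hS : IsLie (matBracket K (Fin 3 ⊕ Fin 3)) (sp K (Fin 3)))
      (χ : hL.Carrier ≃ₗ⁅ℝ⁆ hS.Carrier),
      ∀ A ∈ antihermTraceless K (Fin 3), ∀ D ∈ der K,
      ∀ H₁ ∈ hermTraceless K (Fin 3), ∀ H₂ ∈ hermTraceless K (Fin 3),
      ∀ H₃ ∈ hermTraceless K (Fin 3), ∀ r₁ r₂ r₃ : ℝ,
        ∃ u : hL.Carrier, ∃ T : Module.End ℝ (H3 K), ActsAs T A D ∧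
          hL.val u =
            ((T, H₁ ⊗ₜ[ℝ] SplitQuaternion.i + H₂ ⊗ₜ[ℝ] SplitQuaternion.j
                + H₃ ⊗ₜ[ℝ] SplitQuaternion.k,
              r₁ • commBr SplitQuaternion SplitQuaternion.i + r₂ • commBr SplitQuaternion SplitQuaternion.j
                + r₃ • commBr SplitQuaternion SplitQuaternion.k) : TitsSpace K SplitQuaternion) ∧
          hS.val (χ u) =
            (Matrix.fromBlocks
              (A + (H₁.1 + r₁ • 1)) ((H₂.1 + r₂ • 1) + (H₃.1 + r₃ • 1))
              ((H₂.1 + r₂ • 1) - (H₃.1 + r₃ • 1)) (A - (H₁.1 + r₁ • 1)), D)) := by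
  refine ⟨?_, ?_, ?_⟩
  · obtain ⟨hL, hS, ψ, h⟩ := exists_lieEquiv_sa K
    refine ⟨hL, hS, ψ, fun A hA D hD => ?_⟩
    obtain ⟨u, hu, hu'⟩ := h ⟨(A, D), hA, hD⟩
    exact ⟨u, act K (Fin 3) (A, D), actsAs_act hA hD, hu, hu'⟩
  · obtain ⟨hL, hS, φ, h⟩ := exists_lieEquiv_sl K
    refine ⟨hL, hS, φ, fun A hA D hD H hH => ?_⟩
    obtain ⟨u, hu, hu'⟩ := h (⟨(A, D), hA, hD⟩, ⟨H, hH⟩)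
    refine ⟨u, act K (Fin 3) (A, D), actsAs_act hA hD, hu.trans (titsComplex_of_mem _ hH), ?_⟩
    rw [hu', matComplex_apply]
    exact Prod.ext rfl (add_zero D)
  · obtain ⟨hL, hS, χ, h⟩ := exists_lieEquiv_sp K
    refine ⟨hL, hS, χ, fun A hA D hD H₁ h₁ H₂ h₂ H₃ h₃ r₁ r₂ r₃ => ?_⟩
    -- The parameters are the matrices S_m = H_m + r_m I: their trace parts become the coefficients
    -- r_m of the inner derivations on Tits's side.
    obtain ⟨u, hu, hu'⟩ := h (⟨(A, D), hA, hD⟩, H₁ + r₁ • hermOne K (Fin 3),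
      H₂ + r₂ • hermOne K (Fin 3), H₃ + r₃ • hermOne K (Fin 3))
    refine ⟨u, act K (Fin 3) (A, D), actsAs_act hA hD,
      hu.trans (titsQuaternion_add_smul_one _ h₁ h₂ h₃ r₁ r₂ r₃), ?_⟩
    rw [hu', matQuaternionSa_apply, matQuaternion_eq]
    rfl
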